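/- All graphs are finite and simple. Let $\mathcal M$ be a matroid on the edges of complete graphs, with rank function $\mathrm{rank}$. Write $\mathcal R_3$ for the generic 3-dimensional rigidity matroid and $\mathcal M_{K_5}$ for the generic $C_2^1$-cofactor matroid. A graph is *independent* if its edge set is; it is *rigid* if its edges span the complete graph on its vertex set; it is *nucleation-free* if it has no rigid subgraph on at least five vertices. **Covers.** A *2-thin cover* of $G$ is a family $\mathcal X$ of subsets (*clusters*) of $V(G)$, each of size at least $2$, any two different ones meeting in at most two vertices and neither containing the other, such that each edge of $G$ lies in some cluster. Its *shared set* $S(\mathcal X)$ consists of all pairs $uv$ of distinct vertices such that $\{u,v\}$ is the intersection of two different clusters; $\mathcal X$ is *independent* if $S(\mathcal X)$ is. Let $d(\mathcal X,e)$ be the number of clusters containing $e$. For a set $P$ of pairs put $$IE_P(G,\mathcal X)=\sum_{X\in\mathcal X}\mathrm{rank}\big((G\cup P)[X]\big)-\sum_{e\in P}\big(d(\mathcal X,e)-1\big),\qquad IE(G,\mathcal X)=IE_{S(\mathcal X)}(G,\mathcal X).$$ **Safe splits and safe base graphs.** A *nonedge-split* of $G$ at a nonedge $ab$ deletes $a,b$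 and adds new vertices $a_1,a_2,b_1,b_2$ such that the neighbourhoods of $a_1,a_2$ partition that of $a$ and the neighbourhoods of $b_1,b_2$ partition that of $b$ (parts may be empty); call the result $G^s$. For a cluster $X$ let $X'$ be obtained from $X$ by replacing $a$ (if $a\in X$) by those of $a_1,a_2$ that are adjacent in $G^s$ to some vertex of $X$, and likewise for $b$. The split is *safe* on $(G,\mathcal X)$ if $ab\in S(\mathcal X)$ and (1) whenever $X\in\mathcal X$ contains a nonedge belonging to $S(\mathcal X)$, neither $\{a_1,a_2\}$ nor $\{b_1,b_2\}$ is contained in $X'$; (2) whenever $X,Y\in\mathcal X$, $X\cap Y=\{a,u\}$, $u\ne b$, and $au$ is a nonedge in $S(\mathcal X)$, then $X'\cap\{a_1,a_2\}=Y'\cap\{a_1,a_2\}$, and the same with $a,b$ interchanged. The *safe split cover* $\mathcal X^s$ consists of all $X'$ of size greater than two that contain neither $\{a_1,a_2\}$ nor $\{b_1,b_2\}$, and of the end sets of all edges of $G^s$ that lie in none of these. $G$ is a *safe base graph* if it is independent and has an independent 2-thin cover $\mathcal X$ with $\mathrm{rank}(G)=IE(G,\mathcal X)$ such that some nonedge $ab\in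 S(\mathcal X)$ admits a safe nonedge-split on $(G,\mathcal X)$. Given a graph with a cover and a set of *gluing vertices*, a *key gluing pair* is a pair of distinct gluing vertices contained in some cluster. **Safe double-butterfly split-and-glue.** A butterfly is $K_5$ minus two non-incident edges. The double-butterfly $D$ is the union of the two butterflies on $\{a'_i,b'_i,u,v,c_i\}$ with missing edges $a'_ib'_i$ and $uv$ ($i=1,2$); its gluing vertices are $a'_1,a'_2,b'_1,b'_2$. A *safe ear cover* of $D$ is an independent 2-thin cover $\mathcal Y$ of $D$ such that each cluster contains at most two gluing vertices, the set consisting of $S(\mathcal Y)$ and all pairs of distinct gluing vertices is independent, and $\mathrm{rank}(D)=IE_P(D,\mathcal Y)-1$, where $P$ is the union of $S(\mathcal Y)$ and the set of key gluing pairs. A *safe double-butterfly split-and-glue* on a safe base graph $G$ takes a cover $\mathcal X$ and a nonedge $ab$ as in the definition of a safe base graph, a safe nonedge-split $G^s$ on $(G,\mathcal X)$ at $ab$, and a safe ear cover of $D$, and identifies the gluing vertices of $D$ bijectively with $a_1,a_2,b_1,b_2$ so that the key gluing pairs of $D$ correspond exactly to those of $(G^s,\mathcal X^s)$. **Other constructions.**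 A *$k$-sum* of $G$ and $H$ glues $G$ and $H$ along a complete subgraph $K_k$ of each (without deleting edges). A *Henneberg-I extension* adds a new vertex adjacent to the three vertices of a set $W\subseteq V(G)$. **Corollary.** Let $G$ be a nucleation-free safe base graph. (i) For $\mathcal M=\mathcal R_3$ and for $\mathcal M=\mathcal M_{K_5}$, every graph obtained from $G$ by a safe double-butterfly split-and-glue is a nucleation-free safe base graph. (ii) For $\mathcal M=\mathcal R_3$, $\mathcal M=\mathcal M_{K_5}$ and, more generally, every abstract 3-dimensional rigidity matroid $\mathcal M$: if $H$ is independent and nucleation-free, then a $k$-sum of $G$ and $H$ is a nucleation-free safe base graph whenever $k\in\{0,1,2\}$, or $k=3$ and the base triangle is not contained in a $K_4$ subgraph of $G$ or is not contained in a $K_4$ subgraph of $H$. (iii) For the same matroids as in (ii), a Henneberg-I extension of $G$ whose base vertex set $W$ is not contained in a $K_4$ subgraph of $G$ is a nucleation-free safe base graph. -/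

import Mathlib

open Set

/-! ### Generic matroids on the edges of a complete graph -/

/-- If two finite families of rows with polynomial entries are each linearly independent at some
point, then they are simultaneously linearly independent at some common point. -/
theorem exists_common_linearIndepOn {α J V : Type*} {d : ℕ} [Finite J]
    (row : (V → Fin d → ℝ) → α → J → ℝ)
    (hrow : ∀ a j, ∃ P : MvPolynomial (V × Fin d) ℝ,
      ∀ p, row p a j = MvPolynomial.eval (fun x => p x.1 x.2) P)
    {I K : Set α} (hI : I.Finite) (hK : K.Finite)
    (h₁ : ∃ p, LinearIndepOn ℝ (row p) I) (h₂ : ∃ p, LinearIndepOn ℝ (row p) K) :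
    ∃ p, LinearIndepOn ℝ (row p) I ∧ LinearIndepOn ℝ (row p) K := by
  classical
  have := Fintype.ofFinite J
  choose P hP using hrow
  have key : ∀ {L : Set α}, L.Finite → ∃ Q : MvPolynomial (V × Fin d) ℝ,
      ∀ p, MvPolynomial.eval (fun x => p x.1 x.2) Q ≠ 0 ↔ LinearIndepOn ℝ (row p) L := by
    intro L hL
    have := hL.fintype
    let A : Matrix L J (MvPolynomial (V × Fin d) ℝ) := Matrix.of fun a j => P a j
    refine ⟨(A * A.transpose).det, fun p => ?_⟩
    let B : Matrix L J ℝ := Matrix.of fun a j => row p a j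
    have hB : (MvPolynomial.eval (fun x => p x.1 x.2)) (A * A.transpose).det
        = (B * B.transpose).det := by
      rw [RingHom.map_det]
      congr 1
      ext a b
      simp [A, B, Matrix.mul_apply, hP]
    rw [hB, ← isUnit_iff_ne_zero, ← Matrix.isUnit_iff_isUnit_det,
      ← Matrix.linearIndependent_rows_iff_isUnit, linearIndependent_iff_card_eq_finrank_span,
      show LinearIndepOn ℝ (row p) L ↔ LinearIndependent ℝ B.row from Iff.rfl,
      linearIndependent_iff_card_eq_finrank_span]
    have h1 := Matrix.rank_eq_finrank_span_row (B * B.transpose)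
    have h2 := Matrix.rank_eq_finrank_span_row B
    rw [Matrix.rank_self_mul_transpose] at h1
    unfold Set.finrank
    rw [← h1, ← h2]
  obtain ⟨Q₁, hQ₁⟩ := key hI
  obtain ⟨Q₂, hQ₂⟩ := key hK
  obtain ⟨p₁, hp₁⟩ := h₁
  obtain ⟨p₂, hp₂⟩ := h₂
  have hne₁ : Q₁ ≠ 0 := fun h => (hQ₁ p₁).2 hp₁ (by simp [h])
  have hne₂ : Q₂ ≠ 0 := fun h => (hQ₂ p₂).2 hp₂ (by simp [h])
  by_contra hcon
  refine mul_ne_zero hne₁ hne₂ (MvPolynomial.funext fun z => ?_)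
  by_contra hz
  rw [map_zero, map_mul] at hz
  refine hcon ⟨fun v i => z (v, i), (hQ₁ _).1 ?_, (hQ₂ _).1 ?_⟩
  · exact left_ne_zero_of_mul hz
  · exact right_ne_zero_of_mul hz

/-- The generic matroid of a finite family of rows with polynomial entries: a subset of `E` is
independent iff its rows are linearly independent at some point (equivalently, at every generic
point). -/
noncomputable def genericRowMatroid {α J V : Type*} {d : ℕ} [Finite α] [Finite J] (E : Set α)
    (row : (V → Fin d → ℝ) → α → J → ℝ)
    (hrow : ∀ a j, ∃ P : MvPolynomial (V × Fin d) ℝ,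
      ∀ p, row p a j = MvPolynomial.eval (fun x => p x.1 x.2) P) : Matroid α :=
  (IndepMatroid.ofFinite (E := E) (Set.toFinite E)
    (fun I => I ⊆ E ∧ ∃ p, LinearIndepOn ℝ (row p) I)
    ⟨Set.empty_subset _, 0, linearIndepOn_empty _ _⟩
    (fun _ _ hJ hIJ => ⟨hIJ.trans hJ.1, hJ.2.imp fun _ h => h.mono hIJ⟩)
    (by
      classical
      rintro I K ⟨hIE, hI⟩ ⟨hKE, hK⟩ hlt
      obtain ⟨p, hpI, hpK⟩ := exists_common_linearIndepOn row hrow I.toFinite K.toFinite hI hK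
      by_contra hcon
      push Not at hcon
      have hsub : ∀ e ∈ K, row p e ∈ Submodule.span ℝ (row p '' I) := by
        intro e he
        by_contra hns
        have heI : e ∉ I := fun h => hns (Submodule.subset_span ⟨e, h, rfl⟩)
        exact hcon e he heI (Set.insert_subset (hKE he) hIE) p (hpI.insert hns)
      have := Fintype.ofFinite α
      have h1 : Submodule.span ℝ (row p '' K) ≤ Submodule.span ℝ (row p '' I) := by
        rw [Submodule.span_le]
        rintro _ ⟨e, he, rfl⟩
        exact hsub e he
      have h2 := Submodule.finrank_mono h1
      have hc : ∀ {L : Set α}, LinearIndepOn ℝ (row p) L →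
          Module.finrank ℝ (Submodule.span ℝ (row p '' L)) = L.ncard := by
        intro L hL
        have := finrank_span_eq_card (b := fun x : L => row p x) hL
        rw [← Nat.card_eq_fintype_card, Nat.card_coe_set_eq] at this
        rw [← this, Set.image_eq_range]
      rw [hc hpI, hc hpK] at h2
      omega)
    (fun _ h => h.1)).matroid

/-- The coefficient vector of an edge in the rigidity matrix of a placement in 3-space, for an edge
whose ends are placed at `x` and `y`. -/
def rigidityCoeff (x y : Fin 3 → ℝ) : Fin 3 → ℝ := fun i => x i - y i

/-- The coefficient vector of an edge in the `C₂¹`-cofactor matrix of a placement in the plane, for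
an edge whose ends are placed at `x` and `y`. -/
def cofactorCoeff (x y : Fin 2 → ℝ) : Fin 3 → ℝ :=
  ![(x 0 - y 0) ^ 2, (x 0 - y 0) * (x 1 - y 1), (x 1 - y 1) ^ 2]

open Classical in
/-- The row of the pair `e = uv` in the matrix of the placement `p`, which has three columns per
vertex: it is `coeff (p u) (p v)` at `u`, `-coeff (p u) (p v)` at `v` and `0` at all other vertices.
(The orientation of `e` matters at most for the sign of the row.) -/
noncomputable def edgeRow {V : Type*} {d : ℕ} (coeff : (Fin d → ℝ) → (Fin d → ℝ) → Fin 3 → ℝ)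
    (p : V → Fin d → ℝ) (e : Sym2 V) : V × Fin 3 → ℝ := fun wi =>
  (if wi.1 = (Quot.out e).1 then coeff (p (Quot.out e).1) (p (Quot.out e).2) wi.2 else 0) -
  (if wi.1 = (Quot.out e).2 then coeff (p (Quot.out e).1) (p (Quot.out e).2) wi.2 else 0)

theorem edgeRow_polynomial {V : Type*} {d : ℕ} (coeff : (Fin d → ℝ) → (Fin d → ℝ) → Fin 3 → ℝ)
    (hc : ∀ (u v : V) (i : Fin 3), ∃ P : MvPolynomial (V × Fin d) ℝ,
      ∀ p : V → Fin d → ℝ, coeff (p u) (p v) i = MvPolynomial.eval (fun x => p x.1 x.2) P)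
    (e : Sym2 V) (wi : V × Fin 3) :
    ∃ P : MvPolynomial (V × Fin d) ℝ,
      ∀ p, edgeRow coeff p e wi = MvPolynomial.eval (fun x => p x.1 x.2) P := by
  classical
  obtain ⟨P, hP⟩ := hc (Quot.out e).1 (Quot.out e).2 wi.2
  refine ⟨(if wi.1 = (Quot.out e).1 then P else 0) - (if wi.1 = (Quot.out e).2 then P else 0),
    fun p => ?_⟩
  simp only [edgeRow, hP, map_sub]
  split_ifs <;> simp

theorem rigidityCoeff_polynomial {V : Type*} (u v : V) (i : Fin 3) :
    ∃ P : MvPolynomial (V × Fin 3) ℝ, ∀ p : V → Fin 3 → ℝ,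
      rigidityCoeff (p u) (p v) i = MvPolynomial.eval (fun x => p x.1 x.2) P :=
  ⟨MvPolynomial.X (u, i) - MvPolynomial.X (v, i), fun p => by simp [rigidityCoeff]⟩

theorem cofactorCoeff_polynomial {V : Type*} (u v : V) (i : Fin 3) :
    ∃ P : MvPolynomial (V × Fin 2) ℝ, ∀ p : V → Fin 2 → ℝ,
      cofactorCoeff (p u) (p v) i = MvPolynomial.eval (fun x => p x.1 x.2) P := by
  let D : Fin 2 → MvPolynomial (V × Fin 2) ℝ := fun j =>
    MvPolynomial.X (u, j) - MvPolynomial.X (v, j)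
  fin_cases i
  · exact ⟨D 0 ^ 2, fun p => by simp [D, cofactorCoeff]⟩
  · exact ⟨D 0 * D 1, fun p => by simp [D, cofactorCoeff]⟩
  · exact ⟨D 1 ^ 2, fun p => by simp [D, cofactorCoeff]⟩

/-- The pairs of distinct elements of `U`, i.e. the edge set of the complete graph on `U`. -/
def pairsIn {V : Type*} (U : Set V) : Set (Sym2 V) :=
  {e | ¬ e.IsDiag ∧ ∀ v ∈ e, v ∈ U}

/-- The 3-dimensional generic rigidity matroid `R₃` on the edges of the complete graph with vertex
set `V`: a set of edges is independent iff the rows of the rigidity matrix of some (equivalently,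
any generic) placement in 3-space are linearly independent. -/
noncomputable def rigidityMatroid (V : Type*) [Finite V] : Matroid (Sym2 V) :=
  genericRowMatroid (pairsIn (Set.univ : Set V)) (edgeRow rigidityCoeff)
    (edgeRow_polynomial _ rigidityCoeff_polynomial)

/-- The generic `C₂¹`-cofactor matroid on the edges of the complete graph with vertex set `V`, which
is the maximal matroid `M_{K₅}` in which every `K₅` is a circuit. -/
noncomputable def cofactorMatroid (V : Type*) [Finite V] : Matroid (Sym2 V) :=
  genericRowMatroid (pairsIn (Set.univ : Set V)) (edgeRow cofactorCoeff)
    (edgeRow_polynomial _ cofactorCoeff_polynomial)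

/-- Names for the two generic matroids above. -/
inductive GenericKind
  | rigidity
  | cofactor

/-- The generic matroid `R₃` or `M_{K₅}` on the edges of the complete graph with vertex set `V`. -/
noncomputable def genericMatroid (κ : GenericKind) (V : Type*) [Finite V] : Matroid (Sym2 V) :=
  match κ with
  | .rigidity => rigidityMatroid V
  | .cofactor => cofactorMatroid V

/-- The set of vertices covered by a set of edges. -/
def edgeSupport {V : Type*} (E : Set (Sym2 V)) : Set V := {v | ∃ e ∈ E, v ∈ e}

/-- Graver's abstract 3-dimensional rigidity matroids on the complete graph with vertex set `V`. -/
structure IsAbstractRigidityMatroid {V : Type*} (M : Matroid (Sym2 V)) : Prop where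
  ground_eq : M.E = pairsIn Set.univ
  closure_union_subset : ∀ E F : Set (Sym2 V), E ⊆ M.E → F ⊆ M.E →
    (edgeSupport E ∩ edgeSupport F).ncard < 3 →
      M.closure (E ∪ F) ⊆ pairsIn (edgeSupport E) ∪ pairsIn (edgeSupport F)
  closure_union_eq : ∀ E F : Set (Sym2 V), E ⊆ M.E → F ⊆ M.E →
    M.closure E = pairsIn (edgeSupport E) → M.closure F = pairsIn (edgeSupport F) →
    3 ≤ (edgeSupport E ∩ edgeSupport F).ncard →
      M.closure (E ∪ F) = pairsIn (edgeSupport E ∪ edgeSupport F)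

/-! ### Graphs, rigidity and nucleations -/

/-- Graphs whose vertices are taken from `V`, i.e. subgraphs of the complete graph on `V`. -/
abbrev GraphOn (V : Type*) := (⊤ : SimpleGraph V).Subgraph

/-- The image of a graph under an injection of vertices. -/
abbrev GraphOn.relabel {V W : Type*} (f : V ↪ W) (G : GraphOn V) : GraphOn W :=
  SimpleGraph.Subgraph.map (SimpleGraph.Embedding.completeGraph f).toHom G

/-- `G` is independent in `M`. -/
def IsIndependent {V : Type*} (M : Matroid (Sym2 V)) (G : GraphOn V) : Prop :=
  M.Indep G.edgeSet

/-- `G` is rigid in `M`: its edges span the complete graph on its vertex set. -/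
def IsRigid {V : Type*} (M : Matroid (Sym2 V)) (G : GraphOn V) : Prop :=
  pairsIn G.verts ⊆ M.closure G.edgeSet

/-- `G` has no rigid subgraph on at least five vertices. -/
def IsNucleationFree {V : Type*} (M : Matroid (Sym2 V)) (G : GraphOn V) : Prop :=
  ¬ ∃ N : GraphOn V, N ≤ G ∧ 5 ≤ N.verts.ncard ∧ IsRigid M N

/-- The (finite) rank of a set of edges, as an integer. -/
noncomputable def edgeRank {V : Type*} (M : Matroid (Sym2 V)) (E : Set (Sym2 V)) : ℤ :=
  ((M.eRk E).toNat : ℤ)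

/-! ### 2-thin covers -/

/-- `X` is a 2-thin cover of `G`. -/
structure IsTwoThinCover {V : Type*} (G : GraphOn V) (X : Set (Set V)) : Prop where
  subset_verts : ∀ Y ∈ X, Y ⊆ G.verts
  two_le : ∀ Y ∈ X, 2 ≤ Y.ncard
  inter_le : ∀ Y ∈ X, ∀ Z ∈ X, Y ≠ Z → (Y ∩ Z).ncard ≤ 2
  not_subset : ∀ Y ∈ X, ∀ Z ∈ X, Y ≠ Z → ¬ Y ⊆ Z
  covers : ∀ u v, G.Adj u v → ∃ Y ∈ X, u ∈ Y ∧ v ∈ Y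

/-- The shared set: all pairs `uv` with `{u, v} = Y ∩ Z` for two different clusters `Y`, `Z`. -/
def sharedSet {V : Type*} (X : Set (Set V)) : Set (Sym2 V) :=
  {e | ∃ u v, u ≠ v ∧ e = s(u, v) ∧ ∃ Y ∈ X, ∃ Z ∈ X, Y ≠ Z ∧ Y ∩ Z = {u, v}}

/-- The number of clusters that contain both ends of `e`. -/
noncomputable def coverDegree {V : Type*} (X : Set (Set V)) (e : Sym2 V) : ℕ :=
  {Y ∈ X | ∀ v ∈ e, v ∈ Y}.ncard

/-- The inclusion-exclusion count of `(G, X)` with the set `P` of pairs in the place of the shared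
set: the sum over the clusters `Y` of the rank of the subgraph of `G ∪ P` induced by `Y`, minus the
sum over `e ∈ P` of `d(X, e) - 1`. -/
noncomputable def inclExclWith {V : Type*} (M : Matroid (Sym2 V)) (G : GraphOn V)
    (X : Set (Set V)) (P : Set (Sym2 V)) : ℤ :=
  (∑ᶠ Y ∈ X, edgeRank M {e ∈ G.edgeSet ∪ P | ∀ v ∈ e, v ∈ Y}) -
    ∑ᶠ e ∈ P, ((coverDegree X e : ℤ) - 1)

/-- The inclusion-exclusion rank count `IE(G, X)`. -/
noncomputable def inclExcl {V : Type*} (M : Matroid (Sym2 V)) (G : GraphOn V)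
    (X : Set (Set V)) : ℤ :=
  inclExclWith M G X (sharedSet X)

/-- The pairs of distinct vertices of `T` contained in some cluster of `X`; for `T` a set of gluing
vertices these are the key gluing pairs. -/
def keyPairs {V : Type*} (T : Set V) (X : Set (Set V)) : Set (Sym2 V) :=
  {e ∈ pairsIn T | ∃ Y ∈ X, ∀ v ∈ e, v ∈ Y}

/-! ### Nonedge-splits -/

/-- Labels for the four vertices `a₁, a₂` (`Sum.inl 0`, `Sum.inl 1`) and `b₁, b₂` (`Sum.inr 0`,
`Sum.inr 1`). -/
abbrev Quad := Fin 2 ⊕ Fin 2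

/-- Vertices of a split graph: old vertices, and the four new vertices. -/
abbrev SplitVertex (V : Type*) := V ⊕ Quad

/-- The copies `a₁`, `a₂` of the first end of the split nonedge. -/
abbrev aCopy (V : Type*) (i : Fin 2) : SplitVertex V := Sum.inr (Sum.inl i)

/-- The copies `b₁`, `b₂` of the second end of the split nonedge. -/
abbrev bCopy (V : Type*) (i : Fin 2) : SplitVertex V := Sum.inr (Sum.inr i)

/-- `Gs` is obtained from `G` by a nonedge-split of the nonedge `ab`. -/
structure IsNonedgeSplit {V : Type*} (G : GraphOn V) (a b : V) (Gs : GraphOn (SplitVertex V)) :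
    Prop where
  mem_left : a ∈ G.verts
  mem_right : b ∈ G.verts
  ne : a ≠ b
  not_adj : ¬ G.Adj a b
  verts_eq : Gs.verts = Sum.inl '' (G.verts \ {a, b}) ∪ Set.range Sum.inr
  adj_old : ∀ x y, x ∉ ({a, b} : Set V) → y ∉ ({a, b} : Set V) →
    (Gs.Adj (Sum.inl x) (Sum.inl y) ↔ G.Adj x y)
  union_left : Gs.neighborSet (aCopy V 0) ∪ Gs.neighborSet (aCopy V 1) =
    Sum.inl '' G.neighborSet a
  disjoint_left : Disjoint (Gs.neighborSet (aCopy V 0)) (Gs.neighborSet (aCopy V 1))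
  union_right : Gs.neighborSet (bCopy V 0) ∪ Gs.neighborSet (bCopy V 1) =
    Sum.inl '' G.neighborSet b
  disjoint_right : Disjoint (Gs.neighborSet (bCopy V 0)) (Gs.neighborSet (bCopy V 1))

/-- The set `X'ᵢ` obtained from the cluster `Y = Xᵢ`: each of `a`, `b` that lies in `Y` is replaced
by those of its copies that are adjacent in the split graph to some vertex of `Y`. -/
def splitCluster {V : Type*} (a b : V) (Gs : GraphOn (SplitVertex V)) (Y : Set V) :
    Set (SplitVertex V) :=
  Sum.inl '' (Y \ {a, b}) ∪
    {x | a ∈ Y ∧ (∃ i, x = aCopy V i) ∧ ∃ y ∈ Y, Gs.Adj x (Sum.inl y)} ∪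
    {x | b ∈ Y ∧ (∃ i, x = bCopy V i) ∧ ∃ y ∈ Y, Gs.Adj x (Sum.inl y)}

/-- Some end of the split nonedge has both its copies in `Z`. -/
def ContainsTwins {V : Type*} (Z : Set (SplitVertex V)) : Prop :=
  (∀ i, aCopy V i ∈ Z) ∨ (∀ i, bCopy V i ∈ Z)

/-- `Gs` is obtained by a safe nonedge-split on `(G, X)` that splits `ab`. -/
structure IsSafeNonedgeSplit {V : Type*} (G : GraphOn V) (X : Set (Set V)) (a b : V)
    (Gs : GraphOn (SplitVertex V)) : Prop extends IsNonedgeSplit G a b Gs where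
  mem_shared : s(a, b) ∈ sharedSet X
  not_twins : ∀ Y ∈ X, (∃ x ∈ Y, ∃ y ∈ Y, s(x, y) ∈ sharedSet X ∧ ¬ G.Adj x y) →
    ¬ ContainsTwins (splitCluster a b Gs Y)
  agree_left : ∀ Y ∈ X, ∀ Z ∈ X, ∀ u, u ≠ b → Y ∩ Z = {a, u} →
    s(a, u) ∈ sharedSet X → ¬ G.Adj a u →
      ∀ i, aCopy V i ∈ splitCluster a b Gs Y ↔ aCopy V i ∈ splitCluster a b Gs Z
  agree_right : ∀ Y ∈ X, ∀ Z ∈ X, ∀ u, u ≠ a → Y ∩ Z = {b, u} →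
    s(b, u) ∈ sharedSet X → ¬ G.Adj b u →
      ∀ i, bCopy V i ∈ splitCluster a b Gs Y ↔ bCopy V i ∈ splitCluster a b Gs Z

/-- The clusters of size greater than two of the safe split cover. -/
def largeSplitClusters {V : Type*} (X : Set (Set V)) (a b : V) (Gs : GraphOn (SplitVertex V)) :
    Set (Set (SplitVertex V)) :=
  {Z | ∃ Y ∈ X, Z = splitCluster a b Gs Y ∧ 2 < Z.ncard ∧ ¬ ContainsTwins Z}

/-- The safe split cover: the large clusters, and the edges of the split graph that lie in no large
cluster. -/
def safeSplitCover {V : Type*} (X : Set (Set V)) (a b : V) (Gs : GraphOn (SplitVertex V)) :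
    Set (Set (SplitVertex V)) :=
  largeSplitClusters X a b Gs ∪
    {P | ∃ x y, Gs.Adj x y ∧ P = {x, y} ∧ ∀ Z ∈ largeSplitClusters X a b Gs, ¬ P ⊆ Z}

/-- `X`, `ab` and `Gs` witness that `G` is a safe base graph. -/
structure IsSafeBaseWitness {V : Type*} (M : Matroid (Sym2 V)) (G : GraphOn V) (X : Set (Set V))
    (a b : V) (Gs : GraphOn (SplitVertex V)) : Prop where
  indep : IsIndependent M G
  cover : IsTwoThinCover G X
  indep_shared : M.Indep (sharedSet X)
  rank_eq : edgeRank M G.edgeSet = inclExcl M G X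
  safe : IsSafeNonedgeSplit G X a b Gs

/-- `G` is a safe base graph. -/
def IsSafeBaseGraph {V : Type*} (M : Matroid (Sym2 V)) (G : GraphOn V) : Prop :=
  ∃ X a b Gs, IsSafeBaseWitness M G X a b Gs

/-! ### Safe ears and the double-butterfly split-and-glue -/

/-- `X` is a safe ear cover of `H` with set `T` of gluing vertices. -/
structure IsSafeEarCover {V : Type*} (M : Matroid (Sym2 V)) (H : GraphOn V) (T : Set V)
    (X : Set (Set V)) : Prop where
  gluing_subset : T ⊆ H.verts
  cover : IsTwoThinCover H X
  indep_shared : M.Indep (sharedSet X)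
  inter_gluing_le : ∀ Y ∈ X, (Y ∩ T).ncard ≤ 2
  indep_union : M.Indep (sharedSet X ∪ pairsIn T)
  rank_eq : edgeRank M H.edgeSet = inclExclWith M H X (sharedSet X ∪ keyPairs T X) - 1

/-- Vertices of the double-butterfly: the four gluing vertices `a'₁, a'₂, b'₁, b'₂` (first summand)
and the vertices `u, v` and `c₁, c₂` (`inr (inl 0)`, `inr (inl 1)`, `inr (inr 0)`,
`inr (inr 1)`). -/
abbrev EarVertex := Quad ⊕ Quad

/-- The vertex set `{a'ᵢ, b'ᵢ, u, v, cᵢ}` of the `i`-th butterfly of the double-butterfly. -/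
def butterflyVerts (i : Fin 2) : Set EarVertex :=
  {Sum.inl (Sum.inl i), Sum.inl (Sum.inr i), Sum.inr (Sum.inl 0), Sum.inr (Sum.inl 1),
    Sum.inr (Sum.inr i)}

/-- The double-butterfly: the union of two butterflies `K₅ - a'ᵢb'ᵢ - uv` sharing exactly the
nonedge `uv`. -/
def doubleButterfly : GraphOn EarVertex where
  verts := Set.univ
  Adj x y := x ≠ y ∧ ∃ i, x ∈ butterflyVerts i ∧ y ∈ butterflyVerts i ∧
    s(x, y) ≠ s(Sum.inl (Sum.inl i), Sum.inl (Sum.inr i)) ∧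
    s(x, y) ≠ s(Sum.inr (Sum.inl 0), Sum.inr (Sum.inl 1))
  adj_sub h := h.1
  edge_vert _ := Set.mem_univ _
  symm := ⟨fun x y ⟨hne, i, hx, hy, h₁, h₂⟩ =>
    ⟨hne.symm, i, hy, hx, by rwa [Sym2.eq_swap], by rwa [Sym2.eq_swap]⟩⟩

/-- Vertices of the graph obtained by gluing a double-butterfly to a split graph: those of the split
graph, and the non-gluing vertices `u, v, c₁, c₂` of the ear. -/
abbrev GluedVertex (V : Type*) := SplitVertex V ⊕ Quad

/-- The inclusion of the ear into the glued graph that identifies the gluing vertex `t` of the ear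
with the vertex `σ t` of the split graph. -/
def earInclusion (V : Type*) (σ : Quad ≃ Quad) : EarVertex ↪ GluedVertex V where
  toFun := Sum.map (fun t => Sum.inr (σ t)) id
  inj' := Sum.map_injective.2 ⟨fun _ _ h => σ.injective (Sum.inr_injective h), fun _ _ h => h⟩

/-- The graph `Gs : H` obtained by gluing the split graph `Gs` and the double-butterfly `H`. -/
def glueDoubleButterfly {V : Type*} (Gs : GraphOn (SplitVertex V)) (σ : Quad ≃ Quad) :
    GraphOn (GluedVertex V) :=
  Gs.relabel Function.Embedding.inl ⊔ doubleButterfly.relabel (earInclusion V σ)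

/-- `G'` is obtained by a safe double-butterfly split-and-glue on the safe base graph `G`: a safe
nonedge-split on `(G, X)`, followed by gluing the double-butterfly along its four gluing vertices in
such a way that the key gluing pairs of the ear correspond to those of the split graph. -/
def IsSafeDoubleButterflySplitAndGlue (κ : GenericKind) {V : Type*} [Finite V] (G : GraphOn V)
    (G' : GraphOn (GluedVertex V)) : Prop :=
  ∃ X a b Gs, IsSafeBaseWitness (genericMatroid κ V) G X a b Gs ∧
  ∃ XH, IsSafeEarCover (genericMatroid κ EarVertex) doubleButterfly (Set.range Sum.inl) XH ∧
  ∃ σ : Quad ≃ Quad,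
    (∀ s t : Quad,
      s((Sum.inl s : EarVertex), Sum.inl t) ∈ keyPairs (Set.range Sum.inl) XH ↔
        s((Sum.inr (σ s) : SplitVertex V), Sum.inr (σ t)) ∈
          keyPairs (Set.range Sum.inr) (safeSplitCover X a b Gs)) ∧
    G' = glueDoubleButterfly Gs σ

/-! ### `k`-sums and Henneberg-I extensions -/

/-- The vertices in `C` are vertices of `G` that are pairwise adjacent. -/
def SpansClique {V : Type*} (G : GraphOn V) (C : Set V) : Prop :=
  C ⊆ G.verts ∧ ∀ x ∈ C, ∀ y ∈ C, x ≠ y → G.Adj x y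

/-- `C` is contained in the vertex set of a `K₄` subgraph of `G`. -/
def IsInKFour {V : Type*} (G : GraphOn V) (C : Set V) : Prop :=
  ∃ K : Set V, K.ncard = 4 ∧ C ⊆ K ∧ SpansClique G K

/-- `G'` is a `k`-sum of `G` and `H`: the two graphs have exactly `k` vertices in common, these span
a complete graph in both of them, and `G'` is their union. -/
structure IsKSum {V : Type*} (k : ℕ) (G H G' : GraphOn V) : Prop where
  ncard_eq : (G.verts ∩ H.verts).ncard = k
  clique_left : SpansClique G (G.verts ∩ H.verts)
  clique_right : SpansClique H (G.verts ∩ H.verts)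
  eq_sup : G' = G ⊔ H

/-- `G'` is obtained from `G` by a Henneberg-I extension with base vertex set `W`, i.e. by adding a
new vertex `w` adjacent to the three vertices of `W`. -/
structure IsHennebergI {V : Type*} (G : GraphOn V) (W : Set V) (w : V) (G' : GraphOn V) :
    Prop where
  ncard_eq : W.ncard = 3
  subset_verts : W ⊆ G.verts
  not_mem : w ∉ G.verts
  verts_eq : G'.verts = insert w G.verts
  adj_iff : ∀ x y, G'.Adj x y ↔ G.Adj x y ∨ (x = w ∧ y ∈ W) ∨ (y = w ∧ x ∈ W)

set_option linter.unusedSectionVars false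

/-! ### Rank and nullity -/

section Rank

variable {V : Type*} [Finite V] {M : Matroid (Sym2 V)} {A B I : Set (Sym2 V)}

/-! The nullity of a set of pairs is its size minus its rank. By submodularity it is superadditive
over sets whose pairwise intersections lie in one fixed independent set. Counting every pair once
for each cluster that contains it rewrites `inclExclWith` as |E ∪ P| minus the sum of the cluster
nullities, whenever P contains the shared set (`inclExclWith_eq`). So the cover of an independent
graph is tight exactly when the cluster nullities add up to the number of shared nonedges
(`rank_eq_inclExcl_iff`). To prove a new cover tight, it is enough to bound nullities from below,
with any convenient P containing the shared set; uncovered edges can be added as two-element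
clusters at no cost (`edgeRank_eq_inclExcl_edgeCompletion`). The existence of a safe split at ab is
also a condition on G and the cover alone: it may be tested on the split that gives all neighbours
to the first copies (`IsSplittableNonedge`).

For sums and Henneberg-I extensions only two matroid properties matter: a new vertex of degree at
most three preserves independence, and independent sets on n ≥ 3 vertices have at most 3n - 6
elements (`HasZeroExtensions`). For independent graphs, nucleation-free then means fewer than 3n - 6
edges on any n ≥ 5 vertices, and the excluded K₄'s are the only way in which the new counts could
become tight. No edge is added between old vertices, so the old large clusters keep the safe nonedge
and still account for all shared nonedges.

For split-and-glue, the copies of a and b are placed at the points of a and b. Adding up the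
coordinates of identified vertices maps the rows of the split graph to those of G, and the rows of
the ear to those of a single butterfly attached at a and b. These two images are jointly independent
by a 1-extension, and the ear itself is independent at this degenerate placement, so the glued graph
is independent (`linearIndepOn_edgeRow_union`). Nucleations are excluded by counting in the
collapsed vertex set and, by a finite check, in the ear.

For the cover, every cluster of positive nullity survives the split without losing nullity, whereas
the shared nonedges other than ab lift injectively. This leaves one unit of slack. The slack forces
at least one key pair over ab to exist, and pays for one of them. The ear cover matters only through
its key pairs: two different ones must be the missing gluing pairs of the two butterflies, since
otherwise both could be added to the ear independently, against rank = IE_P - 1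
(`IsSafeEarCover.eq_gluingPair`). For one key pair, a triple consisting of it and a hinge is a
sufficient ear cluster. For two, the butterflies become K₅'s of nullity one once the key pairs and
uv are added, which pays for the second key pair and uv. A key pair is again a splittable nonedge,
because every new cluster at a gluing vertex contains a neighbour of it. -/

theorem coe_toNat_eRk (M : Matroid (Sym2 V)) (A : Set (Sym2 V)) :
    ((M.eRk A).toNat : ℕ∞) = M.eRk A :=
  ENat.natCast_toNat <| ne_top_of_le_ne_top (Set.encard_ne_top_iff.2 A.toFinite) (M.eRk_le_encard A)

theorem edgeRank_mono (h : A ⊆ B) : edgeRank M A ≤ edgeRank M B := by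
  have := M.eRk_mono h
  rw [← coe_toNat_eRk M A, ← coe_toNat_eRk M B] at this
  unfold edgeRank
  exact_mod_cast this

theorem edgeRank_le_ncard (M : Matroid (Sym2 V)) (A : Set (Sym2 V)) :
    edgeRank M A ≤ A.ncard := by
  have := M.eRk_le_encard A
  rw [← coe_toNat_eRk M A, ← A.toFinite.cast_ncard_eq] at this
  unfold edgeRank
  exact_mod_cast this

theorem edgeRank_union_add_inter_le (M : Matroid (Sym2 V)) (A B : Set (Sym2 V)) :
    edgeRank M (A ∪ B) + edgeRank M (A ∩ B) ≤ edgeRank M A + edgeRank M B := by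
  have := M.eRk_inter_add_eRk_union_le A B
  rw [← coe_toNat_eRk M A, ← coe_toNat_eRk M B, ← coe_toNat_eRk M (A ∩ B),
    ← coe_toNat_eRk M (A ∪ B)] at this
  unfold edgeRank
  have h : (M.eRk (A ∩ B)).toNat + (M.eRk (A ∪ B)).toNat ≤
    (M.eRk A).toNat + (M.eRk B).toNat := by exact_mod_cast this
  omega

theorem edgeRank_eq_ncard (h : M.Indep I) : edgeRank M I = I.ncard := by
  have := h.eRk_eq_encard
  rw [← coe_toNat_eRk M I, ← I.toFinite.cast_ncard_eq] at this
  unfold edgeRank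
  exact_mod_cast this

theorem indep_of_ncard_le_edgeRank (h : (A.ncard : ℤ) ≤ edgeRank M A) : M.Indep A := by
  rw [Matroid.indep_iff_eRk_eq_encard_of_finite A.toFinite]
  refine le_antisymm (M.eRk_le_encard A) ?_
  rw [← coe_toNat_eRk M A, ← A.toFinite.cast_ncard_eq]
  unfold edgeRank at h
  exact_mod_cast h

theorem exists_indep_ncard_eq_edgeRank (M : Matroid (Sym2 V)) (A : Set (Sym2 V)) :
    ∃ B ⊆ A, M.Indep B ∧ (B.ncard : ℤ) = edgeRank M A := by
  obtain ⟨B, hB⟩ := M.exists_isBasis' A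
  refine ⟨B, hB.subset, hB.indep, ?_⟩
  have := hB.encard_eq_eRk
  rw [← coe_toNat_eRk M A, ← B.toFinite.cast_ncard_eq] at this
  unfold edgeRank
  exact_mod_cast this

theorem exists_indep_superset_ncard_eq_edgeRank (hI : M.Indep I) (hIA : I ⊆ A) :
    ∃ B, I ⊆ B ∧ B ⊆ A ∧ M.Indep B ∧ (B.ncard : ℤ) = edgeRank M A := by
  obtain ⟨B, hB, hIB⟩ := hI.subset_isBasis'_of_subset hIA
  refine ⟨B, hIB, hB.subset, hB.indep, ?_⟩
  have := hB.encard_eq_eRk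
  rw [← coe_toNat_eRk M A, ← B.toFinite.cast_ncard_eq] at this
  unfold edgeRank
  exact_mod_cast this

theorem edgeRank_union_le_of_subset_closure (h : B ⊆ M.closure A) :
    edgeRank M (A ∪ B) = edgeRank M A := by
  refine le_antisymm ?_ (edgeRank_mono subset_union_left)
  have h1 : M.eRk (A ∪ B) ≤ M.eRk A := by
    rw [← M.eRk_union_closure_left_eq, union_eq_self_of_subset_right h, M.eRk_closure_eq]
  rw [← coe_toNat_eRk M A, ← coe_toNat_eRk M (A ∪ B)] at h1
  unfold edgeRank
  exact_mod_cast h1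

/-- The number of elements of `A` in excess of its rank. -/
noncomputable def nullity (M : Matroid (Sym2 V)) (A : Set (Sym2 V)) : ℤ :=
  A.ncard - edgeRank M A

theorem nullity_nonneg (M : Matroid (Sym2 V)) (A : Set (Sym2 V)) : 0 ≤ nullity M A :=
  sub_nonneg.2 (edgeRank_le_ncard M A)

theorem nullity_eq_zero_iff : nullity M A = 0 ↔ M.Indep A :=
  ⟨fun h => indep_of_ncard_le_edgeRank (by unfold nullity at h; omega),
    fun h => by unfold nullity; rw [edgeRank_eq_ncard h]; omega⟩

/-- Submodularity, where independence of the intersection turns its rank into its cardinality. -/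
theorem nullity_add_le (h : M.Indep (A ∩ B)) :
    nullity M A + nullity M B ≤ nullity M (A ∪ B) := by
  have h1 := edgeRank_union_add_inter_le M A B
  have h2 := edgeRank_eq_ncard h
  have h3 := Set.ncard_union_add_ncard_inter A B
  unfold nullity
  omega

theorem nullity_mono (h : A ⊆ B) : nullity M A ≤ nullity M B := by
  have h1 := edgeRank_union_add_inter_le M A (B \ A)
  have h2 := edgeRank_le_ncard M (B \ A)
  rw [union_sdiff_cancel h, inter_sdiff_self] at h1
  have h3 := Set.ncard_sdiff_add_ncard_of_subset h
  have h4 : (0 : ℤ) ≤ edgeRank M ∅ := by unfold edgeRank; positivity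
  unfold nullity
  omega

/-- A new member meets the union of the earlier ones inside P, so two-set superadditivity applies
repeatedly. With P the shared set, this bounds the total nullity of the clusters of a cover. -/
theorem sum_nullity_le {ι : Type*} (s : Finset ι) (F : ι → Set (Sym2 V)) {P : Set (Sym2 V)}
    (hP : M.Indep P) (hF : ∀ i ∈ s, ∀ j ∈ s, i ≠ j → F i ∩ F j ⊆ P) :
    ∑ i ∈ s, nullity M (F i) ≤ nullity M (⋃ i ∈ s, F i) := by
  classical
  induction s using Finset.induction_on with
  | empty => simpa using nullity_nonneg M _
  | insert i s hi ih =>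
    rw [Finset.sum_insert hi, Finset.set_biUnion_insert]
    have := ih fun j hj k hk => hF j (Finset.mem_insert_of_mem hj) k (Finset.mem_insert_of_mem hk)
    refine (add_le_add_right this _).trans (nullity_add_le (hP.subset ?_))
    rw [inter_iUnion₂]
    refine iUnion₂_subset fun j hj => hF i (Finset.mem_insert_self _ _) j
      (Finset.mem_insert_of_mem hj) ?_
    rintro rfl
    exact hi hj

theorem nullity_image {W : Type*} [Finite W] {N : Matroid (Sym2 W)} {f : Sym2 V → Sym2 W}
    (hf : Function.Injective f) (h : ∀ I, N.Indep (f '' I) ↔ M.Indep I) (A : Set (Sym2 V)) :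
    nullity N (f '' A) = nullity M A := by
  have : edgeRank N (f '' A) = edgeRank M A := by
    refine le_antisymm ?_ ?_
    · obtain ⟨B, hBA, hB, hc⟩ := exists_indep_ncard_eq_edgeRank N (f '' A)
      obtain ⟨C, hCA, rfl⟩ := subset_image_iff.1 hBA
      rw [← hc, ncard_image_of_injective _ hf, ← edgeRank_eq_ncard ((h C).1 hB)]
      exact edgeRank_mono hCA
    · obtain ⟨B, hBA, hB, hc⟩ := exists_indep_ncard_eq_edgeRank M A
      rw [← hc, ← ncard_image_of_injective _ hf, ← edgeRank_eq_ncard ((h B).2 hB)]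
      exact edgeRank_mono (image_mono hBA)
  unfold nullity
  rw [this, ncard_image_of_injective _ hf]

end Rank

/-! ### The inclusion-exclusion count in terms of nullities -/

section Cover

variable {V : Type*} [Finite V] {M : Matroid (Sym2 V)} {G : GraphOn V} {X : Set (Set V)}
  {P : Set (Sym2 V)}

theorem mem_sharedSet_of_mem {e : Sym2 V} (he : ¬ e.IsDiag) {Y Z : Set V}
    (hX : ∀ Y ∈ X, ∀ Z ∈ X, Y ≠ Z → (Y ∩ Z).ncard ≤ 2) (hY : Y ∈ X) (hZ : Z ∈ X) (hne : Y ≠ Z)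
    (heY : ∀ v ∈ e, v ∈ Y) (heZ : ∀ v ∈ e, v ∈ Z) : e ∈ sharedSet X := by
  induction e with | _ u v
  simp only [Sym2.mem_iff, forall_eq_or_imp, forall_eq, Sym2.mk_isDiag_iff] at *
  refine ⟨u, v, he, rfl, Y, hY, Z, hZ, hne, ?_⟩
  refine (Set.eq_of_subset_of_ncard_le ?_ ?_ (toFinite _)).symm
  · rintro x (rfl | rfl)
    exacts [⟨heY.1, heZ.1⟩, ⟨heY.2, heZ.2⟩]
  · rw [Set.ncard_pair he]
    exact hX Y hY Z hZ hne

theorem not_isDiag_of_mem_edgeSet {e : Sym2 V} (he : e ∈ G.edgeSet) : ¬ e.IsDiag :=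
  SimpleGraph.not_isDiag_of_mem_edgeSet _ (G.edgeSet_subset he)

theorem not_isDiag_of_mem_sharedSet {e : Sym2 V} (he : e ∈ sharedSet X) : ¬ e.IsDiag := by
  obtain ⟨u, v, h, rfl, -⟩ := he
  exact h

theorem exists_of_mem_sharedSet {e : Sym2 V} (he : e ∈ sharedSet X) :
    ∃ Y ∈ X, ∃ Z ∈ X, Y ≠ Z ∧ (∀ v ∈ e, v ∈ Y) ∧ ∀ v ∈ e, v ∈ Z := by
  obtain ⟨u, v, h, rfl, Y, hY, Z, hZ, hne, h⟩ := he
  refine ⟨Y, hY, Z, hZ, hne, fun w hw => ?_, fun w hw => ?_⟩ <;>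
  · have : w ∈ Y ∩ Z := by
      rw [h]
      simpa using hw
    first | exact this.1 | exact this.2

theorem IsTwoThinCover.exists_mem (h : IsTwoThinCover G X) {e : Sym2 V} (he : e ∈ G.edgeSet) :
    ∃ Y ∈ X, ∀ v ∈ e, v ∈ Y := by
  induction e with | _ u v
  obtain ⟨Y, hY, hu, hv⟩ := h.covers u v he
  exact ⟨Y, hY, by simp [hu, hv]⟩

open Classical in
theorem coverDegree_eq_card (X : Set (Set V)) (e : Sym2 V) :
    coverDegree X e = {Y ∈ X.toFinite.toFinset | ∀ v ∈ e, v ∈ Y}.card := by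
  unfold coverDegree
  rw [← Set.ncard_coe_finset]
  congr 1
  ext Y
  simp

theorem coverDegree_eq_one (h : IsTwoThinCover G X) {e : Sym2 V} (he : e ∈ G.edgeSet)
    (heS : e ∉ sharedSet X) : coverDegree X e = 1 := by
  obtain ⟨Y, hY, heY⟩ := h.exists_mem he
  refine Set.ncard_eq_one.2 ⟨Y, ?_⟩
  ext Z
  refine ⟨fun hZ => ?_, ?_⟩
  · by_contra hne
    exact heS (mem_sharedSet_of_mem (not_isDiag_of_mem_edgeSet he) h.inter_le hZ.1 hY hne hZ.2 heY)
  · rintro rfl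
    exact ⟨hY, heY⟩

-- Double counting of incidences between pairs and clusters. The correction term turns the
-- multiplicity of each pair of P into one, and the remaining edges already have multiplicity one.
open Classical in
theorem inclExclWith_eq (M : Matroid (Sym2 V)) (h : IsTwoThinCover G X) (hP : sharedSet X ⊆ P) :
    inclExclWith M G X P = (G.edgeSet ∪ P).ncard -
      ∑ Y ∈ X.toFinite.toFinset, nullity M {e ∈ G.edgeSet ∪ P | ∀ v ∈ e, v ∈ Y} := by
  set A := G.edgeSet ∪ P with hA
  have h1 : ∑ Y ∈ X.toFinite.toFinset, ({e ∈ A | ∀ v ∈ e, v ∈ Y}.ncard : ℤ) =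
      ∑ e ∈ A.toFinite.toFinset, (coverDegree X e : ℤ) := by
    have := Finset.sum_card_bipartiteAbove_eq_sum_card_bipartiteBelow
      (s := X.toFinite.toFinset) (t := A.toFinite.toFinset)
      (fun (Y : Set V) (e : Sym2 V) => ∀ v ∈ e, v ∈ Y)
    have h2 : ∀ Y : Set V, {e ∈ A | ∀ v ∈ e, v ∈ Y}.ncard =
        (Finset.bipartiteAbove (fun (Y : Set V) (e : Sym2 V) => ∀ v ∈ e, v ∈ Y)
          A.toFinite.toFinset Y).card := by
      intro Y
      rw [← Set.ncard_coe_finset, Finset.bipartiteAbove]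
      congr 1
      ext e
      simp
    simp_rw [h2, coverDegree_eq_card]
    exact_mod_cast this
  -- An edge outside P is not shared, so it lies in exactly one cluster and its summand d - 1 is
  -- zero.
  have h3 : ∑ e ∈ A.toFinite.toFinset, ((coverDegree X e : ℤ) - 1) =
      ∑ e ∈ P.toFinite.toFinset, ((coverDegree X e : ℤ) - 1) := by
    symm
    refine Finset.sum_subset ?_ fun e he heP => ?_
    · intro e he
      simp only [Finite.mem_toFinset] at *
      exact Or.inr he
    · simp only [Finite.mem_toFinset] at *
      rw [coverDegree_eq_one h (he.resolve_right heP) fun hs => heP (hP hs)]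
      simp
  rw [inclExclWith, finsum_mem_eq_finite_toFinset_sum _ X.toFinite,
    finsum_mem_eq_finite_toFinset_sum _ P.toFinite, ← h3, Finset.sum_sub_distrib, ← h1]
  simp only [nullity, Finset.sum_sub_distrib, Finset.sum_const, nsmul_eq_mul, mul_one]
  rw [Set.ncard_eq_toFinset_card A]
  ring

theorem sum_nullity_cover_le (h : IsTwoThinCover G X) (hS : M.Indep (sharedSet X))
    (hPE : ∀ e ∈ P, ¬ e.IsDiag) :
    ∑ Y ∈ X.toFinite.toFinset, nullity M {e ∈ G.edgeSet ∪ P | ∀ v ∈ e, v ∈ Y} ≤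
      nullity M (G.edgeSet ∪ P) := by
  refine (sum_nullity_le _ _ hS fun Y hY Z hZ hne e he => ?_).trans (nullity_mono ?_)
  · simp only [Finite.mem_toFinset] at hY hZ
    refine mem_sharedSet_of_mem ?_ h.inter_le hY hZ hne he.1.2 he.2.2
    exact he.1.1.elim not_isDiag_of_mem_edgeSet (hPE e)
  · exact iUnion₂_subset fun Y _ e he => he.1

theorem ncard_union_eq_add_sdiff (A B : Set (Sym2 V)) :
    (A ∪ B).ncard = A.ncard + (B \ A).ncard := by
  rw [← Set.ncard_union_eq disjoint_sdiff_right, union_sdiff_self]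

/-- For an independent graph, the count with the shared set equals the rank iff the nullities of the
clusters add up to the number of shared nonedges. -/
theorem rank_eq_inclExcl_iff (hG : IsIndependent M G) (h : IsTwoThinCover G X) :
    edgeRank M G.edgeSet = inclExcl M G X ↔
      ∑ Y ∈ X.toFinite.toFinset, nullity M {e ∈ G.edgeSet ∪ sharedSet X | ∀ v ∈ e, v ∈ Y} =
        (sharedSet X \ G.edgeSet).ncard := by
  rw [inclExcl, inclExclWith_eq M h subset_rfl, edgeRank_eq_ncard hG, ncard_union_eq_add_sdiff]
  push_cast
  constructor <;> intro h <;> linarith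

end Cover

/-! ### Completing a family of clusters by edges -/

section Completion

variable {V : Type*} [Finite V] {M : Matroid (Sym2 V)} {G : GraphOn V} {X L : Set (Set V)}
  {P : Set (Sym2 V)}

theorem coverDegree_le_one (h : ∀ Y ∈ X, ∀ Z ∈ X, Y ≠ Z → (Y ∩ Z).ncard ≤ 2) {e : Sym2 V}
    (he : ¬ e.IsDiag) (heS : e ∉ sharedSet X) : coverDegree X e ≤ 1 := by
  unfold coverDegree
  rw [Set.ncard_le_one]
  intro Y hY Z hZ
  by_contra hne
  exact heS (mem_sharedSet_of_mem he h hY.1 hZ.1 hne hY.2 hZ.2)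

/-- Enlarging P raises the ranks, and a pair outside the shared set lies in at most one cluster, so
d - 1 ≤ 0 and subtracting it does not lower the count. Tightness may therefore be proved with a
larger P. -/
theorem inclExcl_le_inclExclWith (M : Matroid (Sym2 V)) (h : IsTwoThinCover G X)
    (hP : sharedSet X ⊆ P) (hPd : ∀ e ∈ P, ¬ e.IsDiag) :
    inclExcl M G X ≤ inclExclWith M G X P := by
  classical
  rw [inclExcl, inclExclWith, inclExclWith, finsum_mem_eq_finite_toFinset_sum _ X.toFinite,
    finsum_mem_eq_finite_toFinset_sum _ P.toFinite, finsum_mem_eq_finite_toFinset_sum _ X.toFinite,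
    finsum_mem_eq_finite_toFinset_sum _ (sharedSet X).toFinite]
  refine sub_le_sub (Finset.sum_le_sum fun Y _ => edgeRank_mono fun e he =>
    ⟨he.1.imp_right fun h => hP h, he.2⟩) ?_
  have hsub : (sharedSet X).toFinite.toFinset ⊆ P.toFinite.toFinset := by simpa using hP
  rw [← Finset.sum_sdiff hsub, add_le_iff_nonpos_left]
  refine Finset.sum_nonpos fun e he => ?_
  simp only [Finset.mem_sdiff, Finite.mem_toFinset] at he
  have := coverDegree_le_one h.inter_le (hPd e he.1) he.2
  omega

/-- The family `L` together with the edges of `G` not contained in a member of `L`. -/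
def edgeCompletion (G : GraphOn V) (L : Set (Set V)) : Set (Set V) :=
  L ∪ {Y | ∃ x y, G.Adj x y ∧ Y = {x, y} ∧ ∀ Z ∈ L, ¬ Y ⊆ Z}

theorem isTwoThinCover_edgeCompletion (hLG : ∀ Y ∈ L, Y ⊆ G.verts) (hL : ∀ Y ∈ L, 3 ≤ Y.ncard)
    (hthin : ∀ Y ∈ L, ∀ Z ∈ L, Y ≠ Z → (Y ∩ Z).ncard ≤ 2) :
    IsTwoThinCover G (edgeCompletion G L) where
  subset_verts := by
    rintro Y (hY | ⟨x, y, hxy, rfl, -⟩)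
    · exact hLG Y hY
    · rintro z (rfl | rfl)
      exacts [hxy.fst_mem, hxy.snd_mem]
  two_le := by
    rintro Y (hY | ⟨x, y, hxy, rfl, -⟩)
    · exact (hL Y hY).trans' (by norm_num)
    · rw [ncard_pair hxy.ne]
  inter_le := by
    rintro Y (hY | ⟨x, y, hxy, rfl, -⟩) Z (hZ | ⟨x', y', hxy', rfl, -⟩) hne
    · exact hthin Y hY Z hZ hne
    · exact (ncard_le_ncard inter_subset_right (toFinite _)).trans (ncard_pair hxy'.ne).le
    · exact (ncard_le_ncard inter_subset_left (toFinite _)).trans (ncard_pair hxy.ne).le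
    · exact (ncard_le_ncard inter_subset_left (toFinite _)).trans (ncard_pair hxy.ne).le
  not_subset := by
    rintro Y (hY | ⟨x, y, hxy, rfl, h⟩) Z (hZ | ⟨x', y', hxy', rfl, -⟩) hne hsub
    · have h1 := hthin Y hY Z hZ hne
      have h2 := hL Y hY
      rw [inter_eq_left.2 hsub] at h1
      omega
    · have h1 := ncard_le_ncard hsub (toFinite _)
      have h2 := hL Y hY
      rw [ncard_pair hxy'.ne] at h1
      omega
    · exact h Z hZ hsub
    · exact hne (eq_of_subset_of_ncard_le hsub (by rw [ncard_pair hxy.ne, ncard_pair hxy'.ne])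
        (toFinite _))
  covers u v huv := by
    by_cases h : ∃ Z ∈ L, {u, v} ⊆ Z
    · obtain ⟨Z, hZ, h⟩ := h
      exact ⟨Z, Or.inl hZ, h (by simp), h (by simp)⟩
    · push Not at h
      exact ⟨{u, v}, Or.inr ⟨u, v, huv, rfl, h⟩, by simp, by simp⟩

theorem sharedSet_mono {L X : Set (Set V)} (h : L ⊆ X) : sharedSet L ⊆ sharedSet X := by
  rintro e ⟨u, v, h1, rfl, Y, hY, Z, hZ, h2⟩
  exact ⟨u, v, h1, rfl, Y, h hY, Z, h hZ, h2⟩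

/-- Clusters of size two do not contribute to the shared set of a thin cover. -/
theorem sharedSet_subset_of_large (h : ∀ Y ∈ X, ∀ Z ∈ X, Y ≠ Z → ¬ Y ⊆ Z)
    (hL : ∀ Y ∈ X, 3 ≤ Y.ncard → Y ∈ L) : sharedSet X ⊆ sharedSet L := by
  rintro e ⟨u, v, h1, rfl, Y, hY, Z, hZ, hne, h2⟩
  have key : ∀ Y ∈ X, ∀ Z ∈ X, Y ≠ Z → Y ∩ Z = {u, v} → Y ∈ L := by
    intro Y hY Z hZ hne h2
    refine hL Y hY ?_
    by_contra hlt
    refine h Y hY Z hZ hne (inter_eq_left.1 (eq_of_subset_of_ncard_le inter_subset_left ?_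
      (toFinite _)))
    rw [h2, ncard_pair h1]
    omega
  exact ⟨u, v, h1, rfl, Y, key Y hY Z hZ hne h2, Z, key Z hZ Y hY hne.symm (by rwa [inter_comm]),
    hne, h2⟩

theorem sharedSet_edgeCompletion (hLG : ∀ Y ∈ L, Y ⊆ G.verts) (hL : ∀ Y ∈ L, 3 ≤ Y.ncard)
    (hthin : ∀ Y ∈ L, ∀ Z ∈ L, Y ≠ Z → (Y ∩ Z).ncard ≤ 2) :
    sharedSet (edgeCompletion G L) = sharedSet L := by
  refine (sharedSet_subset_of_large (isTwoThinCover_edgeCompletion hLG hL hthin).not_subset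
    ?_).antisymm (sharedSet_mono subset_union_left)
  rintro Y (hY | ⟨x, y, hxy, rfl, -⟩) h3
  · exact hY
  · rw [ncard_pair hxy.ne] at h3
    omega

/-- The count of a thin cover with independent shared set is an upper bound for the rank. -/
theorem edgeRank_union_le_inclExclWith (h : IsTwoThinCover G X) (hS : M.Indep (sharedSet X))
    (hP : sharedSet X ⊆ P) (hPd : ∀ e ∈ P, ¬ e.IsDiag) :
    edgeRank M (G.edgeSet ∪ P) ≤ inclExclWith M G X P := by
  have := sum_nullity_cover_le h hS hPd
  rw [inclExclWith_eq M h hP]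
  unfold nullity at this ⊢
  linarith

/-- If the nullities of the members of `L` account for all nonedges in a set that contains the
shared set, then the completion of `L` determines the rank of `G`. -/
theorem edgeRank_eq_inclExcl_edgeCompletion (hG : IsIndependent M G)
    (hLG : ∀ Y ∈ L, Y ⊆ G.verts) (hL : ∀ Y ∈ L, 3 ≤ Y.ncard)
    (hthin : ∀ Y ∈ L, ∀ Z ∈ L, Y ≠ Z → (Y ∩ Z).ncard ≤ 2) (hS : M.Indep (sharedSet L))
    (hP : sharedSet L ⊆ P) (hPd : ∀ e ∈ P, ¬ e.IsDiag)
    (hsum : ((P \ G.edgeSet).ncard : ℤ) ≤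
      ∑ Y ∈ L.toFinite.toFinset, nullity M {e ∈ G.edgeSet ∪ P | ∀ v ∈ e, v ∈ Y}) :
    edgeRank M G.edgeSet = inclExcl M G (edgeCompletion G L) := by
  have hX := isTwoThinCover_edgeCompletion hLG hL hthin
  have hSX := sharedSet_edgeCompletion hLG hL hthin
  refine le_antisymm ?_ ?_
  · refine (edgeRank_mono subset_union_left).trans (edgeRank_union_le_inclExclWith hX
      (by rwa [hSX]) subset_rfl fun e => not_isDiag_of_mem_sharedSet)
  · refine (inclExcl_le_inclExclWith M hX (hSX.trans_subset hP) hPd).trans ?_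
    rw [inclExclWith_eq M hX (hSX.trans_subset hP), ncard_union_eq_add_sdiff,
      edgeRank_eq_ncard hG]
    have : ∑ Y ∈ L.toFinite.toFinset, nullity M {e ∈ G.edgeSet ∪ P | ∀ v ∈ e, v ∈ Y} ≤
        ∑ Y ∈ (edgeCompletion G L).toFinite.toFinset,
          nullity M {e ∈ G.edgeSet ∪ P | ∀ v ∈ e, v ∈ Y} := by
      refine Finset.sum_le_sum_of_subset_of_nonneg ?_ fun _ _ _ => nullity_nonneg _ _
      intro Y hY
      simp only [Finite.mem_toFinset] at hY ⊢
      exact Or.inl hY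
    push_cast
    linarith

end Completion

/-! ### Matroids closed under zero-extensions -/

/-- The edges joining `w` to the vertices in `W`. -/
def starEdges {V : Type*} (w : V) (W : Set V) : Set (Sym2 V) := (fun x => s(w, x)) '' W

/-- The properties shared by all three-dimensional abstract rigidity matroids and by the generic
matroids: independence is preserved by adding a vertex of degree at most three, and independent
sets satisfy the Maxwell count. -/
structure HasZeroExtensions {V : Type*} (M : Matroid (Sym2 V)) : Prop where
  ground_eq : M.E = pairsIn Set.univ
  zero_ext : ∀ (I : Set (Sym2 V)) (w : V) (W : Set V), M.Indep I → w ∉ edgeSupport I → w ∉ W →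
    W.ncard ≤ 3 → M.Indep (I ∪ starEdges w W)
  card_le : ∀ (I : Set (Sym2 V)) (U : Set V), M.Indep I → I ⊆ pairsIn U → 3 ≤ U.ncard →
    I.ncard + 6 ≤ 3 * U.ncard

/-- The rank of the complete graph on `n` vertices. -/
def completeRank (n : ℕ) : ℕ := ∑ i ∈ Finset.range n, min 3 i

theorem completeRank_succ (n : ℕ) : completeRank (n + 1) = completeRank n + min 3 n :=
  Finset.sum_range_succ _ _

theorem completeRank_add_six {n : ℕ} (h : 3 ≤ n) : completeRank n + 6 = 3 * n := by
  induction n, h using Nat.le_induction with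
  | base => rfl
  | succ n hn ih => rw [completeRank_succ]; omega

/-! ### Complete graphs, stars and edge supports. -/

section Pairs

variable {V : Type*} [Finite V]

theorem ncard_starEdges (w : V) (W : Set V) : (starEdges w W).ncard = W.ncard :=
  ncard_image_of_injective _ fun _ _ h => Sym2.congr_right.1 h

theorem mem_starEdges {w : V} {W : Set V} {e : Sym2 V} :
    e ∈ starEdges w W ↔ ∃ x ∈ W, s(w, x) = e := Iff.rfl

theorem mk_mem_pairsIn {U : Set V} {x y : V} : s(x, y) ∈ pairsIn U ↔ x ≠ y ∧ x ∈ U ∧ y ∈ U := by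
  simp [pairsIn]

theorem pairsIn_mono {U W : Set V} (h : U ⊆ W) : pairsIn U ⊆ pairsIn W :=
  fun _ he => ⟨he.1, fun v hv => h (he.2 v hv)⟩

theorem pairsIn_insert (w : V) (U : Set V) (hw : w ∉ U) :
    pairsIn (insert w U) = pairsIn U ∪ starEdges w U := by
  ext e
  induction e with | _ x y
  simp only [mem_union, mk_mem_pairsIn, mem_starEdges, mem_insert_iff, Sym2.eq_iff]
  constructor
  · rintro ⟨hne, rfl | hx, rfl | hy⟩
    · exact absurd rfl hne
    · exact Or.inr ⟨y, hy, by simp⟩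
    · exact Or.inr ⟨x, hx, by simp⟩
    · exact Or.inl ⟨hne, hx, hy⟩
  · rintro (⟨hne, hx, hy⟩ | ⟨z, hz, ⟨rfl, rfl⟩ | ⟨rfl, rfl⟩⟩)
    · exact ⟨hne, Or.inr hx, Or.inr hy⟩
    · exact ⟨fun h => hw (h ▸ hz), Or.inl rfl, Or.inr hz⟩
    · exact ⟨fun h => hw (h ▸ hz), Or.inr hz, Or.inl rfl⟩

theorem edgeSupport_mono {A B : Set (Sym2 V)} (h : A ⊆ B) : edgeSupport A ⊆ edgeSupport B :=
  fun _ ⟨e, he, hv⟩ => ⟨e, h he, hv⟩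

theorem edgeSupport_pairsIn_subset (U : Set V) : edgeSupport (pairsIn U) ⊆ U :=
  fun _ ⟨_, he, hv⟩ => he.2 _ hv

theorem edgeSupport_union (A B : Set (Sym2 V)) :
    edgeSupport (A ∪ B) = edgeSupport A ∪ edgeSupport B := by
  ext v
  simp only [edgeSupport, mem_union, mem_ofPred_eq, or_and_right, exists_or]

theorem edgeSupport_starEdges_subset (w : V) (W : Set V) :
    edgeSupport (starEdges w W) ⊆ insert w W := by
  rintro v ⟨_, ⟨x, hx, rfl⟩, hv⟩
  rcases Sym2.mem_iff.1 hv with rfl | rfl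
  exacts [mem_insert _ _, mem_insert_of_mem _ hx]

theorem edgeSet_subset_pairsIn (G : GraphOn V) : G.edgeSet ⊆ pairsIn G.verts :=
  fun _ he => ⟨not_isDiag_of_mem_edgeSet he, fun _ hv =>
    SimpleGraph.Subgraph.mem_verts_of_mem_edge he hv⟩

end Pairs

/-! ### Ranks of complete graphs and the effect of deleting a star. -/

namespace HasZeroExtensions

variable {V : Type*} [Finite V] {M : Matroid (Sym2 V)} (hM : HasZeroExtensions M)
  {I A : Set (Sym2 V)} {U W : Set V}

include hM

theorem subset_pairsIn (hI : M.Indep I) : I ⊆ pairsIn Set.univ := hM.ground_eq ▸ hI.subset_ground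

/-- Among four vertices each new one has at most three predecessors, so K₄ arises by zero-extensions
alone. -/
theorem indep_pairsIn (hU : U.ncard ≤ 4) : M.Indep (pairsIn U) := by
  induction U, toFinite U using Set.Finite.induction_on with
  | empty =>
    convert M.empty_indep
    ext e
    induction e with | _ x y
    simp [mk_mem_pairsIn]
  | @insert w U hw _ ih =>
    rw [ncard_insert_of_notMem hw] at hU
    rw [pairsIn_insert w U hw]
    exact hM.zero_ext _ _ _ (ih (by omega)) (fun h => hw (edgeSupport_pairsIn_subset U h)) hw
      (by omega)

theorem edgeRank_pairsIn_le (hU : 3 ≤ U.ncard) : edgeRank M (pairsIn U) + 6 ≤ 3 * U.ncard := by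
  obtain ⟨B, hB, hBi, hc⟩ := exists_indep_ncard_eq_edgeRank M (pairsIn U)
  have := hM.card_le B U hBi hB hU
  omega

/-- Building up `pairsIn (W₀ ∪ W)` vertex by vertex on top of an independent set. -/
theorem exists_indep_extension (hI : M.Indep I) (hIU : edgeSupport I ⊆ U) {W₀ : Set V}
    (hW₀ : W₀ ⊆ U) (hW : Disjoint W U) :
    ∃ J, I ⊆ J ∧ M.Indep J ∧ J ⊆ I ∪ pairsIn (W₀ ∪ W) ∧
      J.ncard + completeRank W₀.ncard = I.ncard + completeRank (W₀.ncard + W.ncard) := by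
  induction W, toFinite W using Set.Finite.induction_on with
  | empty => exact ⟨I, subset_rfl, hI, subset_union_left, by simp⟩
  | @insert w W hw _ ih =>
    rw [disjoint_insert_left] at hW
    obtain ⟨J, hIJ, hJ, hJs, hc⟩ := ih hW.2
    have hcard : (W₀ ∪ W).ncard = W₀.ncard + W.ncard :=
      ncard_union_eq (hW.2.mono_right hW₀).symm (toFinite _) (toFinite _)
    -- The new vertex is joined to as many predecessors as a zero-extension allows, which is the
    -- summand `min 3 n` of `completeRank`.
    obtain ⟨R, hR, hRc⟩ := Set.exists_subset_card_eq (s := W₀ ∪ W) (n := min 3 (W₀ ∪ W).ncard)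
      (min_le_right _ _)
    have hw' : w ∉ W₀ ∪ W := fun h => h.elim (fun h => hW.1 (hW₀ h)) hw
    have hwJ : w ∉ edgeSupport J := by
      intro h
      have := edgeSupport_mono hJs h
      rw [edgeSupport_union] at this
      exact this.elim (fun h => hW.1 (hIU h)) fun h => hw' (edgeSupport_pairsIn_subset _ h)
    have hsub : W₀ ∪ W ⊆ W₀ ∪ insert w W := union_subset_union_right _ (subset_insert _ _)
    refine ⟨J ∪ starEdges w R, hIJ.trans subset_union_left,
      hM.zero_ext _ _ _ hJ hwJ (fun h => hw' (hR h)) (by omega), union_subset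
        (hJs.trans (union_subset_union_right _ (pairsIn_mono hsub))) ?_, ?_⟩
    · refine subset_union_of_subset_right ?_ _
      rintro _ ⟨x, hx, rfl⟩
      exact mk_mem_pairsIn.2 ⟨fun h => hw' (hR (h ▸ hx)), by simp, hsub (hR hx)⟩
    · rw [ncard_union_eq ?_ (toFinite _) (toFinite _), ncard_starEdges, hRc, hcard,
        ncard_insert_of_notMem hw, ← add_assoc, completeRank_succ]
      · omega
      · rw [Set.disjoint_left]
        rintro _ he ⟨x, hx, rfl⟩
        exact hwJ ⟨_, he, by simp⟩

theorem le_edgeRank_pairsIn (U : Set V) : (completeRank U.ncard : ℤ) ≤ edgeRank M (pairsIn U) := by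
  obtain ⟨J, -, hJ, hJs, hc⟩ := hM.exists_indep_extension (I := ∅) (U := ∅) (W₀ := ∅) (W := U)
    M.empty_indep (by simp [edgeSupport]) subset_rfl (disjoint_empty _)
  simp only [empty_union, ncard_empty, zero_add] at hc hJs
  have : completeRank 0 = 0 := rfl
  have := edgeRank_mono (M := M) hJs
  rw [edgeRank_eq_ncard hJ] at this
  omega

/-- Deleting the edges at a vertex lowers the rank by at least three unless the degree is smaller. -/
theorem edgeRank_sdiff_star (hA : A ⊆ pairsIn Set.univ) (a : V) :
    edgeRank M (A \ {e | a ∈ e}) + min 3 ((A ∩ {e | a ∈ e}).ncard : ℤ) ≤ edgeRank M A := by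
  obtain ⟨B, hBA, hB, hc⟩ := exists_indep_ncard_eq_edgeRank M (A \ {e | a ∈ e})
  obtain ⟨R, hR, hRc⟩ := Set.exists_subset_card_eq (s := {x | s(a, x) ∈ A})
    (n := min 3 {x | s(a, x) ∈ A}.ncard) (min_le_right _ _)
  have hst : A ∩ {e | a ∈ e} = starEdges a {x | s(a, x) ∈ A} := by
    ext e
    constructor
    · rintro ⟨he, hx⟩
      obtain ⟨x, rfl⟩ := Sym2.mem_iff_exists.1 hx
      exact ⟨x, he, rfl⟩
    · rintro ⟨x, hx, rfl⟩
      exact ⟨hx, by simp⟩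
  have ha : a ∉ edgeSupport B := fun ⟨e, he, hae⟩ => (hBA he).2 hae
  have hJ := hM.zero_ext B a R hB ha (fun h => (hA (hR h)).1 rfl) (by omega)
  have hd : Disjoint B (starEdges a R) := by
    rw [Set.disjoint_left]
    rintro _ he ⟨x, hx, rfl⟩
    exact ha ⟨_, he, by simp⟩
  have h1 : B ∪ starEdges a R ⊆ A := by
    refine union_subset (hBA.trans sdiff_subset) ?_
    rintro _ ⟨x, hx, rfl⟩
    exact hR hx
  have h2 := edgeRank_mono (M := M) h1
  rw [edgeRank_eq_ncard hJ, ncard_union_eq hd (toFinite _) (toFinite _), ncard_starEdges] at h2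
  rw [hst, ncard_starEdges]
  push_cast at h2
  omega

/-- Up to three pairs at a vertex are gained in rank, so a star contributes to the nullity only by
its excess over three. -/
theorem nullity_le_sdiff_star (hA : A ⊆ pairsIn Set.univ) (a : V) :
    nullity M A ≤ nullity M (A \ {e | a ∈ e}) + (A ∩ {e | a ∈ e}).ncard -
      min 3 ((A ∩ {e | a ∈ e}).ncard : ℤ) := by
  have h1 := hM.edgeRank_sdiff_star hA a
  have h2 := Set.ncard_inter_add_ncard_sdiff_eq_ncard A {e | a ∈ e} (toFinite _)
  unfold nullity
  omega

/-- For independent graphs, being nucleation-free is a matter of counting edges. -/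
theorem isNucleationFree_iff {G : GraphOn V} (hG : IsIndependent M G) :
    IsNucleationFree M G ↔ ∀ U ⊆ G.verts, 5 ≤ U.ncard →
      {e ∈ G.edgeSet | ∀ v ∈ e, v ∈ U}.ncard + 6 < 3 * U.ncard := by
  constructor
  · intro h U hU h5
    by_contra hlt
    refine h ⟨G.induce U, ?_, h5, ?_⟩
    · exact ⟨hU, fun x y h => h.2.2⟩
    · have hE : (G.induce U).edgeSet = {e ∈ G.edgeSet | ∀ v ∈ e, v ∈ U} := by
        ext e
        induction e with | _ x y
        simp only [SimpleGraph.Subgraph.mem_edgeSet, SimpleGraph.Subgraph.induce_adj, mem_ofPred_eq,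
          Sym2.mem_iff, forall_eq_or_imp, forall_eq]
        tauto
      intro e he
      rw [hE]
      have hind : M.Indep {e ∈ G.edgeSet | ∀ v ∈ e, v ∈ U} := hG.subset fun e he => he.1
      have hsub : {e ∈ G.edgeSet | ∀ v ∈ e, v ∈ U} ⊆ pairsIn U :=
        fun e he => ⟨not_isDiag_of_mem_edgeSet he.1, he.2⟩
      -- A pair outside the closure could be added to a set that already has 3|U| - 6 elements,
      -- against the Maxwell bound.
      by_contra hcl
      have hgr : e ∈ M.E := hM.ground_eq ▸ pairsIn_mono (subset_univ _) he
      have h1 : e ∉ {e ∈ G.edgeSet | ∀ v ∈ e, v ∈ U} :=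
        fun h => hcl (M.subset_closure _ hind.subset_ground h)
      have h2 := hM.card_le _ U (hind.insert_indep_iff.2 (Or.inl ⟨hgr, hcl⟩))
        (insert_subset he hsub) (by omega)
      rw [ncard_insert_of_notMem h1] at h2
      omega
  · rintro h ⟨N, hN, h5, hr⟩
    have h1 := h N.verts hN.1 h5
    have h2 : N.edgeSet ⊆ {e ∈ G.edgeSet | ∀ v ∈ e, v ∈ N.verts} := fun e he =>
      ⟨SimpleGraph.Subgraph.edgeSet_mono hN he, fun v hv =>
        SimpleGraph.Subgraph.mem_verts_of_mem_edge he hv⟩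
    have h3 := ncard_le_ncard h2 (toFinite _)
    have h4 := edgeRank_union_le_of_subset_closure hr
    have h5' := edgeRank_mono (M := M) (subset_union_right (s := N.edgeSet) (t := pairsIn N.verts))
    have h6 := hM.le_edgeRank_pairsIn N.verts
    have h7 := edgeRank_le_ncard M N.edgeSet
    have h8 := completeRank_add_six (n := N.verts.ncard) (by omega)
    omega

end HasZeroExtensions

/-! ### Splits that give all neighbours to the first copies -/

section TrivialSplit

variable {V : Type*} {G : GraphOn V} {X : Set (Set V)} {a b : V} {Gs : GraphOn (SplitVertex V)}

/-- The map that identifies the copies of `a` and the copies of `b`. -/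
def splitCollapse (a b : V) : SplitVertex V → V :=
  Sum.elim id (Sum.elim (fun _ => a) fun _ => b)

/-- The vertices of the split graph other than the second copies. -/
def firstCopies (a b : V) : Set (SplitVertex V) :=
  {x | x = aCopy V 0 ∨ x = bCopy V 0 ∨ ∃ v, v ≠ a ∧ v ≠ b ∧ x = Sum.inl v}

/-- The nonedge-split that gives all neighbours of `a` and `b` to the first copies. -/
def trivialSplit (G : GraphOn V) (a b : V) : GraphOn (SplitVertex V) where
  verts := Sum.inl '' (G.verts \ {a, b}) ∪ Set.range Sum.inr
  Adj x y := x ∈ firstCopies a b ∧ y ∈ firstCopies a b ∧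
    G.Adj (splitCollapse a b x) (splitCollapse a b y)
  adj_sub h := fun hxy => h.2.2.ne (congrArg _ hxy)
  edge_vert := by
    rintro x y ⟨rfl | rfl | ⟨v, ha, hb, rfl⟩, -, h⟩
    · exact Or.inr ⟨_, rfl⟩
    · exact Or.inr ⟨_, rfl⟩
    · exact Or.inl ⟨v, ⟨h.fst_mem, by simp [ha, hb]⟩, rfl⟩
  symm := ⟨fun _ _ h => ⟨h.2.1, h.1, h.2.2.symm⟩⟩

theorem inl_mem_firstCopies {v : V} :
    (Sum.inl v : SplitVertex V) ∈ firstCopies a b ↔ v ≠ a ∧ v ≠ b := by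
  simp [firstCopies]

theorem aCopy_mem_firstCopies {i : Fin 2} : aCopy V i ∈ firstCopies a b ↔ i = 0 := by
  simp [firstCopies]

theorem bCopy_mem_firstCopies {i : Fin 2} : bCopy V i ∈ firstCopies a b ↔ i = 0 := by
  simp [firstCopies]

theorem mem_splitCluster_inl {Y : Set V} {v : V} :
    Sum.inl v ∈ splitCluster a b Gs Y ↔ v ∈ Y ∧ v ≠ a ∧ v ≠ b := by
  simp [splitCluster]

theorem mem_splitCluster_aCopy {Y : Set V} {i : Fin 2} :
    aCopy V i ∈ splitCluster a b Gs Y ↔ a ∈ Y ∧ ∃ y ∈ Y, Gs.Adj (aCopy V i) (Sum.inl y) := by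
  simp [splitCluster]
  intros; omega

theorem mem_splitCluster_bCopy {Y : Set V} {i : Fin 2} :
    bCopy V i ∈ splitCluster a b Gs Y ↔ b ∈ Y ∧ ∃ y ∈ Y, Gs.Adj (bCopy V i) (Sum.inl y) := by
  simp [splitCluster]
  intros; omega

/-- A shared nonedge whose trivial split is safe. -/
structure IsSplittableNonedge (G : GraphOn V) (X : Set (Set V)) (a b : V) : Prop where
  mem_left : a ∈ G.verts
  mem_right : b ∈ G.verts
  ne : a ≠ b
  not_adj : ¬ G.Adj a b
  mem_shared : s(a, b) ∈ sharedSet X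
  agree_left : ∀ Y ∈ X, ∀ Z ∈ X, ∀ u, u ≠ b → Y ∩ Z = {a, u} →
    s(a, u) ∈ sharedSet X → ¬ G.Adj a u → ((∃ y ∈ Y, G.Adj a y) ↔ ∃ y ∈ Z, G.Adj a y)
  agree_right : ∀ Y ∈ X, ∀ Z ∈ X, ∀ u, u ≠ a → Y ∩ Z = {b, u} →
    s(b, u) ∈ sharedSet X → ¬ G.Adj b u → ((∃ y ∈ Y, G.Adj b y) ↔ ∃ y ∈ Z, G.Adj b y)

theorem IsSplittableNonedge.symm (h : IsSplittableNonedge G X a b) :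
    IsSplittableNonedge G X b a where
  mem_left := h.mem_right
  mem_right := h.mem_left
  ne := h.ne.symm
  not_adj h' := h.not_adj h'.symm
  mem_shared := Sym2.eq_swap ▸ h.mem_shared
  agree_left := h.agree_right
  agree_right := h.agree_left

theorem trivialSplit_adj_aCopy {i : Fin 2} {y : SplitVertex V} (hab : ¬ G.Adj a b) :
    (trivialSplit G a b).Adj (aCopy V i) y ↔ i = 0 ∧ ∃ v, G.Adj a v ∧ y = Sum.inl v := by
  constructor
  · rintro ⟨h1, rfl | rfl | ⟨v, hv, hv', rfl⟩, h⟩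
    · exact absurd rfl h.ne
    · exact absurd h hab
    · exact ⟨aCopy_mem_firstCopies.1 h1, v, h, rfl⟩
  · rintro ⟨rfl, v, hv, rfl⟩
    exact ⟨aCopy_mem_firstCopies.2 rfl, inl_mem_firstCopies.2
      ⟨hv.ne.symm, fun h => hab (h ▸ hv)⟩, hv⟩

theorem trivialSplit_adj_bCopy {i : Fin 2} {y : SplitVertex V} (hab : ¬ G.Adj a b) :
    (trivialSplit G a b).Adj (bCopy V i) y ↔ i = 0 ∧ ∃ v, G.Adj b v ∧ y = Sum.inl v := by
  constructor
  · rintro ⟨h1, rfl | rfl | ⟨v, hv, hv', rfl⟩, h⟩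
    · exact absurd h.symm hab
    · exact absurd rfl h.ne
    · exact ⟨bCopy_mem_firstCopies.1 h1, v, h, rfl⟩
  · rintro ⟨rfl, v, hv, rfl⟩
    exact ⟨bCopy_mem_firstCopies.2 rfl, inl_mem_firstCopies.2
      ⟨fun h => hab (h ▸ hv.symm), hv.ne.symm⟩, hv⟩

/-- The second copies are isolated, so no cluster contains twins, and a first copy enters a split
cluster exactly when the cluster contains its end and a neighbour of that end. Condition (2) thus
becomes the agreement of these neighbour conditions. -/
theorem IsSplittableNonedge.isSafeNonedgeSplit (h : IsSplittableNonedge G X a b) :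
    IsSafeNonedgeSplit G X a b (trivialSplit G a b) := by
  have hA : ∀ Y i, aCopy V i ∈ splitCluster a b (trivialSplit G a b) Y ↔
      i = 0 ∧ a ∈ Y ∧ ∃ y ∈ Y, G.Adj a y := by
    intro Y i
    simp only [mem_splitCluster_aCopy, trivialSplit_adj_aCopy h.not_adj, Sum.inl.injEq]
    grind
  have hB : ∀ Y i, bCopy V i ∈ splitCluster a b (trivialSplit G a b) Y ↔
      i = 0 ∧ b ∈ Y ∧ ∃ y ∈ Y, G.Adj b y := by
    intro Y i
    simp only [mem_splitCluster_bCopy, trivialSplit_adj_bCopy h.not_adj, Sum.inl.injEq]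
    grind
  refine { mem_left := h.mem_left, mem_right := h.mem_right, ne := h.ne, not_adj := h.not_adj,
           verts_eq := rfl, adj_old := ?_, union_left := ?_, disjoint_left := ?_,
           union_right := ?_, disjoint_right := ?_, mem_shared := h.mem_shared, not_twins := ?_,
           agree_left := ?_, agree_right := ?_ }
  · intro x y hx hy
    simp only [mem_insert_iff, mem_singleton_iff, not_or] at hx hy
    exact ⟨fun h => h.2.2, fun h => ⟨inl_mem_firstCopies.2 hx, inl_mem_firstCopies.2 hy, h⟩⟩
  · ext y
    simp only [mem_union, SimpleGraph.Subgraph.mem_neighborSet, trivialSplit_adj_aCopy h.not_adj,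
      mem_image]
    grind
  · rw [Set.disjoint_left]
    intro y _ hy
    exact absurd ((trivialSplit_adj_aCopy h.not_adj).1 hy).1 (by decide)
  · ext y
    simp only [mem_union, SimpleGraph.Subgraph.mem_neighborSet, trivialSplit_adj_bCopy h.not_adj,
      mem_image]
    grind
  · rw [Set.disjoint_left]
    intro y _ hy
    exact absurd ((trivialSplit_adj_bCopy h.not_adj).1 hy).1 (by decide)
  · rintro Y - - (ht | ht)
    · exact absurd ((hA Y 1).1 (ht 1)).1 (by decide)
    · exact absurd ((hB Y 1).1 (ht 1)).1 (by decide)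
  · intro Y hY Z hZ u hu hYZ hs hadj i
    have h1 : a ∈ Y ∩ Z := hYZ ▸ mem_insert _ _
    rw [hA, hA, h.agree_left Y hY Z hZ u hu hYZ hs hadj]
    simp [h1.1, h1.2]
  · intro Y hY Z hZ u hu hYZ hs hadj i
    have h1 : b ∈ Y ∩ Z := hYZ ▸ mem_insert _ _
    rw [hB, hB, h.agree_right Y hY Z hZ u hu hYZ hs hadj]
    simp [h1.1, h1.2]

theorem IsNonedgeSplit.exists_aCopy_adj_iff (h : IsNonedgeSplit G a b Gs) {v : V} :
    (∃ i, Gs.Adj (aCopy V i) (Sum.inl v)) ↔ G.Adj a v := by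
  have := Set.ext_iff.1 h.union_left (Sum.inl v)
  simp only [mem_union, SimpleGraph.Subgraph.mem_neighborSet, mem_image, Sum.inl.injEq,
    exists_eq_right] at this
  rw [← this, Fin.exists_fin_two]

theorem IsNonedgeSplit.exists_bCopy_adj_iff (h : IsNonedgeSplit G a b Gs) {v : V} :
    (∃ i, Gs.Adj (bCopy V i) (Sum.inl v)) ↔ G.Adj b v := by
  have := Set.ext_iff.1 h.union_right (Sum.inl v)
  simp only [mem_union, SimpleGraph.Subgraph.mem_neighborSet, mem_image, Sum.inl.injEq,
    exists_eq_right] at this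
  rw [← this, Fin.exists_fin_two]

theorem IsNonedgeSplit.exists_aCopy_mem_iff (h : IsNonedgeSplit G a b Gs) {Y : Set V} :
    (∃ i, aCopy V i ∈ splitCluster a b Gs Y) ↔ a ∈ Y ∧ ∃ y ∈ Y, G.Adj a y := by
  simp only [mem_splitCluster_aCopy, ← h.exists_aCopy_adj_iff]
  grind

theorem IsNonedgeSplit.exists_bCopy_mem_iff (h : IsNonedgeSplit G a b Gs) {Y : Set V} :
    (∃ i, bCopy V i ∈ splitCluster a b Gs Y) ↔ b ∈ Y ∧ ∃ y ∈ Y, G.Adj b y := by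
  simp only [mem_splitCluster_bCopy, ← h.exists_bCopy_adj_iff]
  grind

/-- Agreement for each copy implies agreement on whether some copy occurs, and some copy occurs
exactly when the cluster contains a neighbour of the end. Any safe split may thus be replaced by the
trivial one. -/
theorem IsSafeNonedgeSplit.isSplittableNonedge (h : IsSafeNonedgeSplit G X a b Gs) :
    IsSplittableNonedge G X a b where
  mem_left := h.mem_left
  mem_right := h.mem_right
  ne := h.ne
  not_adj := h.not_adj
  mem_shared := h.mem_shared
  agree_left Y hY Z hZ u hu hYZ hs hadj := by
    have h1 : a ∈ Y ∩ Z := hYZ ▸ mem_insert _ _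
    have h2 := exists_congr (h.agree_left Y hY Z hZ u hu hYZ hs hadj)
    rwa [h.exists_aCopy_mem_iff, h.exists_aCopy_mem_iff, and_iff_right h1.1,
      and_iff_right h1.2] at h2
  agree_right Y hY Z hZ u hu hYZ hs hadj := by
    have h1 : b ∈ Y ∩ Z := hYZ ▸ mem_insert _ _
    have h2 := exists_congr (h.agree_right Y hY Z hZ u hu hYZ hs hadj)
    rwa [h.exists_bCopy_mem_iff, h.exists_bCopy_mem_iff, and_iff_right h1.1,
      and_iff_right h1.2] at h2

end TrivialSplit

/-! ### Sums and Henneberg-I extensions -/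

section Pairs

variable {V : Type*} [Finite V]

theorem ncard_pairsIn (U : Set V) : (pairsIn U).ncard = ∑ i ∈ Finset.range U.ncard, i := by
  induction U, toFinite U using Set.Finite.induction_on with
  | empty =>
    simp only [ncard_empty, Finset.range_zero, Finset.sum_empty]
    rw [ncard_eq_zero]
    ext e
    induction e with | _ x y
    simp [mk_mem_pairsIn]
  | @insert w U hw _ ih =>
    rw [pairsIn_insert w U hw, ncard_insert_of_notMem hw, Finset.sum_range_succ, ← ih,
      ncard_union_eq ?_ (toFinite _) (toFinite _), ncard_starEdges]
    rw [Set.disjoint_left]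
    rintro _ he ⟨x, -, rfl⟩
    exact hw (he.2 w (by simp))

theorem completeRank_eq_sum {n : ℕ} (h : n ≤ 4) : completeRank n = ∑ i ∈ Finset.range n, i :=
  Finset.sum_congr rfl fun i hi => min_eq_right (by rw [Finset.mem_range] at hi; omega)

theorem completeRank_cases (n : ℕ) : (n ≤ 1 ∧ completeRank n = 0) ∨
    (n = 2 ∧ completeRank n = 1) ∨ (3 ≤ n ∧ completeRank n + 6 = 3 * n) := by
  rcases Nat.lt_or_ge n 3 with h | h
  · interval_cases n <;> decide
  · exact Or.inr (Or.inr ⟨h, completeRank_add_six h⟩)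

/-- The edges of `G` with both ends in `U`. -/
abbrev edgesIn (G : GraphOn V) (U : Set V) : Set (Sym2 V) := {e ∈ G.edgeSet | ∀ v ∈ e, v ∈ U}

theorem edgesIn_subset_pairsIn (G : GraphOn V) (U : Set V) : edgesIn G U ⊆ pairsIn U :=
  fun _ he => ⟨not_isDiag_of_mem_edgeSet he.1, he.2⟩

/-- Four vertices have only six pairs. -/
theorem spansClique_of_ncard {G : GraphOn V} {U : Set V} (hU : U ⊆ G.verts) (h4 : U.ncard = 4)
    (h6 : 6 ≤ (edgesIn G U).ncard) : SpansClique G U := by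
  refine ⟨hU, fun x hx y hy hne => ?_⟩
  have h1 : edgesIn G U = pairsIn U := by
    refine eq_of_subset_of_ncard_le (edgesIn_subset_pairsIn G U) ?_ (toFinite _)
    rw [ncard_pairsIn, h4]
    exact h6
  have h2 : s(x, y) ∈ edgesIn G U := h1 ▸ mk_mem_pairsIn.2 ⟨hne, hx, hy⟩
  exact h2.1

end Pairs

/-! ### Unions along small cliques, and extensions without new edges between old vertices. -/

namespace HasZeroExtensions

variable {V : Type*} [Finite V] {M : Matroid (Sym2 V)} (hM : HasZeroExtensions M)
  {I A : Set (Sym2 V)} {U W : Set V} {G H G' : GraphOn V}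

include hM

theorem edgeRank_pairsIn (U : Set V) : edgeRank M (pairsIn U) = completeRank U.ncard := by
  refine le_antisymm ?_ (hM.le_edgeRank_pairsIn U)
  rcases Nat.lt_or_ge U.ncard 3 with h | h
  · refine (edgeRank_le_ncard _ _).trans ?_
    rw [ncard_pairsIn, completeRank_eq_sum (by omega)]
  · have := hM.edgeRank_pairsIn_le h
    have := completeRank_add_six h
    omega

theorem ncard_edgesIn_le (hG : IsIndependent M G) (U : Set V) :
    (edgesIn G U).ncard ≤ completeRank U.ncard := by
  have h1 := edgeRank_mono (M := M) (edgesIn_subset_pairsIn G U)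
  rw [edgeRank_eq_ncard (hG.subset fun e he => he.1), hM.edgeRank_pairsIn] at h1
  exact_mod_cast h1

/-- Two independent graphs that share a complete graph on at most three vertices have an
independent union. -/
theorem isIndependent_sup (hG : IsIndependent M G) (hH : IsIndependent M H)
    (hc : (G.verts ∩ H.verts).ncard ≤ 3) (hcG : SpansClique G (G.verts ∩ H.verts))
    (hcH : SpansClique H (G.verts ∩ H.verts)) : IsIndependent M (G ⊔ H) := by
  -- `J` certifies that E(G) together with all pairs of V(H) has rank at least |E(G)| plus the rank
  -- of a complete graph on V(H), minus that on the common vertices.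
  obtain ⟨J, -, hJ, hJs, hJc⟩ := hM.exists_indep_extension (I := G.edgeSet) (U := G.verts)
    (W₀ := G.verts ∩ H.verts) (W := H.verts \ G.verts) hG
    (fun v ⟨e, he, hv⟩ => SimpleGraph.Subgraph.mem_verts_of_mem_edge he hv) inter_subset_left
    disjoint_sdiff_left
  have hW : G.verts ∩ H.verts ∪ H.verts \ G.verts = H.verts := by
    rw [inter_comm, inter_union_sdiff]
  have hWc : (G.verts ∩ H.verts).ncard + (H.verts \ G.verts).ncard = H.verts.ncard := by
    rw [inter_comm, ncard_inter_add_ncard_sdiff_eq_ncard _ _ (toFinite _)]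
  rw [hW] at hJs
  rw [hWc] at hJc
  obtain ⟨B, hHB, hBs, hB, hBc⟩ := exists_indep_superset_ncard_eq_edgeRank hH
    (edgeSet_subset_pairsIn H)
  rw [hM.edgeRank_pairsIn] at hBc
  have h1 := edgeRank_union_add_inter_le M (G.edgeSet ∪ B) (pairsIn H.verts)
  have h2 : edgeRank M B ≤ edgeRank M ((G.edgeSet ∪ B) ∩ pairsIn H.verts) :=
    edgeRank_mono fun e he => ⟨Or.inr he, hBs he⟩
  rw [edgeRank_eq_ncard hB] at h2
  rw [hM.edgeRank_pairsIn] at h1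
  have h3 : edgeRank M J ≤ edgeRank M (G.edgeSet ∪ B ∪ pairsIn H.verts) :=
    edgeRank_mono fun e he => (hJs he).imp_left Or.inl
  rw [edgeRank_eq_ncard hJ] at h3
  have h4 := ncard_union_add_ncard_inter G.edgeSet B
  have h5 : (pairsIn (G.verts ∩ H.verts)).ncard ≤ (G.edgeSet ∩ B).ncard := by
    refine ncard_le_ncard (fun e => ?_) (toFinite _)
    induction e with | _ x y
    rw [mk_mem_pairsIn]
    rintro ⟨hne, hx, hy⟩
    exact ⟨hcG.2 x hx y hy hne, hHB (hcH.2 x hx y hy hne)⟩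
  rw [ncard_pairsIn, ← completeRank_eq_sum (by omega)] at h5
  have h6 : M.Indep (G.edgeSet ∪ B) := indep_of_ncard_le_edgeRank (by omega)
  rw [IsIndependent, SimpleGraph.Subgraph.edgeSet_sup]
  exact h6.subset (union_subset_union_right _ hHB)

/-- Safe base graphs remain safe under independent extensions that add no edge between old
vertices. -/
theorem isSafeBaseGraph_of_le (hG : IsSafeBaseGraph M G) (hG' : IsIndependent M G') (hle : G ≤ G')
    (hadj : ∀ x ∈ G.verts, ∀ y ∈ G.verts, G'.Adj x y → G.Adj x y) : IsSafeBaseGraph M G' := by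
  obtain ⟨X, a, b, Gs, hw⟩ := hG
  have hsafe := hw.safe.isSplittableNonedge
  -- Two-element clusters have no nullity and create no shared pairs, so they can be discarded and
  -- rebuilt from the edges of the larger graph.
  set L := {Y ∈ X | 3 ≤ Y.ncard} with hL
  have hLX : L ⊆ X := fun Y hY => hY.1
  have hS : sharedSet L = sharedSet X := (sharedSet_mono hLX).antisymm
    (sharedSet_subset_of_large hw.cover.not_subset fun Y hY h3 => ⟨hY, h3⟩)
  have hLG : ∀ Y ∈ L, Y ⊆ G'.verts := fun Y hY => (hw.cover.subset_verts Y hY.1).trans hle.1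
  have hL3 : ∀ Y ∈ L, 3 ≤ Y.ncard := fun Y hY => hY.2
  have hthin : ∀ Y ∈ L, ∀ Z ∈ L, Y ≠ Z → (Y ∩ Z).ncard ≤ 2 := fun Y hY Z hZ =>
    hw.cover.inter_le Y hY.1 Z hZ.1
  have hSX := sharedSet_edgeCompletion hLG hL3 hthin
  have hE : G.edgeSet ⊆ G'.edgeSet := SimpleGraph.Subgraph.edgeSet_mono hle
  refine ⟨edgeCompletion G' L, a, b, _, hG', isTwoThinCover_edgeCompletion hLG hL3 hthin, ?_, ?_,
    IsSplittableNonedge.isSafeNonedgeSplit ?_⟩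
  · rw [hSX, hS]
    exact hw.indep_shared
  · refine edgeRank_eq_inclExcl_edgeCompletion hG' hLG hL3 hthin (hS ▸ hw.indep_shared)
      (P := sharedSet X) hS.subset (fun e => not_isDiag_of_mem_sharedSet) ?_
    have h1 := (rank_eq_inclExcl_iff hw.indep hw.cover).1 hw.rank_eq
    have h2 : ((sharedSet X \ G'.edgeSet).ncard : ℤ) ≤ (sharedSet X \ G.edgeSet).ncard := by
      exact_mod_cast ncard_le_ncard (sdiff_subset_sdiff_right hE) (toFinite _)
    refine h2.trans (h1.symm.le.trans ?_)
    have h3 : L.toFinite.toFinset ⊆ X.toFinite.toFinset := by simpa using hLX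
    rw [← Finset.sum_subset h3]
    · exact Finset.sum_le_sum fun Y _ => nullity_mono fun e he =>
        ⟨he.1.imp_left fun h => hE h, he.2⟩
    · intro Y hY hYL
      simp only [Finite.mem_toFinset] at hY hYL
      rw [nullity_eq_zero_iff]
      refine (hM.indep_pairsIn (U := Y) ?_).subset ?_
      · by_contra h
        exact hYL ⟨hY, by omega⟩
      · exact fun e he => ⟨he.1.elim not_isDiag_of_mem_edgeSet not_isDiag_of_mem_sharedSet, he.2⟩
  -- Two-element clusters of the completion are edges, so clusters that meet in a nonedge come from
  -- the original cover.
  · have key : ∀ c u, s(c, u) ∈ sharedSet X → ¬ G'.Adj c u → ∀ Y ∈ edgeCompletion G' L, ∀ Z, Y ∩ Z = {c, u} → Y ∈ L := by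
      rintro c u hs hcu Y (hY | ⟨x, y, hxy, rfl, -⟩) Z hYZ
      · exact hY
      · refine absurd ?_ hcu
        have hc : c ∈ ({x, y} : Set V) ∩ Z := hYZ ▸ mem_insert _ _
        have hu : u ∈ ({x, y} : Set V) ∩ Z := hYZ ▸ mem_insert_of_mem _ rfl
        have hne : c ≠ u := fun h => not_isDiag_of_mem_sharedSet hs (Sym2.mk_isDiag_iff.2 h)
        rcases hc.1 with rfl | rfl <;> rcases hu.1 with rfl | rfl
        exacts [absurd rfl hne, hxy, hxy.symm, absurd rfl hne]
    -- Original clusters lie in V(G), where the two graphs have the same adjacencies.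
    have good : ∀ c, c ∈ G.verts → ∀ Y ∈ L, ((∃ y ∈ Y, G'.Adj c y) ↔ ∃ y ∈ Y, G.Adj c y) :=
      fun c hc Y hY => ⟨fun ⟨y, hy, h⟩ => ⟨y, hy, hadj c hc y (hw.cover.subset_verts Y hY.1 hy) h⟩,
        fun ⟨y, hy, h⟩ => ⟨y, hy, hle.2 h⟩⟩
    refine ⟨hle.1 hsafe.mem_left, hle.1 hsafe.mem_right, hsafe.ne,
      fun h => hsafe.not_adj (hadj a hsafe.mem_left b hsafe.mem_right h), ?_, ?_, ?_⟩
    · rw [hSX, hS]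
      exact hsafe.mem_shared
    · intro Y hY Z hZ u hu hYZ hs hnadj
      rw [hSX, hS] at hs
      have hYL := key a u hs hnadj Y hY Z hYZ
      have hZL := key a u hs hnadj Z hZ Y (by rwa [inter_comm])
      rw [good a hsafe.mem_left Y hYL, good a hsafe.mem_left Z hZL]
      exact hsafe.agree_left Y hYL.1 Z hZL.1 u hu hYZ hs fun h => hnadj (hle.2 h)
    · intro Y hY Z hZ u hu hYZ hs hnadj
      rw [hSX, hS] at hs
      have hYL := key b u hs hnadj Y hY Z hYZ
      have hZL := key b u hs hnadj Z hZ Y (by rwa [inter_comm])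
      rw [good b hsafe.mem_right Y hYL, good b hsafe.mem_right Z hZL]
      exact hsafe.agree_right Y hYL.1 Z hZL.1 u hu hYZ hs fun h => hnadj (hle.2 h)

/-- Split U into its parts in G and H. If these share j vertices, the two counts bound the edges by
their sum minus the rank of K_j. If neither part contains the other, this stays below 3|U| - 6
unless j = 3 and both parts are tight. Nucleation-freeness then makes both parts K₄'s containing the
base triangle. -/
theorem isNucleationFree_sup (hG : IsIndependent M G) (hH : IsIndependent M H)
    (hGn : IsNucleationFree M G) (hHn : IsNucleationFree M H) {k : ℕ} (h : IsKSum k G H G')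
    (hk : k ≤ 2 ∨ k = 3 ∧
      (¬ IsInKFour G (G.verts ∩ H.verts) ∨ ¬ IsInKFour H (G.verts ∩ H.verts))) :
    IsNucleationFree M G' := by
  obtain ⟨hkc, hcG, hcH, rfl⟩ := h
  have hind := hM.isIndependent_sup hG hH (by omega) hcG hcH
  rw [hM.isNucleationFree_iff hG] at hGn
  rw [hM.isNucleationFree_iff hH] at hHn
  rw [hM.isNucleationFree_iff hind]
  intro U hU h5
  by_contra hlt
  set U₁ := U ∩ G.verts with hU₁
  set U₂ := U ∩ H.verts with hU₂
  have hEU : edgesIn (G ⊔ H) U ⊆ edgesIn G U₁ ∪ edgesIn H U₂ := by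
    rintro e ⟨he, heU⟩
    rw [SimpleGraph.Subgraph.edgeSet_sup] at he
    exact he.imp
      (fun he => ⟨he, fun v hv => ⟨heU v hv, SimpleGraph.Subgraph.mem_verts_of_mem_edge he hv⟩⟩)
      (fun he => ⟨he, fun v hv => ⟨heU v hv, SimpleGraph.Subgraph.mem_verts_of_mem_edge he hv⟩⟩)
  have hUU : U = U₁ ∪ U₂ := by
    rw [hU₁, hU₂, ← inter_union_distrib_left]
    exact (inter_eq_left.2 hU).symm
  have hsub : U₁ ∩ U₂ ⊆ G.verts ∩ H.verts := fun x hx => ⟨hx.1.2, hx.2.2⟩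
  have hP : pairsIn (U₁ ∩ U₂) ⊆ edgesIn G U₁ ∩ edgesIn H U₂ := by
    intro e
    induction e with | _ x y
    rw [mk_mem_pairsIn]
    rintro ⟨hne, hx, hy⟩
    refine ⟨⟨hcG.2 x (hsub hx) y (hsub hy) hne, ?_⟩, hcH.2 x (hsub hx) y (hsub hy) hne, ?_⟩
    · simp [hx.1, hy.1]
    · simp [hx.2, hy.2]
  have c1 := ncard_le_ncard hEU (toFinite _)
  have c2 := ncard_union_add_ncard_inter (edgesIn G U₁) (edgesIn H U₂)
  have c3 := ncard_le_ncard hP (toFinite _)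
  have c4 := ncard_le_ncard hsub (toFinite _)
  have c5 := ncard_union_add_ncard_inter U₁ U₂
  rw [← hUU] at c5
  rw [ncard_pairsIn, ← completeRank_eq_sum (by omega)] at c3
  have c6 := hM.ncard_edgesIn_le hG U₁
  have c7 := hM.ncard_edgesIn_le hH U₂
  have n1 : 5 ≤ U₁.ncard → (edgesIn G U₁).ncard + 6 < 3 * U₁.ncard := hGn U₁ inter_subset_right
  have n2 : 5 ≤ U₂.ncard → (edgesIn H U₂).ncard + 6 < 3 * U₂.ncard := hHn U₂ inter_subset_right
  have r1 := completeRank_cases U₁.ncard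
  have r2 := completeRank_cases U₂.ncard
  have r3 := completeRank_cases (U₁ ∩ U₂).ncard
  have i1 : (U₁ ∩ U₂).ncard ≤ U₁.ncard := ncard_le_ncard inter_subset_left (toFinite _)
  have i2 : (U₁ ∩ U₂).ncard ≤ U₂.ncard := ncard_le_ncard inter_subset_right (toFinite _)
  have hlt' : ¬ (edgesIn (G ⊔ H) U).ncard + 6 < 3 * U.ncard := hlt
  -- A part lying in the common clique contributes no edge that the other graph lacks, so the count
  -- in the other graph applies.
  by_cases t2 : (U₁ ∩ U₂).ncard = U₂.ncard
  · have : U₁ ∩ U₂ = U₂ := eq_of_subset_of_ncard_le inter_subset_right t2.ge (toFinite _)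
    have h2 : edgesIn H U₂ ⊆ edgesIn G U₁ := fun e he =>
      (hP (this.symm ▸ edgesIn_subset_pairsIn H U₂ he)).1
    have := ncard_le_ncard (hEU.trans (union_subset subset_rfl h2)) (toFinite _)
    omega
  by_cases t1 : (U₁ ∩ U₂).ncard = U₁.ncard
  · have : U₁ ∩ U₂ = U₁ := eq_of_subset_of_ncard_le inter_subset_left t1.ge (toFinite _)
    have h2 : edgesIn G U₁ ⊆ edgesIn H U₂ := fun e he =>
      (hP (this.symm ▸ edgesIn_subset_pairsIn G U₁ he)).2
    have := ncard_le_ncard (hEU.trans (union_subset h2 subset_rfl)) (toFinite _)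
    omega
  -- For j ≤ 2 the bound on the edges has slack.
  have j3 : (U₁ ∩ U₂).ncard = 3 := by omega
  have hfull : U₁ ∩ U₂ = G.verts ∩ H.verts :=
    eq_of_subset_of_ncard_le hsub (by omega) (toFinite _)
  rcases hk with hk | ⟨-, hk | hk⟩
  · omega
  · exact hk ⟨U₁, by omega, hfull ▸ inter_subset_left,
      spansClique_of_ncard inter_subset_right (by omega) (by omega)⟩
  · exact hk ⟨U₂, by omega, hfull ▸ inter_subset_right,
      spansClique_of_ncard inter_subset_right (by omega) (by omega)⟩

theorem ksum (hG : IsSafeBaseGraph M G) (hGn : IsNucleationFree M G) (hH : IsIndependent M H)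
    (hHn : IsNucleationFree M H) {k : ℕ} (h : IsKSum k G H G')
    (hk : k ≤ 2 ∨ k = 3 ∧
      (¬ IsInKFour G (G.verts ∩ H.verts) ∨ ¬ IsInKFour H (G.verts ∩ H.verts))) :
    IsNucleationFree M G' ∧ IsSafeBaseGraph M G' := by
  have hGi : IsIndependent M G := by
    obtain ⟨X, a, b, Gs, hw⟩ := hG
    exact hw.indep
  refine ⟨hM.isNucleationFree_sup hGi hH hGn hHn h hk, ?_⟩
  obtain ⟨hkc, hcG, hcH, rfl⟩ := h
  refine hM.isSafeBaseGraph_of_le hG (hM.isIndependent_sup hGi hH (by omega) hcG hcH) le_sup_left ?_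
  rintro x hx y hy (hxy | hxy)
  · exact hxy
  · exact hcG.2 x ⟨hx, hxy.fst_mem⟩ y ⟨hy, hxy.snd_mem⟩ hxy.ne

theorem edgeSet_hennebergI {w : V} (h : IsHennebergI G W w G') :
    G'.edgeSet = G.edgeSet ∪ starEdges w W := by
  ext e
  induction e with | _ x y
  simp only [SimpleGraph.Subgraph.mem_edgeSet, h.adj_iff, mem_union, mem_starEdges, Sym2.eq_iff]
  grind

/-- A tight set containing the new vertex loses exactly one vertex and three edges when it is
removed. The rest is again tight, hence has four vertices and is a K₄ containing W. -/
theorem hennebergI {w : V} (hG : IsSafeBaseGraph M G) (hGn : IsNucleationFree M G)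
    (h : IsHennebergI G W w G') (hW : ¬ IsInKFour G W) :
    IsNucleationFree M G' ∧ IsSafeBaseGraph M G' := by
  have hGi : IsIndependent M G := by
    obtain ⟨X, a, b, Gs, hw⟩ := hG
    exact hw.indep
  have hE := hM.edgeSet_hennebergI h
  have hwW : w ∉ W := fun hw => h.not_mem (h.subset_verts hw)
  have hG'i : IsIndependent M G' := by
    rw [IsIndependent, hE]
    exact hM.zero_ext _ _ _ hGi (fun ⟨e, he, hv⟩ =>
      h.not_mem (SimpleGraph.Subgraph.mem_verts_of_mem_edge he hv)) hwW h.ncard_eq.le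
  refine ⟨?_, hM.isSafeBaseGraph_of_le hG hG'i ⟨?_, ?_⟩ ?_⟩
  · rw [hM.isNucleationFree_iff hGi] at hGn
    rw [hM.isNucleationFree_iff hG'i]
    intro U hU h5
    by_contra hlt
    have hlt' : ¬ (edgesIn G' U).ncard + 6 < 3 * U.ncard := hlt
    have hUG : U \ {w} ⊆ G.verts := by
      rintro x ⟨hx, hxw⟩
      exact ((h.verts_eq ▸ hU hx : x ∈ insert w G.verts)).resolve_left hxw
    have hsub : edgesIn G' U ⊆ edgesIn G (U \ {w}) ∪ starEdges w (W ∩ U) := by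
      rintro e ⟨he, heU⟩
      rw [hE] at he
      rcases he with he | ⟨x, hx, rfl⟩
      · refine Or.inl ⟨he, fun v hv => ⟨heU v hv, ?_⟩⟩
        rintro rfl
        exact h.not_mem (SimpleGraph.Subgraph.mem_verts_of_mem_edge he hv)
      · exact Or.inr ⟨x, ⟨hx, heU x (by simp)⟩, rfl⟩
    by_cases hw : w ∈ U
    · have c1 := (ncard_le_ncard hsub (toFinite _)).trans (ncard_union_le _ _)
      have c2 := ncard_sdiff_singleton_add_one hw (toFinite _)
      have c3 := hM.ncard_edgesIn_le hGi (U \ {w})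
      have c4 := completeRank_add_six (n := (U \ {w}).ncard) (by omega)
      have c5 := ncard_le_ncard (inter_subset_left : W ∩ U ⊆ W) (toFinite _)
      have c6 := h.ncard_eq
      have n1 : 5 ≤ (U \ {w}).ncard → (edgesIn G (U \ {w})).ncard + 6 < 3 * (U \ {w}).ncard :=
        hGn _ hUG
      rw [ncard_starEdges] at c1
      have hWU : W ∩ U = W := eq_of_subset_of_ncard_le inter_subset_left (by omega) (toFinite _)
      refine hW ⟨U \ {w}, by omega, fun x hx => ⟨(inter_eq_left.1 hWU) hx, ?_⟩,
        spansClique_of_ncard hUG (by omega) (by omega)⟩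
      rintro rfl
      exact hwW hx
    · have hU' : U \ {w} = U := sdiff_singleton_eq_self hw
      rw [hU'] at hsub hUG
      have hsub' : edgesIn G' U ⊆ edgesIn G U := by
        intro e he
        rcases hsub he with h1 | ⟨x, -, rfl⟩
        · exact h1
        · exact absurd (he.2 w (by simp)) hw
      have c1 := ncard_le_ncard hsub' (toFinite _)
      have n1 : (edgesIn G U).ncard + 6 < 3 * U.ncard := hGn _ hUG h5
      omega
  · rw [h.verts_eq]
    exact subset_insert _ _
  · exact fun x y hxy => (h.adj_iff x y).2 (Or.inl hxy)
  · intro x hx y hy hxy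
    rcases (h.adj_iff x y).1 hxy with h1 | ⟨rfl, -⟩ | ⟨rfl, -⟩
    · exact h1
    · exact absurd hx h.not_mem
    · exact absurd hy h.not_mem

end HasZeroExtensions

/-! ### Abstract rigidity matroids are closed under zero-extensions -/

section Abstract

variable {V : Type*} [Finite V] {M : Matroid (Sym2 V)}

theorem edgeSupport_pairsIn {U : Set V} (hU : 2 ≤ U.ncard) : edgeSupport (pairsIn U) = U := by
  refine (edgeSupport_pairsIn_subset U).antisymm fun v hv => ?_
  obtain ⟨w, hw, hne⟩ := exists_ne_of_one_lt_ncard hU v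
  exact ⟨s(v, w), mk_mem_pairsIn.2 ⟨hne.symm, hv, hw⟩, by simp⟩

theorem edgeSupport_empty : edgeSupport (∅ : Set (Sym2 V)) = ∅ := by simp [edgeSupport]

theorem pairsIn_empty : pairsIn (∅ : Set V) = ∅ := by
  rw [← ncard_eq_zero, ncard_pairsIn]
  simp

theorem IsAbstractRigidityMatroid.closure_pairsIn (hM : IsAbstractRigidityMatroid M) (U : Set V) :
    M.closure (pairsIn U) = pairsIn (edgeSupport (pairsIn U)) := by
  have hE : pairsIn U ⊆ M.E := hM.ground_eq ▸ pairsIn_mono (subset_univ _)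
  refine Subset.antisymm ?_
    ((pairsIn_mono (edgeSupport_pairsIn_subset U)).trans (M.subset_closure _ hE))
  have := hM.closure_union_subset (pairsIn U) ∅ hE (empty_subset _) (by simp [edgeSupport_empty])
  rwa [union_empty, edgeSupport_empty, pairsIn_empty, union_empty] at this

/-- The edges at the new vertex are added one at a time. The old set and the star built so far share
at most two vertices, so Graver's first closure axiom keeps the next edge out of the closure. The
Maxwell bound follows from the second axiom: all pairs on n + 1 vertices lie in the closure of those
on n vertices and three edges at the last one. -/
theorem IsAbstractRigidityMatroid.hasZeroExtensions (hM : IsAbstractRigidityMatroid M) :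
    HasZeroExtensions M where
  ground_eq := hM.ground_eq
  zero_ext I w W hI hwI hwW hW := by
    induction W, toFinite W using Set.Finite.induction_on with
    | empty => simpa [starEdges] using hI
    | @insert x W hx _ ih =>
      rw [ncard_insert_of_notMem hx] at hW
      have ih' := ih (fun h => hwW (mem_insert_of_mem _ h)) (by omega)
      have hst : starEdges w (insert x W) = insert s(w, x) (starEdges w W) := image_insert_eq
      rw [hst, union_insert, ih'.insert_indep_iff]
      refine Or.inl ⟨?_, fun hcl => ?_⟩
      · rw [hM.ground_eq, mk_mem_pairsIn]
        exact ⟨fun h => hwW (h ▸ mem_insert _ _), trivial, trivial⟩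
      · have h1 := hM.closure_union_subset I (starEdges w W) hI.subset_ground
          (ih'.subset subset_union_right).subset_ground ?_ hcl
        · rcases h1 with h1 | h1
          · exact hwI (mk_mem_pairsIn.1 h1).2.1
          · rcases edgeSupport_starEdges_subset w W (mk_mem_pairsIn.1 h1).2.2 with h | h
            · exact hwW (h ▸ mem_insert _ _)
            · exact hx h
        · refine (ncard_le_ncard (t := W) ?_ (toFinite _)).trans_lt (by omega)
          rintro v ⟨hv, hv'⟩
          rcases edgeSupport_starEdges_subset w W hv' with h | h
          · exact absurd (h ▸ hv) hwI
          · exact h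
  card_le I U hI hIU hU := by
    have key : ∀ n, 3 ≤ n → ∀ U : Set V, U.ncard = n →
        edgeRank M (pairsIn U) + 6 ≤ 3 * n := by
      intro n hn
      induction n, hn using Nat.le_induction with
      | base =>
        intro U hU
        have := edgeRank_le_ncard M (pairsIn U)
        rw [ncard_pairsIn, hU] at this
        simp only [Finset.sum_range_succ, Finset.range_zero, Finset.sum_empty] at this
        omega
      | succ n hn ih =>
        intro U hU
        obtain ⟨w, hw⟩ : U.Nonempty := nonempty_of_ncard_ne_zero (by omega)
        obtain ⟨U', rfl, hwU⟩ : ∃ U', insert w U' = U ∧ w ∉ U' :=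
          ⟨U \ {w}, by simp [insert_eq_of_mem hw], by simp⟩
        rw [ncard_insert_of_notMem hwU] at hU
        obtain ⟨T, hT, hTc⟩ := Set.exists_subset_card_eq (s := U') (n := 3) (by omega)
        have hwT : w ∉ T := fun h => hwU (hT h)
        have hsup : edgeSupport (pairsIn U') = U' := edgeSupport_pairsIn (by omega)
        have hsupT : edgeSupport (pairsIn (insert w T)) = insert w T :=
          edgeSupport_pairsIn (by rw [ncard_insert_of_notMem hwT]; omega)
        have hgr : ∀ W : Set V, pairsIn W ⊆ M.E :=
          fun W => hM.ground_eq ▸ pairsIn_mono (subset_univ _)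
        -- The complete graphs on U' and on T + w share the three vertices of T, and the pairs of T
        -- are already present in U'. Only the three edges from w to T are new.
        have hcl := hM.closure_union_eq (pairsIn U') (pairsIn (insert w T)) (hgr _) (hgr _)
          (hM.closure_pairsIn _) (hM.closure_pairsIn _) (by
            rw [hsup, hsupT, ← hTc]
            exact ncard_le_ncard (fun x hx => ⟨hT hx, mem_insert_of_mem _ hx⟩) (toFinite _))
        rw [hsup, hsupT, union_insert, union_eq_self_of_subset_right hT, pairsIn_insert w T hwT,
          ← union_assoc, union_eq_self_of_subset_right (pairsIn_mono hT)] at hcl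
        have h1 := edgeRank_union_le_of_subset_closure hcl.symm.subset
        have h2 := edgeRank_mono (M := M) (subset_union_right
          (s := pairsIn U' ∪ starEdges w T) (t := pairsIn (insert w U')))
        have h3 := edgeRank_union_add_inter_le M (pairsIn U') (starEdges w T)
        have h4 := edgeRank_le_ncard M (starEdges w T)
        rw [ncard_starEdges] at h4
        have h5 : (0 : ℤ) ≤ edgeRank M (pairsIn U' ∩ starEdges w T) := by
          unfold edgeRank; positivity
        have := ih U' (by omega)
        push_cast
        omega
    have h1 := key _ hU U rfl
    have h2 := edgeRank_mono (M := M) hIU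
    rw [edgeRank_eq_ncard hI] at h2
    omega

end Abstract

/-! ### Linear algebra of rows -/

section LinearAlgebra

variable {ι E F : Type*} [AddCommGroup E] [Module ℝ E] [AddCommGroup F] [Module ℝ F]
  {v w : ι → E} {A B : Set ι}

theorem linearIndepOn_congr_units (h : ∀ i ∈ A, ∃ s : ℝˣ, v i = s • w i) :
    LinearIndepOn ℝ v A ↔ LinearIndepOn ℝ w A := by
  choose! s hs using h
  have h1 : LinearIndepOn ℝ v A ↔ LinearIndependent ℝ ((fun i : A => s i) • fun i : A => w i) := by
    have : (fun i : A => v i) = (fun i : A => s i) • fun i : A => w i := by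
      ext i
      exact hs i i.2
    rw [← this]
    rfl
  rw [h1, LinearIndependent.units_smul_iff]
  rfl

theorem span_congr_units (h : ∀ i ∈ A, ∃ s : ℝˣ, v i = s • w i) :
    Submodule.span ℝ (v '' A) = Submodule.span ℝ (w '' A) := by
  refine le_antisymm (Submodule.span_le.2 ?_) (Submodule.span_le.2 ?_)
  · rintro _ ⟨i, hi, rfl⟩
    obtain ⟨s, hs⟩ := h i hi
    rw [hs]
    exact Submodule.smul_mem _ (s : ℝ) (Submodule.subset_span ⟨i, hi, rfl⟩)
  · rintro _ ⟨i, hi, rfl⟩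
    obtain ⟨s, hs⟩ := h i hi
    have : w i = (s⁻¹ : ℝˣ) • v i := by rw [hs, inv_smul_smul]
    rw [this]
    exact Submodule.smul_mem _ ((s⁻¹ : ℝˣ) : ℝ) (Submodule.subset_span ⟨i, hi, rfl⟩)

theorem LinearIndepOn.disjoint_span_ker {f : E →ₗ[ℝ] F} (h : LinearIndepOn ℝ (f ∘ v) A) :
    Disjoint (Submodule.span ℝ (v '' A)) (LinearMap.ker f) := by
  rw [Submodule.disjoint_def]
  intro x hx hf
  rw [Finsupp.mem_span_image_iff_linearCombination] at hx
  obtain ⟨l, hl, rfl⟩ := hx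
  rw [linearIndepOn_iff] at h
  rw [LinearMap.mem_ker, Finsupp.apply_linearCombination] at hf
  rw [h l hl hf, map_zero]

/-- Independence of a union can be checked in part after applying a linear map. -/
theorem LinearIndepOn.union_of_comp {f : E →ₗ[ℝ] F} (hA : LinearIndepOn ℝ (f ∘ v) A)
    (hB : LinearIndepOn ℝ v B)
    (hd : Disjoint (Submodule.span ℝ ((f ∘ v) '' A)) (Submodule.span ℝ ((f ∘ v) '' B))) :
    LinearIndepOn ℝ v (A ∪ B) := by
  refine LinearIndepOn.union (hA.of_comp f) hB ?_
  rw [Submodule.disjoint_def]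
  intro x hx hx'
  refine Submodule.disjoint_def.1 hA.disjoint_span_ker x hx ?_
  rw [LinearMap.mem_ker]
  refine Submodule.disjoint_def.1 hd _ ?_ ?_
  · rw [image_comp, ← Submodule.map_span]
    exact Submodule.mem_map_of_mem hx
  · rw [image_comp, ← Submodule.map_span]
    exact Submodule.mem_map_of_mem hx'

theorem LinearIndepOn.union_of_comp_eq_zero {f : E →ₗ[ℝ] F} (hA : LinearIndepOn ℝ (f ∘ v) A)
    (hB : LinearIndepOn ℝ v B) (h0 : ∀ i ∈ B, f (v i) = 0) : LinearIndepOn ℝ v (A ∪ B) := by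
  refine hA.union_of_comp hB ?_
  have : Submodule.span ℝ ((f ∘ v) '' B) = ⊥ := by
    rw [Submodule.span_eq_bot]
    rintro _ ⟨i, hi, rfl⟩
    exact h0 i hi
  rw [this]
  exact disjoint_bot_right

end LinearAlgebra

/-! ### The generic matroids -/

namespace GenericKind

/-- The dimension of the space in which the vertices are placed. -/
@[reducible]
def dim : GenericKind → ℕ
  | rigidity => 3
  | cofactor => 2

/-- The coefficient vector of an edge. -/
def coeff : (κ : GenericKind) → (Fin κ.dim → ℝ) → (Fin κ.dim → ℝ) → Fin 3 → ℝ
  | rigidity => rigidityCoeff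
  | cofactor => cofactorCoeff

theorem coeff_polynomial (κ : GenericKind) {V : Type*} (u v : V) (i : Fin 3) :
    ∃ P : MvPolynomial (V × Fin κ.dim) ℝ, ∀ p : V → Fin κ.dim → ℝ,
      κ.coeff (p u) (p v) i = MvPolynomial.eval (fun x => p x.1 x.2) P := by
  cases κ
  · exact rigidityCoeff_polynomial u v i
  · exact cofactorCoeff_polynomial u v i

theorem coeff_swap (κ : GenericKind) : ∃ s : ℝˣ, ∀ x y, κ.coeff y x = s • κ.coeff x y := by
  cases κ
  · refine ⟨-1, fun x y => ?_⟩
    ext i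
    simp [coeff, rigidityCoeff]
  · refine ⟨1, fun x y => ?_⟩
    ext i
    fin_cases i <;> simp [coeff, cofactorCoeff] <;> ring

end GenericKind

theorem genericMatroid_indep_iff {κ : GenericKind} {V : Type*} [Finite V] {I : Set (Sym2 V)} :
    (genericMatroid κ V).Indep I ↔
      I ⊆ pairsIn Set.univ ∧ ∃ p, LinearIndepOn ℝ (edgeRow κ.coeff p) I := by
  cases κ <;> exact Iff.rfl

theorem genericMatroid_ground (κ : GenericKind) (V : Type*) [Finite V] :
    (genericMatroid κ V).E = pairsIn Set.univ := by
  cases κ <;> rfl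

/-! ### Rows of oriented pairs and their push-forward along vertex maps. -/

section Rows

variable {κ : GenericKind} {V W : Type*}

open Classical in
/-- The row of an oriented pair. -/
noncomputable def orientedRow (κ : GenericKind) (p : V → Fin κ.dim → ℝ) (u v : V) :
    V × Fin 3 → ℝ := fun wi =>
  (if wi.1 = u then κ.coeff (p u) (p v) wi.2 else 0) -
    if wi.1 = v then κ.coeff (p u) (p v) wi.2 else 0

theorem orientedRow_swap (κ : GenericKind) :
    ∃ s : ℝˣ, ∀ {V : Type*} (p : V → Fin κ.dim → ℝ) (u v : V),
      orientedRow κ p v u = s • orientedRow κ p u v := by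
  obtain ⟨s, hs⟩ := κ.coeff_swap
  refine ⟨-s, fun p u v => ?_⟩
  ext wi
  have h2 : κ.coeff (p v) (p u) wi.2 = s * κ.coeff (p u) (p v) wi.2 := by
    rw [hs, Pi.smul_apply, Units.smul_def, smul_eq_mul]
  simp only [orientedRow, Pi.smul_apply, Units.smul_def, smul_eq_mul, Units.val_neg, h2]
  split_ifs <;> ring

/-- The orientation chosen by `Quot.out` is unknown, but reversal changes the row only by a unit.
Rows are therefore compared up to units from here on. -/
theorem edgeRow_mk (p : V → Fin κ.dim → ℝ) (u v : V) :
    ∃ s : ℝˣ, edgeRow κ.coeff p s(u, v) = s • orientedRow κ p u v := by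
  have h1 : edgeRow κ.coeff p s(u, v) =
    orientedRow κ p (Quot.out s(u, v)).1 (Quot.out s(u, v)).2 := rfl
  have h2 : s((Quot.out s(u, v)).1, (Quot.out s(u, v)).2) = s(u, v) := Quot.out_eq _
  rcases Sym2.eq_iff.1 h2 with ⟨h3, h4⟩ | ⟨h3, h4⟩
  · exact ⟨1, by rw [h1, h3, h4, one_smul]⟩
  · obtain ⟨s, hs⟩ := orientedRow_swap κ
    exact ⟨s, by rw [h1, h3, h4, hs]⟩

variable [Finite V] [Finite W]

open Classical in
/-- Adding up the coordinates of the vertices with the same image. -/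
noncomputable def pushRow (f : V → W) : (V × Fin 3 → ℝ) →ₗ[ℝ] (W × Fin 3 → ℝ) :=
  letI := Fintype.ofFinite V
  { toFun := fun r wi => ∑ v, if wi.1 = f v then r (v, wi.2) else 0
    map_add' := fun r r' => by
      ext wi
      simp only [Pi.add_apply, ← Finset.sum_add_distrib]
      refine Finset.sum_congr rfl fun v _ => ?_
      split_ifs <;> simp
    map_smul' := fun c r => by
      ext wi
      simp only [Pi.smul_apply, smul_eq_mul, Finset.mul_sum, RingHom.id_apply]
      refine Finset.sum_congr rfl fun v _ => ?_
      split_ifs <;> simp }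

/-- Coefficients depend only on positions, so the identity holds because identified vertices share a
position. A pair with identified ends is sent to zero. -/
theorem pushRow_orientedRow (f : V → W) (p : W → Fin κ.dim → ℝ) (u v : V) :
    pushRow f (orientedRow κ (p ∘ f) u v) = orientedRow κ p (f u) (f v) := by
  classical
  let := Fintype.ofFinite V
  have key : ∀ (x : V) (w : W) (c : ℝ),
      (∑ y, if w = f y then (if y = x then c else 0) else 0) = if w = f x then c else 0 := by
    intro x w c
    rw [Finset.sum_eq_single x]
    · simp
    · intro y _ hy
      simp [hy]
    · simp
  ext ⟨w, i⟩
  change (∑ y, if w = f y then orientedRow κ (p ∘ f) u v (y, i) else 0) = _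
  have h1 : ∀ y, (if w = f y then orientedRow κ (p ∘ f) u v (y, i) else 0) =
      (if w = f y then (if y = u then κ.coeff (p (f u)) (p (f v)) i else 0) else 0) -
        if w = f y then (if y = v then κ.coeff (p (f u)) (p (f v)) i else 0) else 0 := by
    intro y
    simp only [orientedRow, Function.comp_apply]
    split_ifs <;> simp
  simp_rw [h1, Finset.sum_sub_distrib, key]
  rfl

theorem pushRow_edgeRow (f : V → W) (p : W → Fin κ.dim → ℝ) (e : Sym2 V) :
    ∃ s : ℝˣ, pushRow f (edgeRow κ.coeff (p ∘ f) e) = s • edgeRow κ.coeff p (e.map f) := by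
  induction e with | _ u v
  obtain ⟨s, hs⟩ := edgeRow_mk (κ := κ) (p ∘ f) u v
  obtain ⟨t, ht⟩ := edgeRow_mk (κ := κ) p (f u) (f v)
  refine ⟨s * t⁻¹, ?_⟩
  rw [hs, Sym2.map_mk, ht, Units.smul_def, map_smul, pushRow_orientedRow, ← Units.smul_def,
    mul_smul, inv_smul_smul]

theorem pushRow_injective {f : V → W} (hf : Function.Injective f) :
    Function.Injective (pushRow f) := by
  classical
  let := Fintype.ofFinite V
  intro r r' h
  ext ⟨v, i⟩
  have key : ∀ r, pushRow f r (f v, i) = r (v, i) := by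
    intro r
    change (∑ y, if f v = f y then r (y, i) else 0) = _
    simp [hf.eq_iff]
  rw [← key r, ← key r', h]

/-- Splitting vertices in place: if the part `A` has an independent image that is independent of
the image of `B`, then `A ∪ B` is independent as soon as `B` is. -/
theorem linearIndepOn_edgeRow_union (f : V → W) (p : W → Fin κ.dim → ℝ) {A B : Set (Sym2 V)}
    {C D : Set (Sym2 W)} (hA : InjOn (Sym2.map f) A) (hAC : MapsTo (Sym2.map f) A C)
    (hBD : MapsTo (Sym2.map f) B D) (hCD : Disjoint C D)
    (hp : LinearIndepOn ℝ (edgeRow κ.coeff p) (C ∪ D))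
    (hB : LinearIndepOn ℝ (edgeRow κ.coeff (p ∘ f)) B) :
    LinearIndepOn ℝ (edgeRow κ.coeff (p ∘ f)) (A ∪ B) := by
  have h := fun e => pushRow_edgeRow (κ := κ) f p e
  have hu : ∀ A : Set (Sym2 V), ∀ e ∈ A, ∃ s : ℝˣ, (pushRow f ∘ edgeRow κ.coeff (p ∘ f)) e =
      s • (edgeRow κ.coeff p ∘ Sym2.map f) e := fun A e _ => h e
  have h1 := (linearIndepOn_union_iff hCD).1 hp
  refine LinearIndepOn.union_of_comp (f := pushRow f) ?_ hB ?_
  · rw [linearIndepOn_congr_units (hu A)]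
    exact (h1.1.mono hAC.image_subset).comp_of_image hA
  · rw [span_congr_units (hu A), span_congr_units (hu B), image_comp, image_comp]
    exact h1.2.2.mono (Submodule.span_mono (image_mono hAC.image_subset))
      (Submodule.span_mono (image_mono hBD.image_subset))

theorem linearIndepOn_edgeRow_of_injOn (f : V → W) (p : W → Fin κ.dim → ℝ) {A : Set (Sym2 V)}
    {C : Set (Sym2 W)} (hA : InjOn (Sym2.map f) A) (hAC : MapsTo (Sym2.map f) A C)
    (hp : LinearIndepOn ℝ (edgeRow κ.coeff p) C) :
    LinearIndepOn ℝ (edgeRow κ.coeff (p ∘ f)) A := by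
  have := linearIndepOn_edgeRow_union f p hA hAC (mapsTo_empty _ ∅) (disjoint_empty C)
    (by rwa [union_empty]) (linearIndepOn_empty _ _)
  rwa [union_empty] at this

/-- Extending a placement by zero does not affect rows of pairs of old vertices, and `pushRow` along
an embedding only pads rows by zeros. -/
theorem genericMatroid_indep_image_iff (f : V ↪ W) {I : Set (Sym2 V)} :
    (genericMatroid κ W).Indep (Sym2.map f '' I) ↔ (genericMatroid κ V).Indep I := by
  have hf := Sym2.map.injective f.injective
  have hdiag : Sym2.map f '' I ⊆ pairsIn Set.univ ↔ I ⊆ pairsIn Set.univ := by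
    rw [image_subset_iff]
    refine forall₂_congr fun e _ => ?_
    induction e with | _ u v
    simp [mk_mem_pairsIn]
  rw [genericMatroid_indep_iff, genericMatroid_indep_iff, hdiag]
  refine and_congr_right fun _ => ⟨fun ⟨p, hp⟩ => ⟨p ∘ f, ?_⟩, fun ⟨q, hq⟩ => ?_⟩
  · exact linearIndepOn_edgeRow_of_injOn f p hf.injOn (mapsTo_image _ _) hp
  · refine ⟨Function.extend f q 0, LinearIndepOn.image_of_comp _ _ ?_⟩
    have hpq : Function.extend f q 0 ∘ f = q :=
      funext fun v => f.injective.extend_apply _ _ v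
    refine (linearIndepOn_congr_units (v := pushRow f ∘ edgeRow κ.coeff (Function.extend f q 0 ∘ f))
      fun e _ => pushRow_edgeRow f _ e).1 ?_
    rw [hpq]
    exact hq.map_injOn _ (pushRow_injective f.injective).injOn

theorem nullity_genericMatroid_image (f : V ↪ W) (A : Set (Sym2 V)) :
    nullity (genericMatroid κ W) (Sym2.map f '' A) = nullity (genericMatroid κ V) A :=
  nullity_image (Sym2.map.injective f.injective) (fun _ => genericMatroid_indep_image_iff f) A

/-! ### Zero-extensions of placements -/

/-- The coordinates of a vertex. -/
def vertexCoord (w : V) : (V × Fin 3 → ℝ) →ₗ[ℝ] (Fin 3 → ℝ) :=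
  LinearMap.funLeft ℝ ℝ fun i => (w, i)

theorem vertexCoord_edgeRow_of_notMem (p : V → Fin κ.dim → ℝ) {w : V} {e : Sym2 V} (hw : w ∉ e) :
    vertexCoord w (edgeRow κ.coeff p e) = 0 := by
  induction e with | _ u v
  obtain ⟨s, hs⟩ := edgeRow_mk (κ := κ) p u v
  rw [Sym2.mem_iff, not_or] at hw
  ext i
  change edgeRow κ.coeff p s(u, v) (w, i) = 0
  rw [hs]
  simp [orientedRow, hw.1, hw.2]

theorem vertexCoord_edgeRow (p : V → Fin κ.dim → ℝ) {w x : V} (hx : x ≠ w) :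
    ∃ s : ℝˣ, vertexCoord w (edgeRow κ.coeff p s(w, x)) = s • κ.coeff (p w) (p x) := by
  obtain ⟨s, hs⟩ := edgeRow_mk (κ := κ) p w x
  refine ⟨s, ?_⟩
  ext i
  change edgeRow κ.coeff p s(w, x) (w, i) = _
  rw [hs]
  simp [orientedRow, hx.symm]

/-- Projecting to the coordinates of w kills the old rows and leaves the coefficient vectors of the
star. Unlike a generic statement, this works at a given placement, even a degenerate one. -/
theorem linearIndepOn_edgeRow_union_starEdges (p : V → Fin κ.dim → ℝ) {I : Set (Sym2 V)} {w : V}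
    {U : Set V} (hI : LinearIndepOn ℝ (edgeRow κ.coeff p) I) (hw : w ∉ edgeSupport I) (hwU : w ∉ U)
    (hU : LinearIndepOn ℝ (fun x => κ.coeff (p w) (p x)) U) :
    LinearIndepOn ℝ (edgeRow κ.coeff p) (I ∪ starEdges w U) := by
  rw [union_comm]
  refine LinearIndepOn.union_of_comp_eq_zero (f := vertexCoord w) (LinearIndepOn.image_of_comp _ _ ?_)
    hI fun e he => vertexCoord_edgeRow_of_notMem p fun h => hw ⟨e, he, h⟩
  refine (linearIndepOn_congr_units fun x hx => ?_).2 hU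
  exact vertexCoord_edgeRow p fun h => hwU (h ▸ hx)

open Classical in
/-- The row with a given entry at a single vertex. -/
noncomputable def vertexRow (w : V) : (Fin 3 → ℝ) →ₗ[ℝ] (V × Fin 3 → ℝ) :=
  { toFun := fun c wi => if wi.1 = w then c wi.2 else 0
    map_add' := fun c c' => by
      ext wi
      simp only [Pi.add_apply]
      split_ifs <;> simp
    map_smul' := fun c r => by
      ext wi
      simp only [Pi.smul_apply, RingHom.id_apply]
      split_ifs <;> simp }

theorem vertexCoord_vertexRow (w : V) (c : Fin 3 → ℝ) : vertexCoord w (vertexRow w c) = c := by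
  ext i
  simp [vertexCoord, vertexRow, LinearMap.funLeft_apply]

theorem vertexCoord_vertexRow_of_ne {w x : V} (h : w ≠ x) (c : Fin 3 → ℝ) :
    vertexCoord w (vertexRow x c) = 0 := by
  ext i
  simp [vertexCoord, vertexRow, LinearMap.funLeft_apply, h]

theorem vertexRow_injective (w : V) : Function.Injective (vertexRow w) :=
  Function.LeftInverse.injective (vertexCoord_vertexRow w)

/-- Two families of rows with polynomial entries, each independent at some placement, are
simultaneously independent at some placement. -/
theorem exists_common_placement {α β : Type*} {d : ℕ} {r : (V → Fin d → ℝ) → α → V × Fin 3 → ℝ}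
    {r' : (V → Fin d → ℝ) → β → V × Fin 3 → ℝ}
    (hr : ∀ a j, ∃ P : MvPolynomial (V × Fin d) ℝ,
      ∀ p, r p a j = MvPolynomial.eval (fun x => p x.1 x.2) P)
    (hr' : ∀ a j, ∃ P : MvPolynomial (V × Fin d) ℝ,
      ∀ p, r' p a j = MvPolynomial.eval (fun x => p x.1 x.2) P)
    {I : Set α} {K : Set β} (hI : I.Finite) (hK : K.Finite)
    (h₁ : ∃ p, LinearIndepOn ℝ (r p) I) (h₂ : ∃ p, LinearIndepOn ℝ (r' p) K) :
    ∃ p, LinearIndepOn ℝ (r p) I ∧ LinearIndepOn ℝ (r' p) K := by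
  obtain ⟨p, hp, hp'⟩ := exists_common_linearIndepOn (fun p => Sum.elim (r p) (r' p))
    (by rintro (a | a) j; exacts [hr a j, hr' a j]) (hI.image Sum.inl) (hK.image Sum.inr)
    (h₁.imp fun p hp => LinearIndepOn.image_of_comp _ _ hp)
    (h₂.imp fun p hp => LinearIndepOn.image_of_comp _ _ hp)
  exact ⟨p, hp.comp_of_image Sum.inl_injective.injOn, hp'.comp_of_image Sum.inr_injective.injOn⟩

/-- The coefficient vector of the pair `(w, x)` at the vertex `w` only. -/
noncomputable def pinRow (κ : GenericKind) (p : V → Fin κ.dim → ℝ) (wx : V × V) : V × Fin 3 → ℝ :=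
  vertexRow wx.1 (κ.coeff (p wx.1) (p wx.2))

theorem pinRow_polynomial (wx : V × V) (j : V × Fin 3) :
    ∃ P : MvPolynomial (V × Fin κ.dim) ℝ,
      ∀ p, pinRow κ p wx j = MvPolynomial.eval (fun x => p x.1 x.2) P := by
  classical
  obtain ⟨P, hP⟩ := κ.coeff_polynomial wx.1 wx.2 j.2
  refine ⟨if j.1 = wx.1 then P else 0, fun p => ?_⟩
  change (if j.1 = wx.1 then κ.coeff (p wx.1) (p wx.2) j.2 else 0) = _
  split_ifs <;> simp [hP]

theorem linearIndepOn_pinRow_iff (p : V → Fin κ.dim → ℝ) (w : V) (U : Set V) :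
    LinearIndepOn ℝ (pinRow κ p) (Prod.mk w '' U) ↔
      LinearIndepOn ℝ (fun x => κ.coeff (p w) (p x)) U := by
  have h1 : pinRow κ p ∘ Prod.mk w = vertexRow w ∘ fun x => κ.coeff (p w) (p x) := rfl
  constructor
  · intro h
    have := h.comp_of_image (f := Prod.mk w) (Prod.mk_right_injective w).injOn
    rw [h1] at this
    exact this.of_comp _
  · intro h
    refine LinearIndepOn.image_of_comp _ _ ?_
    rw [h1]
    exact h.map_injOn _ (vertexRow_injective w).injOn

theorem linearIndepOn_pinRow_union (p : V → Fin κ.dim → ℝ) {w : V} {U : Set V} {K : Set (V × V)}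
    (hU : LinearIndepOn ℝ (fun x => κ.coeff (p w) (p x)) U)
    (hK : LinearIndepOn ℝ (pinRow κ p) K) (hw : ∀ x ∈ K, x.1 ≠ w) :
    LinearIndepOn ℝ (pinRow κ p) (Prod.mk w '' U ∪ K) := by
  refine LinearIndepOn.union_of_comp_eq_zero (f := vertexCoord w) (LinearIndepOn.image_of_comp _ _ ?_)
    hK fun x hx => vertexCoord_vertexRow_of_ne (hw x hx).symm _
  exact hU.congr fun x _ => (vertexCoord_vertexRow _ _).symm

/-- General-position requirements at several vertices are encoded as independence of `pinRow`s. They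
can then be met together with independence of I once each is met at some placement. -/
theorem exists_placement_pinRow {I : Set (Sym2 V)} (hI : (genericMatroid κ V).Indep I)
    {K : Set (V × V)} (hK : ∃ p, LinearIndepOn ℝ (pinRow κ p) K) :
    ∃ p, LinearIndepOn ℝ (edgeRow κ.coeff p) I ∧ LinearIndepOn ℝ (pinRow κ p) K :=
  exists_common_placement (edgeRow_polynomial κ.coeff κ.coeff_polynomial) pinRow_polynomial
    I.toFinite K.toFinite (genericMatroid_indep_iff.1 hI).2 hK

end Rows

/-! ### The generic matroids are closed under zero-extensions -/

theorem linearIndependent_of_det_ne_zero (c : Fin 3 → Fin 3 → ℝ) (h : (Matrix.of c).det ≠ 0) :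
    LinearIndependent ℝ c :=
  Matrix.linearIndependent_rows_of_det_ne_zero h

namespace GenericKind

/-- Four points in general position: the origin and three further points. -/
def point : (κ : GenericKind) → Fin 3 → Fin κ.dim → ℝ
  | rigidity => ![![1, 0, 0], ![0, 1, 0], ![0, 0, 1]]
  | cofactor => ![![1, 0], ![0, 1], ![1, 1]]

theorem linearIndependent_coeff_point (κ : GenericKind) :
    LinearIndependent ℝ fun i => κ.coeff 0 (κ.point i) := by
  refine linearIndependent_of_det_ne_zero _ ?_
  cases κ <;>
  · rw [Matrix.det_fin_three]
    simp [coeff, point, rigidityCoeff, cofactorCoeff, dim]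

/-- Used for the tip of the ear: from the third point, the directions to the two hinges are
independent. -/
theorem linearIndependent_coeff_point_two (κ : GenericKind) :
    LinearIndependent ℝ ![κ.coeff (κ.point 2) (κ.point 0), κ.coeff (κ.point 2) (κ.point 1)] := by
  rw [LinearIndependent.pair_iff]
  intro s t h
  have h0 := congrFun h 0
  have h1 := congrFun h 1
  have h2 := congrFun h 2
  cases κ <;>
  · simp [coeff, point, rigidityCoeff, cofactorCoeff, dim] at h0 h1 h2
    simp_all

/-- The sample configuration for a 1-extension: the ends of the removed edge are opposite points,
their midpoint is the origin, and the other two neighbours are in general position. -/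
theorem linearIndependent_coeff_point_neg (κ : GenericKind) :
    LinearIndependent ℝ ![κ.coeff (κ.point 0) (-κ.point 0), κ.coeff 0 (κ.point 1),
      κ.coeff 0 (κ.point 2)] := by
  refine linearIndependent_of_det_ne_zero _ ?_
  cases κ <;>
  · rw [Matrix.det_fin_three]
    simp [coeff, point, rigidityCoeff, cofactorCoeff, dim]

/-- At the midpoint the difference vector is halved, up to sign, and the coefficients are
homogeneous of degree one or two. The two half-edges therefore carry nonzero multiples of the
coefficient vector of the whole edge. -/
theorem coeff_midpoint (κ : GenericKind) : ∃ s t : ℝˣ, ∀ x y : Fin κ.dim → ℝ,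
    κ.coeff ((1 / 2 : ℝ) • (x + y)) x = s • κ.coeff x y ∧
      κ.coeff ((1 / 2 : ℝ) • (x + y)) y = t • κ.coeff x y := by
  cases κ
  · refine ⟨Units.mk0 (-1 / 2) (by norm_num), Units.mk0 (1 / 2) (by norm_num), fun x y => ⟨?_, ?_⟩⟩ <;>
    · ext i
      simp [coeff, rigidityCoeff, Units.smul_def]
      ring
  · refine ⟨Units.mk0 (1 / 4) (by norm_num), Units.mk0 (1 / 4) (by norm_num), fun x y => ⟨?_, ?_⟩⟩ <;>
    · ext i
      fin_cases i <;>
      · simp [coeff, cofactorCoeff, Units.smul_def]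
        ring

/-- The midpoint is substituted for an auxiliary vertex `none`. -/
theorem coeff_midpoint_polynomial (κ : GenericKind) {V : Type*} (a b v : V) (i : Fin 3) :
    ∃ P : MvPolynomial (V × Fin κ.dim) ℝ, ∀ p : V → Fin κ.dim → ℝ,
      κ.coeff ((1 / 2 : ℝ) • (p a + p b)) (p v) i = MvPolynomial.eval (fun x => p x.1 x.2) P := by
  obtain ⟨P, hP⟩ := κ.coeff_polynomial (none : Option V) (some v) i
  refine ⟨MvPolynomial.bind₁ (fun x : Option V × Fin κ.dim => x.1.elim
    (MvPolynomial.C (1 / 2) * (MvPolynomial.X (a, x.2) + MvPolynomial.X (b, x.2)))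
    fun v => MvPolynomial.X (v, x.2)) P, fun p => ?_⟩
  have := hP fun o => o.elim ((1 / 2 : ℝ) • (p a + p b)) p
  rw [Option.elim_none, Option.elim_some] at this
  rw [this]
  change _ = MvPolynomial.eval₂Hom (RingHom.id ℝ) _ (MvPolynomial.bind₁ _ P)
  rw [MvPolynomial.eval₂Hom_bind₁]
  change MvPolynomial.eval₂Hom (RingHom.id ℝ) _ P = _
  congr 2
  ext ⟨o, j⟩
  cases o <;> simp [mul_add]

/-- Six infinitesimal motions that do not affect any edge. -/
def motion : (κ : GenericKind) → (Fin κ.dim → ℝ) → Fin 6 → Fin 3 → ℝ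
  | rigidity => fun x => ![![1, 0, 0], ![0, 1, 0], ![0, 0, 1], ![x 1, -x 0, 0], ![x 2, 0, -x 0],
      ![0, x 2, -x 1]]
  | cofactor => fun x => ![![1, 0, 0], ![0, 1, 0], ![0, 0, 1], ![x 1, -x 0, 0], ![0, x 1, -x 0],
      ![x 1 ^ 2, -(2 * x 0 * x 1), x 0 ^ 2]]

theorem coeff_dot_motion (κ : GenericKind) (x y : Fin κ.dim → ℝ) (k : Fin 6) :
    ∑ i, κ.coeff x y i * (κ.motion x k i - κ.motion y k i) = 0 := by
  rw [Fin.sum_univ_three]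
  cases κ <;> fin_cases k <;>
  · simp [coeff, motion, rigidityCoeff, cofactorCoeff]
    try ring

theorem motion_polynomial (κ : GenericKind) {V : Type*} (v : V) (k : Fin 6) (i : Fin 3) :
    ∃ P : MvPolynomial (V × Fin κ.dim) ℝ, ∀ p : V → Fin κ.dim → ℝ,
      κ.motion (p v) k i = MvPolynomial.eval (fun x => p x.1 x.2) P := by
  cases κ
  · let X : Fin 3 → MvPolynomial (V × Fin 3) ℝ := fun j => MvPolynomial.X (v, j)
    refine ⟨(![![1, 0, 0], ![0, 1, 0], ![0, 0, 1], ![X 1, -X 0, 0], ![X 2, 0, -X 0],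
      ![0, X 2, -X 1]] : Fin 6 → Fin 3 → MvPolynomial (V × Fin 3) ℝ) k i, fun p => ?_⟩
    fin_cases k <;> fin_cases i <;> simp [motion, X]
  · let X : Fin 2 → MvPolynomial (V × Fin 2) ℝ := fun j => MvPolynomial.X (v, j)
    refine ⟨(![![1, 0, 0], ![0, 1, 0], ![0, 0, 1], ![X 1, -X 0, 0], ![0, X 1, -X 0],
      ![X 1 ^ 2, -(2 * X 0 * X 1), X 0 ^ 2]] : Fin 6 → Fin 3 → MvPolynomial (V × Fin 2) ℝ) k i,
      fun p => ?_⟩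
    fin_cases k <;> fin_cases i <;> simp [motion, X]

/-- Three sample points already separate the six motions. -/
theorem eq_zero_of_motion (κ : GenericKind) (c : Fin 6 → ℝ)
    (h : ∀ x ∈ ({0, κ.point 0, κ.point 1} : Set (Fin κ.dim → ℝ)), ∑ k, c k • κ.motion x k = 0) :
    c = 0 := by
  have h0 := h 0 (by simp)
  have h1 := h (κ.point 0) (by simp)
  have h2 := h (κ.point 1) (by simp)
  simp only [funext_iff, Fin.forall_fin_succ, Fin.sum_univ_succ] at h0 h1 h2 ⊢
  cases κ <;>
  · simp [motion, point, dim] at h0 h1 h2 ⊢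
    refine ⟨?_, ?_, ?_, ?_, ?_, ?_⟩ <;> linarith

end GenericKind

/-! ### The Maxwell bound from motions, and zero-extensions by general position. -/

section Generic

variable {κ : GenericKind} {V : Type*} [Finite V]

/-- The row of a motion. -/
def motionRow (κ : GenericKind) (p : V → Fin κ.dim → ℝ) (k : Fin 6) : V × Fin 3 → ℝ :=
  fun wi => κ.motion (p wi.1) k wi.2

theorem edgeRow_dotProduct_motionRow [Fintype V] (p : V → Fin κ.dim → ℝ) (e : Sym2 V)
    (k : Fin 6) : edgeRow κ.coeff p e ⬝ᵥ motionRow κ p k = 0 := by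
  classical
  induction e with | _ u v
  obtain ⟨s, hs⟩ := edgeRow_mk (κ := κ) p u v
  have key : orientedRow κ p u v ⬝ᵥ motionRow κ p k = 0 := by
    rw [← κ.coeff_dot_motion (p u) (p v) k]
    simp only [dotProduct, Fintype.sum_prod_type_right, orientedRow, motionRow, sub_mul, ite_mul,
      zero_mul, Finset.sum_sub_distrib, Finset.sum_ite_eq', Finset.mem_univ, if_true, mul_sub]
  rw [hs, Units.smul_def, smul_dotProduct, key, smul_zero]

theorem exists_linearIndepOn_motionRow (hV : 3 ≤ Nat.card V) :
    ∃ p, LinearIndepOn ℝ (motionRow (V := V) κ p) Set.univ := by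
  have := Fintype.ofFinite V
  rw [Nat.card_eq_fintype_card] at hV
  obtain ⟨g⟩ : Nonempty (Fin 3 ↪ V) := Function.Embedding.nonempty_of_card_le (by simpa using hV)
  refine ⟨Function.extend g ![0, κ.point 0, κ.point 1] 0, ?_⟩
  rw [linearIndepOn_univ_iff, Fintype.linearIndependent_iff]
  intro c hc
  refine congrFun (κ.eq_zero_of_motion c ?_)
  have key : ∀ j : Fin 3, ∑ k, c k • κ.motion ((![0, κ.point 0, κ.point 1] :
      Fin 3 → Fin κ.dim → ℝ) j) k = 0 := by
    intro j
    ext i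
    have := congrFun hc (g j, i)
    simpa [motionRow, g.injective.extend_apply, Finset.sum_apply] using this
  rintro x (rfl | rfl | rfl)
  exacts [key 0, key 1, key 2]

/-- Edge rows are orthogonal to the six motions, which are independent at a suitable common
placement. Over the reals orthogonal spaces meet in zero, so |I| + 6 is at most the dimension 3|V|.
-/
theorem ncard_add_six_le_of_indep {I : Set (Sym2 V)} (hI : (genericMatroid κ V).Indep I)
    (hV : 3 ≤ Nat.card V) : I.ncard + 6 ≤ 3 * Nat.card V := by
  classical
  have := Fintype.ofFinite V
  obtain ⟨p, hp, hm⟩ := exists_common_placement (edgeRow_polynomial κ.coeff κ.coeff_polynomial)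
    (r' := motionRow κ) (fun k j => κ.motion_polynomial j.1 k j.2) I.toFinite
    (toFinite Set.univ) (genericMatroid_indep_iff.1 hI).2 (exists_linearIndepOn_motionRow hV)
  rw [linearIndepOn_univ_iff] at hm
  have hI' : LinearIndependent ℝ fun e : I => edgeRow κ.coeff p e := hp
  have := I.toFinite.fintype
  have hd : Disjoint (Submodule.span ℝ (range fun e : I => edgeRow κ.coeff p e))
      (Submodule.span ℝ (range (motionRow κ p))) := by
    rw [Submodule.disjoint_def]
    intro x hx hx'
    have h1 : ∀ y ∈ Submodule.span ℝ (range (motionRow κ p)), x ⬝ᵥ y = 0 := by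
      intro y hy
      clear hx'
      induction hx using Submodule.span_induction with
      | mem x hx =>
        obtain ⟨e, rfl⟩ := hx
        induction hy using Submodule.span_induction with
        | mem y hy =>
          obtain ⟨k, rfl⟩ := hy
          exact edgeRow_dotProduct_motionRow p e k
        | zero => exact dotProduct_zero _
        | add y z _ _ hy hz => rw [dotProduct_add, hy, hz, add_zero]
        | smul c y _ hy => rw [dotProduct_smul, hy, smul_zero]
      | zero => exact zero_dotProduct _
      | add x z _ _ hx hz => rw [add_dotProduct, hx, hz, add_zero]
      | smul c x _ hx => rw [smul_dotProduct, hx, smul_zero]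
    exact dotProduct_self_eq_zero.1 (h1 x hx')
  have h2 := (hI'.sum_type hm hd).fintype_card_le_finrank
  rw [Module.finrank_fintype_fun_eq_card, Fintype.card_sum, Fintype.card_prod, Fintype.card_fin,
    Fintype.card_fin] at h2
  rw [Nat.card_eq_fintype_card, ← Nat.card_coe_set_eq, Nat.card_eq_fintype_card]
  omega

theorem exists_injOn_fin_three {U : Set V} (hU : U.ncard ≤ 3) : ∃ g : V → Fin 3, InjOn g U := by
  have := Fintype.ofFinite V
  have := U.toFinite.fintype
  obtain ⟨g⟩ : Nonempty (U ↪ Fin 3) := Function.Embedding.nonempty_of_card_le (by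
    rwa [Fintype.card_fin, ← Nat.card_eq_fintype_card, Nat.card_coe_set_eq])
  classical
  refine ⟨fun v => if h : v ∈ U then g ⟨v, h⟩ else 0, fun x hx y hy h => ?_⟩
  simp only [hx, hy, dif_pos] at h
  exact congrArg Subtype.val (g.injective h)

theorem genericMatroid_hasZeroExtensions (κ : GenericKind) (V : Type*) [Finite V] :
    HasZeroExtensions (genericMatroid κ V) where
  ground_eq := genericMatroid_ground κ V
  zero_ext I w W hI hw hwW hW := by
    classical
    obtain ⟨g, hg⟩ := exists_injOn_fin_three hW
    obtain ⟨p, hp, hpin⟩ := exists_placement_pinRow (K := Prod.mk w '' W) hI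
      ⟨fun v => if v ∈ W then κ.point (g v) else 0, by
        rw [linearIndepOn_pinRow_iff]
        refine ((κ.linearIndependent_coeff_point.linearIndepOn (g '' W)).comp_of_image hg).congr ?_
        intro x hx
        simp [hx, hwW]⟩
    rw [linearIndepOn_pinRow_iff] at hpin
    refine genericMatroid_indep_iff.2 ⟨union_subset ?_ ?_, p,
      linearIndepOn_edgeRow_union_starEdges p hp hw hwW hpin⟩
    · exact (genericMatroid_indep_iff.1 hI).1
    · rintro _ ⟨x, hx, rfl⟩
      exact mk_mem_pairsIn.2 ⟨fun h => hwW (h ▸ hx), trivial, trivial⟩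
  card_le I U hI hIU hU := by
    let f : U ↪ V := Function.Embedding.subtype _
    have hI' : Sym2.map f '' (Sym2.map f ⁻¹' I) = I := by
      rw [image_preimage_eq_iff]
      intro e he
      have := hIU he
      induction e with | _ x y
      rw [mk_mem_pairsIn] at this
      exact ⟨s(⟨x, this.2.1⟩, ⟨y, this.2.2⟩), rfl⟩
    rw [← hI', genericMatroid_indep_image_iff] at hI
    have := ncard_add_six_le_of_indep hI (by rwa [Nat.card_coe_set_eq])
    rwa [← ncard_image_of_injective _ (Sym2.map.injective f.injective), hI',
      Nat.card_coe_set_eq] at this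

/-! ### One-extensions -/

theorem edgeRow_congr {p q : V → Fin κ.dim → ℝ} {e : Sym2 V} (h : ∀ v ∈ e, p v = q v) :
    edgeRow κ.coeff p e = edgeRow κ.coeff q e := by
  have h1 := h _ (Sym2.out_fst_mem e)
  have h2 := h _ (Sym2.out_snd_mem e)
  unfold edgeRow
  rw [h1, h2]

/-- The new vertex w is placed at the midpoint of ab. There the rows of ab, wa and wb are dependent,
so after a zero-extension by wa, wx, wy the row of ab can be exchanged for that of wb. -/
theorem genericMatroid_oneExtension {I : Set (Sym2 V)} {a b x y w : V}
    (hI : (genericMatroid κ V).Indep (insert s(a, b) I)) (hab : s(a, b) ∉ I)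
    (hw : w ∉ edgeSupport I) (hd : [w, a, b, x, y].Nodup) :
    (genericMatroid κ V).Indep (I ∪ starEdges w {a, b, x, y}) := by
  classical
  simp only [List.nodup_cons, List.mem_cons, List.not_mem_nil, not_or, or_false, not_false_eq_true,
    List.nodup_nil, and_true] at hd
  obtain ⟨⟨hwa, hwb, hwx, hwy⟩, ⟨hne, hax, hay⟩, ⟨hbx, hby⟩, hxy⟩ := hd
  -- These are the three directions seen from the midpoint, with wa represented by the parallel
  -- direction ab. Writing them without w makes the condition polynomial in the old positions.
  let r : (V → Fin κ.dim → ℝ) → Fin 3 → Fin 3 → ℝ := fun p => ![κ.coeff (p a) (p b),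
    κ.coeff ((1 / 2 : ℝ) • (p a + p b)) (p x), κ.coeff ((1 / 2 : ℝ) • (p a + p b)) (p y)]
  have hr : ∀ k i, ∃ P : MvPolynomial (V × Fin κ.dim) ℝ,
      ∀ p, r p k i = MvPolynomial.eval (fun x => p x.1 x.2) P := by
    intro k i
    fin_cases k
    exacts [κ.coeff_polynomial a b i, κ.coeff_midpoint_polynomial a b x i,
      κ.coeff_midpoint_polynomial a b y i]
  obtain ⟨p, hp, hrp⟩ := exists_common_placement (edgeRow_polynomial κ.coeff κ.coeff_polynomial)
    (r' := fun p k => vertexRow w (r p k)) (fun k j => by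
      obtain ⟨P, hP⟩ := hr k j.2
      refine ⟨if j.1 = w then P else 0, fun p => ?_⟩
      change (if j.1 = w then r p k j.2 else 0) = _
      split_ifs <;> simp [hP]) (I := insert s(a, b) I) (K := univ) (toFinite _) (toFinite _)
    (genericMatroid_indep_iff.1 hI).2 (by
      refine ⟨fun v => if v = a then κ.point 0 else if v = b then -κ.point 0 else
        if v = x then κ.point 1 else κ.point 2, ?_⟩
      rw [linearIndepOn_univ_iff]
      refine LinearIndependent.map' ?_ _ (LinearMap.ker_eq_bot.2 (vertexRow_injective w))
      have h := κ.linearIndependent_coeff_point_neg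
      simpa [Ne.symm hne, Ne.symm hax, Ne.symm hbx, Ne.symm hay, Ne.symm hby, Ne.symm hxy, r]
        using h)
  rw [linearIndepOn_univ_iff] at hrp
  have hrp : LinearIndependent ℝ (r p) := LinearIndependent.of_comp (vertexRow w) hrp
  -- Only w moves, and the old rows do not involve it.
  set q := Function.update p w ((1 / 2 : ℝ) • (p a + p b)) with hq
  have hqv : ∀ v, v ≠ w → q v = p v := fun v hv => Function.update_of_ne hv _ _
  have hqw : q w = (1 / 2 : ℝ) • (p a + p b) := Function.update_self _ _ _
  have hw' : w ∉ edgeSupport (insert s(a, b) I) := by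
    rintro ⟨e, rfl | he, hwe⟩
    · rcases Sym2.mem_iff.1 hwe with h | h
      exacts [hwa h, hwb h]
    · exact hw ⟨e, he, hwe⟩
  have hq1 : LinearIndepOn ℝ (edgeRow κ.coeff q) (insert s(a, b) I) := by
    refine hp.congr fun e he => edgeRow_congr fun v hv => (hqv v ?_).symm
    rintro rfl
    exact hw' ⟨e, he, hv⟩
  obtain ⟨s, t, hst⟩ := κ.coeff_midpoint
  have hca : κ.coeff (q w) (q a) = s • κ.coeff (p a) (p b) := by
    rw [hqw, hqv a (Ne.symm hwa), (hst _ _).1]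
  have hcb : κ.coeff (q w) (q b) = t • κ.coeff (p a) (p b) := by
    rw [hqw, hqv b (Ne.symm hwb), (hst _ _).2]
  have hq2 := linearIndepOn_edgeRow_union_starEdges q (w := w) (U := {a, x, y}) hq1 hw'
    (by simp [hwa, hwx, hwy]) (by
      have him : ![a, x, y] '' univ = {a, x, y} := by
        ext v
        simp only [Fin.exists_fin_succ, mem_image, mem_univ, true_and, mem_insert_iff,
          mem_singleton_iff, IsEmpty.exists_iff, or_false, eq_comm (a := v)]
        rfl
      rw [← him]
      refine LinearIndepOn.image_of_comp _ _ ?_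
      refine (linearIndepOn_congr_units (w := r p) fun k _ => ?_).2 (linearIndepOn_univ_iff.2 hrp)
      fin_cases k
      · exact ⟨s, hca⟩
      · refine ⟨1, ?_⟩
        change κ.coeff (q w) (q x) = _
        rw [one_smul, hqw, hqv x (Ne.symm hwx)]
        rfl
      · refine ⟨1, ?_⟩
        change κ.coeff (q w) (q y) = _
        rw [one_smul, hqw, hqv y (Ne.symm hwy)]
        rfl)
  rw [insert_union] at hq2
  have hab' : s(a, b) ∉ I ∪ starEdges w {a, x, y} := by
    rintro (h | ⟨z, -, h⟩)
    · exact hab h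
    · rcases Sym2.eq_iff.1 h with h | h
      exacts [hwa h.1, hwb h.1]
  have hq3 := (linearIndepOn_insert hab').1 hq2
  have hstar : I ∪ starEdges w {a, b, x, y} = insert s(w, b) (I ∪ starEdges w {a, x, y}) := by
    rw [← union_insert]
    congr 1
    simp only [starEdges, image_insert_eq, image_singleton]
    exact insert_comm _ _ _
  refine genericMatroid_indep_iff.2 ⟨union_subset ((subset_insert _ _).trans
    (genericMatroid_indep_iff.1 hI).1) ?_, q, ?_⟩
  · rintro _ ⟨z, hz, rfl⟩
    refine mk_mem_pairsIn.2 ⟨?_, trivial, trivial⟩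
    rintro rfl
    rcases hz with h | h | h | h
    exacts [hwa h, hwb h, hwx h, hwy h]
  · rw [hstar]
    -- If the row of wb were spanned, the row of ab, a combination of those of wa and wb, would be
    -- spanned too.
    refine hq3.1.insert fun hmem => hq3.2 ?_
    have hmem' : edgeRow κ.coeff q s(w, a) ∈
        Submodule.span ℝ (edgeRow κ.coeff q '' (I ∪ starEdges w {a, x, y})) :=
      Submodule.subset_span ⟨_, Or.inr ⟨a, by simp, rfl⟩, rfl⟩
    obtain ⟨s₁, h₁⟩ := edgeRow_mk (κ := κ) q a b
    obtain ⟨s₂, h₂⟩ := edgeRow_mk (κ := κ) q w a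
    obtain ⟨s₃, h₃⟩ := edgeRow_mk (κ := κ) q w b
    have h₂' : orientedRow κ q w a ∈
        Submodule.span ℝ (edgeRow κ.coeff q '' (I ∪ starEdges w {a, x, y})) := by
      have := Submodule.smul_mem _ ((s₂⁻¹ : ℝˣ) : ℝ) hmem'
      rwa [← Units.smul_def, h₂, inv_smul_smul] at this
    have h₃' : orientedRow κ q w b ∈
        Submodule.span ℝ (edgeRow κ.coeff q '' (I ∪ starEdges w {a, x, y})) := by
      have := Submodule.smul_mem _ ((s₃⁻¹ : ℝˣ) : ℝ) hmem
      rwa [← Units.smul_def, h₃, inv_smul_smul] at this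
    rw [h₁, Units.smul_def]
    refine Submodule.smul_mem _ _ ?_
    have : orientedRow κ q a b =
        ((t⁻¹ : ℝˣ) : ℝ) • orientedRow κ q w b - ((s⁻¹ : ℝˣ) : ℝ) • orientedRow κ q w a := by
      rw [hqv a (Ne.symm hwa)] at hca
      rw [hqv b (Ne.symm hwb)] at hcb
      ext ⟨v, i⟩
      have e1 : ((s⁻¹ : ℝˣ) : ℝ) * (s * κ.coeff (p a) (p b) i) = κ.coeff (p a) (p b) i :=
        Units.inv_mul_cancel_left _ _
      have e2 : ((t⁻¹ : ℝˣ) : ℝ) * (t * κ.coeff (p a) (p b) i) = κ.coeff (p a) (p b) i :=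
        Units.inv_mul_cancel_left _ _
      simp only [orientedRow, Pi.sub_apply, Pi.smul_apply, smul_eq_mul, hqv a (Ne.symm hwa),
        hqv b (Ne.symm hwb), hca, hcb, Units.smul_def, mul_sub, mul_ite, mul_zero, e1, e2]
      ring
    rw [this]
    exact sub_mem (Submodule.smul_mem _ _ h₃') (Submodule.smul_mem _ _ h₂')

end Generic

/-! ### The double-butterfly with two further gluing pairs -/

/-- The non-gluing vertices `u`, `v` of the double-butterfly. -/
abbrev earHinge (i : Fin 2) : EarVertex := Sum.inr (Sum.inl i)

/-- The vertex `cᵢ` of the double-butterfly. -/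
abbrev earTip (i : Fin 2) : EarVertex := Sum.inr (Sum.inr i)

/-- The gluing vertices of the `i`-th butterfly. -/
abbrev gluingPair (i : Fin 2) : Sym2 Quad := s(Sum.inl i, Sum.inr i)

-- A finite check: unless the two pairs are the two gluing pairs of the butterflies, they lie with
-- an unused gluing pair in a spanning tree of the four gluing vertices. The order t₁, t₂, t₃, t₄
-- attaches each vertex to an earlier one, ready for zero-extensions.
set_option synthInstance.maxHeartbeats 400000 in
set_option synthInstance.maxSize 2000 in
theorem exists_tree_of_ne : ∀ p q r s : Quad, p ≠ q → r ≠ s → s(p, q) ≠ s(r, s) →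
    ¬ (∃ i, s(p, q) = gluingPair i ∧ s(r, s) = gluingPair (1 - i)) →
    ∃ i, gluingPair i ≠ s(p, q) ∧ gluingPair i ≠ s(r, s) ∧
      ∃ t₁ t₂, t₁ ≠ t₂ ∧ (s(t₂, t₁) = s(p, q) ∨ s(t₂, t₁) = s(r, s) ∨ s(t₂, t₁) = gluingPair i) ∧
      ∃ t₃, t₃ ≠ t₁ ∧ t₃ ≠ t₂ ∧ ∃ x₃, (x₃ = t₁ ∨ x₃ = t₂) ∧
      ∃ t₄, t₄ ≠ t₁ ∧ t₄ ≠ t₂ ∧ t₄ ≠ t₃ ∧ ∃ x₄, (x₄ = t₁ ∨ x₄ = t₂ ∨ x₄ = t₃) ∧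
      (s(p, q) = s(t₂, t₁) ∨ s(p, q) = s(t₃, x₃) ∨ s(p, q) = s(t₄, x₄)) ∧
      (s(r, s) = s(t₂, t₁) ∨ s(r, s) = s(t₃, x₃) ∨ s(r, s) = s(t₄, x₄)) ∧
      (gluingPair i = s(t₂, t₁) ∨ gluingPair i = s(t₃, x₃) ∨ gluingPair i = s(t₄, x₄)) := by
  decide +kernel

set_option synthInstance.maxHeartbeats 400000 in
set_option synthInstance.maxSize 2000 in
theorem eq_or_eq_of_four_ne : ∀ t₁ t₂ t₃ t₄ : Quad, t₁ ≠ t₂ → t₃ ≠ t₁ → t₃ ≠ t₂ → t₄ ≠ t₁ →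
    t₄ ≠ t₂ → t₄ ≠ t₃ → ∀ t, t = t₁ ∨ t = t₂ ∨ t = t₃ ∨ t = t₄ := by
  decide +kernel

theorem notMem_edgeSupport_union_starEdges {V : Type*} {I : Set (Sym2 V)} {w x : V} {W : Set V}
    (hI : w ∉ edgeSupport I) (hx : w ≠ x) (hW : w ∉ W) : w ∉ edgeSupport (I ∪ starEdges x W) := by
  rintro ⟨e, he | ⟨y, hy, rfl⟩, hwe⟩
  · exact hI ⟨e, he, hwe⟩
  · rcases Sym2.mem_iff.1 hwe with rfl | rfl
    exacts [hx rfl, hW hy]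

section

variable {κ : GenericKind}

/-- The pairs between the hinge and the gluing vertices. -/
def hingeStar : Set (Sym2 EarVertex) := {e | ∃ (i : Fin 2) (t : Quad), e = s(earHinge i, Sum.inl t)}

/-- After the hinge pair, each gluing vertex is joined to both hinges and at most one earlier gluing
vertex along the tree, so it has degree at most three when added. -/
theorem indep_hingeStar_union (t₁ t₂ t₃ t₄ x₃ x₄ : Quad) (h12 : t₁ ≠ t₂) (h31 : t₃ ≠ t₁)
    (h32 : t₃ ≠ t₂) (h41 : t₄ ≠ t₁) (h42 : t₄ ≠ t₂) (h43 : t₄ ≠ t₃) (hx₃ : x₃ = t₁ ∨ x₃ = t₂)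
    (hx₄ : x₄ = t₁ ∨ x₄ = t₂ ∨ x₄ = t₃) :
    (genericMatroid κ EarVertex).Indep (insert s(earHinge 0, earHinge 1)
      (hingeStar ∪ Sym2.map Sum.inl '' {s(t₂, t₁), s(t₃, x₃), s(t₄, x₄)})) := by
  have hM := genericMatroid_hasZeroExtensions κ EarVertex
  have c1 : ∀ x : EarVertex, ({x} : Set EarVertex).ncard ≤ 3 := fun x => by simp
  have c2 : ∀ x y : EarVertex, ({x, y} : Set EarVertex).ncard ≤ 3 := fun x y =>
    (ncard_insert_le _ _).trans (by simp)
  have c3 : ∀ x y z : EarVertex, ({x, y, z} : Set EarVertex).ncard ≤ 3 := fun x y z =>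
    (ncard_insert_le _ _).trans (Nat.succ_le_succ ((ncard_insert_le _ _).trans (by simp)))
  have hs : ∀ t, (Sum.inl t : EarVertex) ∉ edgeSupport (∅ ∪ starEdges (earHinge 0) {earHinge 1}) :=
    fun t => notMem_edgeSupport_union_starEdges (by simp [edgeSupport]) (by simp) (by simp)
  have h0 := hM.zero_ext ∅ (earHinge 0) {earHinge 1} (Matroid.empty_indep _)
    (by simp [edgeSupport]) (by simp) (c1 _)
  have h1 := hM.zero_ext _ (Sum.inl t₁) {earHinge 0, earHinge 1} h0 (hs _) (by simp) (c2 _ _)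
  have s1 : ∀ t, t ≠ t₁ → _ := fun t h => notMem_edgeSupport_union_starEdges (hs t)
    (x := Sum.inl t₁) (W := {earHinge 0, earHinge 1}) (by simpa) (by simp)
  have h2 := hM.zero_ext _ (Sum.inl t₂) {earHinge 0, earHinge 1, Sum.inl t₁} h1
    (s1 _ h12.symm) (by simp [h12.symm]) (c3 _ _ _)
  have s2 : ∀ t, t ≠ t₁ → t ≠ t₂ → _ := fun t h h' => notMem_edgeSupport_union_starEdges (s1 t h)
    (x := Sum.inl t₂) (W := {earHinge 0, earHinge 1, Sum.inl t₁}) (by simpa) (by simpa)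
  have h3 := hM.zero_ext _ (Sum.inl t₃) {earHinge 0, earHinge 1, Sum.inl x₃} h2
    (s2 _ h31 h32) (by rcases hx₃ with rfl | rfl <;> simp [h31, h32]) (c3 _ _ _)
  have s3 := notMem_edgeSupport_union_starEdges (s2 t₄ h41 h42) (x := Sum.inl t₃)
    (W := {earHinge 0, earHinge 1, Sum.inl x₃}) (by simpa)
    (by rcases hx₃ with rfl | rfl <;> simp [h41, h42])
  have h4 := hM.zero_ext _ (Sum.inl t₄) {earHinge 0, earHinge 1, Sum.inl x₄} h3 s3
    (by rcases hx₄ with rfl | rfl | rfl <;> simp [h41, h42, h43]) (c3 _ _ _)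
  refine h4.subset ?_
  have hall := eq_or_eq_of_four_ne t₁ t₂ t₃ t₄ h12 h31 h32 h41 h42 h43
  rintro e (rfl | ⟨i, t, rfl⟩ | ⟨e, rfl | rfl | rfl, rfl⟩)
  · simp [starEdges]
  · rcases hall t with rfl | rfl | rfl | rfl <;> fin_cases i <;>
      simp [starEdges, Sym2.eq_swap]
  all_goals simp [starEdges]

theorem fin_two_eq_zero_or_one (i : Fin 2) : i = 0 ∨ i = 1 := by
  revert i
  decide

theorem edgeSet_doubleButterfly_subset : doubleButterfly.edgeSet ⊆
    hingeStar ∪ ⋃ i, starEdges (earTip i)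
      {Sum.inl (Sum.inl i), Sum.inl (Sum.inr i), earHinge 0, earHinge 1} := by
  intro e he
  induction e with | _ x y
  obtain ⟨hne, i, hx, hy, h1, h2⟩ := he
  simp only [butterflyVerts, mem_insert_iff, mem_singleton_iff] at hx hy
  rcases hx with rfl | rfl | rfl | rfl | rfl <;> rcases hy with rfl | rfl | rfl | rfl | rfl <;>
    simp_all [hingeStar, starEdges, Sym2.eq_swap, Fin.exists_fin_two, fin_two_eq_zero_or_one]

/-- The tree contains a gluing pair distinct from the two added pairs. A 1-extension by the
corresponding tip removes that gluing pair, and one by the other tip removes the hinge pair. What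
remains contains the double-butterfly with both added pairs. -/
theorem indep_doubleButterfly_union {p q r s : Quad} (hpq : p ≠ q) (hrs : r ≠ s)
    (hne : s(p, q) ≠ s(r, s))
    (h : ¬ ∃ i, s(p, q) = gluingPair i ∧ s(r, s) = gluingPair (1 - i)) :
    (genericMatroid κ EarVertex).Indep
      (doubleButterfly.edgeSet ∪ Sym2.map Sum.inl '' {s(p, q), s(r, s)}) := by
  obtain ⟨i, hi1, hi2, t₁, t₂, h12, -, t₃, h31, h32, x₃, hx₃, t₄, h41, h42, h43, x₄, hx₄, he, hf,
    hg⟩ := exists_tree_of_ne p q r s hpq hrs hne h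
  set K : Set (Sym2 EarVertex) := Sym2.map Sum.inl '' {s(p, q), s(r, s)} with hK
  have hind := indep_hingeStar_union (κ := κ) t₁ t₂ t₃ t₄ x₃ x₄ h12 h31 h32 h41 h42 h43 hx₃ hx₄
  have hinj : Function.Injective (Sym2.map (Sum.inl : Quad → EarVertex)) :=
    Sym2.map.injective Sum.inl_injective
  have htip : ∀ j : Fin 2, earTip j ∉ edgeSupport (hingeStar ∪ K) := by
    rintro j ⟨e, ⟨k, t, rfl⟩ | ⟨e, -, rfl⟩, hw⟩
    · simp at hw
    · obtain ⟨y, -, hy⟩ := Sym2.mem_map.1 hw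
      exact Sum.inl_ne_inr hy
  have htip' : ∀ j : Fin 2, earTip j ∉
      edgeSupport (insert s(earHinge 0, earHinge 1) (hingeStar ∪ K)) := by
    rintro j ⟨e, rfl | he, hw⟩
    · simp at hw
    · exact htip j ⟨e, he, hw⟩
  have h1 := genericMatroid_oneExtension (κ := κ) (w := earTip i)
    (I := insert s(earHinge 0, earHinge 1) (hingeStar ∪ K)) (a := Sum.inl (Sum.inl i))
    (b := Sum.inl (Sum.inr i)) (x := earHinge 0) (y := earHinge 1) (hind.subset (by
      rintro e (rfl | rfl | h | ⟨e, h | h, rfl⟩)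
      · exact Or.inr (Or.inr ⟨_, hg, rfl⟩)
      · exact Or.inl rfl
      · exact Or.inr (Or.inl h)
      · exact Or.inr (Or.inr ⟨_, h ▸ he, rfl⟩)
      · exact Or.inr (Or.inr ⟨_, h ▸ hf, rfl⟩))) (by
      rintro (h | ⟨k, t, h⟩ | ⟨e, h | h, h'⟩)
      · simp at h
      · simp at h
      · exact hi1 (hinj (h'.symm.trans (congrArg _ h)))
      · exact hi2 (hinj (h'.symm.trans (congrArg _ h)))) (htip' i) (by simp)
  have hii : earTip (1 - i) ≠ earTip i := by
    clear * -
    revert i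
    decide
  rw [insert_union] at h1
  have h2 := genericMatroid_oneExtension (κ := κ) (w := earTip (1 - i))
    (I := hingeStar ∪ K ∪ _) (a := earHinge 0) (b := earHinge 1) (x := Sum.inl (Sum.inl (1 - i)))
    (y := Sum.inl (Sum.inr (1 - i))) h1 (by
      rintro ((⟨k, t, h⟩ | ⟨e, -, h⟩) | h)
      · simp at h
      · induction e
        simp at h
      · simp [starEdges] at h)
      (notMem_edgeSupport_union_starEdges (htip _) hii (by simp)) (by simp)
  refine h2.subset (union_subset (edgeSet_doubleButterfly_subset.trans (union_subset ?_ ?_)) ?_)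
  · exact subset_union_left.trans (subset_union_left.trans subset_union_left)
  · refine iUnion_subset fun j => ?_
    have hj : j = i ∨ j = 1 - i := by
      clear * -
      revert i j
      decide
    rcases hj with rfl | rfl
    · exact subset_union_right.trans subset_union_left
    · refine subset_union_of_subset_right (image_mono ?_) _
      rintro x (rfl | rfl | rfl | rfl) <;> simp
  · exact subset_union_right.trans (subset_union_left.trans subset_union_left)

/-- Two different key gluing pairs of a safe ear cover of the double-butterfly are the missing
gluing pairs of the two butterflies. -/
theorem IsSafeEarCover.eq_gluingPair {X : Set (Set EarVertex)}
    (h : IsSafeEarCover (genericMatroid κ EarVertex) doubleButterfly (range Sum.inl) X)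
    {p q r s : Quad} (hpq : s(Sum.inl p, Sum.inl q) ∈ keyPairs (range Sum.inl) X)
    (hrs : s(Sum.inl r, Sum.inl s) ∈ keyPairs (range Sum.inl) X) (hne : s(p, q) ≠ s(r, s)) :
    ∃ i, s(p, q) = gluingPair i ∧ s(r, s) = gluingPair (1 - i) := by
  by_contra hcon
  have hp : p ≠ q := fun h => (mk_mem_pairsIn.1 hpq.1).1 (congrArg _ h)
  have hr : r ≠ s := fun h => (mk_mem_pairsIn.1 hrs.1).1 (congrArg _ h)
  have hind := indep_doubleButterfly_union (κ := κ) hp hr hne hcon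
  -- The rank with all key pairs added is at most IE_P, which is one more than the rank of the ear.
  -- An independent addition of two pairs contradicts this.
  have h1 := edgeRank_union_le_inclExclWith h.cover h.indep_shared
    (P := sharedSet X ∪ keyPairs (range Sum.inl) X) subset_union_left (by
      rintro e (he | he)
      exacts [not_isDiag_of_mem_sharedSet he, he.1.1])
  have h2 := h.rank_eq
  have h3 := edgeRank_eq_ncard hind
  have h4 := edgeRank_mono (M := genericMatroid κ EarVertex)
    (A := doubleButterfly.edgeSet ∪ Sym2.map Sum.inl '' {s(p, q), s(r, s)})
    (B := doubleButterfly.edgeSet ∪ (sharedSet X ∪ keyPairs (range Sum.inl) X)) (by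
      refine union_subset_union_right _ ?_
      rintro _ ⟨e, rfl | rfl, rfl⟩
      exacts [Or.inr hpq, Or.inr hrs])
  have h5 := edgeRank_eq_ncard (hind.subset subset_union_left)
  have h6 : (doubleButterfly.edgeSet ∪ Sym2.map Sum.inl '' {s(p, q), s(r, s)}).ncard =
      doubleButterfly.edgeSet.ncard + 2 := by
    rw [ncard_union_eq, ncard_image_of_injective _ (Sym2.map.injective Sum.inl_injective),
      ncard_pair hne]
    rw [Set.disjoint_left]
    rintro _ he ⟨e, -, rfl⟩
    have := edgeSet_doubleButterfly_subset he
    induction e with | _ x y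
    rcases this with ⟨k, t, h⟩ | h
    · simp at h
    · obtain ⟨k, hk⟩ := mem_iUnion.1 h
      simp [starEdges] at hk
  omega

end

/-! ### Clusters without neighbours of a split vertex -/

namespace HasZeroExtensions

variable {V : Type*} [Finite V] {M : Matroid (Sym2 V)} (hM : HasZeroExtensions M)
  {G : GraphOn V} {X : Set (Set V)} {a b : V}

include hM in
/-- In a tight cover, a cluster that contains no neighbour of the end `a` of a splittable nonedge
`ab` contains no shared pair at `a` other than `ab`. -/
theorem notMem_sharedSet_of_forall_not_adj (hG : IsIndependent M G) (hX : IsTwoThinCover G X)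
    (hS : M.Indep (sharedSet X)) (hrank : edgeRank M G.edgeSet = inclExcl M G X)
    (hab : IsSplittableNonedge G X a b) {Y : Set V} (hY : Y ∈ X) (haY : a ∈ Y)
    (hbad : ∀ y ∈ Y, ¬ G.Adj a y) {u : V} (hu : u ∈ Y) (hub : u ≠ b) : s(a, u) ∉ sharedSet X := by
  classical
  intro hau
  set S := sharedSet X with hSdef
  let F : Set V → Set (Sym2 V) := fun Y => {e ∈ G.edgeSet ∪ S | ∀ v ∈ e, v ∈ Y}
  -- The bad clusters contain a but none of its neighbours, so all their pairs at a are shared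
  -- nonedges. The aim is to show that these pairs waste too much of the tight count.
  let bad : Finset (Set V) := {Y ∈ X.toFinite.toFinset | a ∈ Y ∧ ∀ y ∈ Y, ¬ G.Adj a y}
  let good : Finset (Set V) := {Y ∈ X.toFinite.toFinset | ¬ (a ∈ Y ∧ ∀ y ∈ Y, ¬ G.Adj a y)}
  set star : Set (Sym2 V) := {e | a ∈ e} with hstar
  set Ab := ⋃ Y ∈ bad, F Y with hAb
  set Ag := ⋃ Y ∈ good, F Y with hAg
  have hnd : ∀ e ∈ G.edgeSet ∪ S, ¬ e.IsDiag := by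
    rintro e (he | he)
    exacts [not_isDiag_of_mem_edgeSet he, not_isDiag_of_mem_sharedSet he]
  have hinter : ∀ Y ∈ X, ∀ Z ∈ X, Y ≠ Z → F Y ∩ F Z ⊆ S := fun Y hY Z hZ hne e he =>
    mem_sharedSet_of_mem (hnd e he.1.1) hX.inter_le hY hZ hne he.1.2 he.2.2
  have hmb : ∀ {Y}, Y ∈ bad ↔ Y ∈ X ∧ a ∈ Y ∧ ∀ y ∈ Y, ¬ G.Adj a y := by simp [bad]
  have hmg : ∀ {Y}, Y ∈ good ↔ Y ∈ X ∧ ¬ (a ∈ Y ∧ ∀ y ∈ Y, ¬ G.Adj a y) := by simp [good]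
  have hbg : Ab ∩ Ag ⊆ S := by
    rintro e ⟨he, he'⟩
    simp only [hAb, hAg, mem_iUnion] at he he'
    obtain ⟨Y, hY, he⟩ := he
    obtain ⟨Z, hZ, he'⟩ := he'
    rw [hmb] at hY
    rw [hmg] at hZ
    refine hinter Y hY.1 Z hZ.1 ?_ ⟨he, he'⟩
    rintro rfl
    exact hZ.2 hY.2
  have hAbE : Ab ⊆ G.edgeSet ∪ S := iUnion₂_subset fun Y _ e he => he.1
  have hAgE : Ag ⊆ G.edgeSet ∪ S := iUnion₂_subset fun Y _ e he => he.1
  have hstarE : ∀ e ∈ Ab ∩ star, e ∉ G.edgeSet := by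
    rintro e ⟨he, hae⟩ heE
    simp only [hAb, mem_iUnion] at he
    obtain ⟨Y, hY, he⟩ := he
    rw [hmb] at hY
    obtain ⟨y, rfl⟩ := hae
    exact hY.2.2 y (he.2 y (Sym2.mem_mk_right a y)) heE
  -- A pair au with u ≠ b in both a bad and a good cluster is a shared nonedge, and `agree_left`
  -- would carry a neighbour of a from the good cluster to the bad one.
  have hT : Ab ∩ star ∩ Ag ⊆ {s(a, b)} := by
    rintro e ⟨⟨he, hae⟩, he'⟩
    have heS := hbg ⟨he, he'⟩
    have heE := hstarE e ⟨he, hae⟩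
    simp only [hAb, hAg, mem_iUnion] at he he'
    obtain ⟨Y, hY, he⟩ := he
    obtain ⟨Z, hZ, he'⟩ := he'
    rw [hmb] at hY
    rw [hmg] at hZ
    obtain ⟨y, rfl⟩ := hae
    by_contra hne
    have hyb : y ≠ b := by
      rintro rfl
      exact hne rfl
    have hya : a ≠ y := hnd _ (hAbE (mem_iUnion₂.2 ⟨Y, hmb.2 hY, he⟩))
    have haZ : a ∈ Z := he'.2 a (Sym2.mem_mk_left a y)
    have hYZ : Y ≠ Z := by
      rintro rfl
      exact hZ.2 hY.2
    have hsub : ({a, y} : Set V) ⊆ Y ∩ Z := by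
      rintro x (rfl | rfl)
      exacts [⟨hY.2.1, haZ⟩, ⟨he.2 x (Sym2.mem_mk_right a x), he'.2 x (Sym2.mem_mk_right a x)⟩]
    have heq := eq_of_subset_of_ncard_le hsub
      (by rw [ncard_pair hya]; exact hX.inter_le Y hY.1 Z hZ.1 hYZ) (toFinite _)
    have := (hab.agree_left Y hY.1 Z hZ.1 y hyb heq.symm heS heE).2 (by
      by_contra hcon
      push Not at hcon
      exact hZ.2 ⟨haZ, hcon⟩)
    obtain ⟨z, hz, hz'⟩ := this
    exact hY.2.2 z hz hz'
  have h1 := (rank_eq_inclExcl_iff hG hX).1 hrank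
  have h2 : ∑ Y ∈ X.toFinite.toFinset, nullity M (F Y) =
      ∑ Y ∈ bad, nullity M (F Y) + ∑ Y ∈ good, nullity M (F Y) :=
    (Finset.sum_filter_add_sum_filter_not _ _ _).symm
  have h3 : ∑ Y ∈ bad, nullity M (F Y) ≤ nullity M Ab := sum_nullity_le _ _ hS
    fun Y hY Z hZ hne => hinter Y (hmb.1 hY).1 Z (hmb.1 hZ).1 hne
  have h4 : ∑ Y ∈ good, nullity M (F Y) ≤ nullity M Ag := sum_nullity_le _ _ hS
    fun Y hY Z hZ hne => hinter Y (hmg.1 hY).1 Z (hmg.1 hZ).1 hne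
  have h5 := hM.nullity_le_sdiff_star (A := Ab)
    (fun e he => ⟨hnd e (hAbE he), fun _ _ => trivial⟩) a
  rw [← hstar] at h5
  have h6 : nullity M (Ab \ star) + nullity M Ag ≤ nullity M (Ab \ star ∪ Ag) :=
    nullity_add_le (hS.subset ((inter_subset_inter_left _ sdiff_subset).trans hbg))
  set T := Ab ∩ star ∩ Ag with hTdef
  have hC : Ab \ star ∪ Ag ⊆ (G.edgeSet ∪ S) \ ((Ab ∩ star) \ Ag) := by
    rintro e (he | he)
    · exact ⟨hAbE he.1, fun h => he.2 h.1.2⟩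
    · exact ⟨hAgE he, fun h => h.2 he⟩
  have hEC : G.edgeSet ⊆ Ab \ star ∪ Ag := by
    intro e he
    obtain ⟨Y, hY, heY⟩ := hX.exists_mem he
    have heF : e ∈ F Y := ⟨Or.inl he, heY⟩
    by_cases hb : a ∈ Y ∧ ∀ y ∈ Y, ¬ G.Adj a y
    · have heb : e ∈ Ab := mem_iUnion₂.2 ⟨Y, hmb.2 ⟨hY, hb⟩, heF⟩
      exact Or.inl ⟨heb, fun h => hstarE e ⟨heb, h⟩ he⟩
    · exact Or.inr (mem_iUnion₂.2 ⟨Y, hmg.2 ⟨hY, hb⟩, heF⟩)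
  have h7 := edgeRank_mono (M := M) hEC
  rw [edgeRank_eq_ncard hG] at h7
  have h8 := ncard_le_ncard hC
  have h9 : ((Ab ∩ star) \ Ag).ncard + T.ncard = (Ab ∩ star).ncard :=
    by rw [add_comm]; exact ncard_inter_add_ncard_sdiff_eq_ncard _ _
  have h10 := ncard_sdiff_add_ncard_of_subset
    (s := (Ab ∩ star) \ Ag) (t := G.edgeSet ∪ S) (sdiff_subset.trans (inter_subset_left.trans hAbE))
  have h11 := ncard_union_eq_add_sdiff G.edgeSet S
  have h12 : T.ncard ≤ 1 := (ncard_le_ncard hT).trans (by simp)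
  have hau' : s(a, u) ∈ (Ab ∩ star) \ Ag := by
    have : s(a, u) ∈ Ab ∩ star := by
      refine ⟨mem_iUnion₂.2 ⟨Y, hmb.2 ⟨hY, haY, hbad⟩, Or.inr hau, ?_⟩, Sym2.mem_mk_left a u⟩
      simp [haY, hu]
    refine ⟨this, fun h => ?_⟩
    have := hT ⟨this, h⟩
    rw [mem_singleton_iff, Sym2.congr_right] at this
    exact hub this
  have h13 : 0 < ((Ab ∩ star) \ Ag).ncard := (ncard_pos).2 ⟨_, hau'⟩
  have h14 : nullity M (Ab \ star ∪ Ag) =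
    (Ab \ star ∪ Ag).ncard - edgeRank M (Ab \ star ∪ Ag) := rfl
  have h15 : ∑ Y ∈ bad, nullity M (F Y) + ∑ Y ∈ good, nullity M (F Y) =
    (S \ G.edgeSet).ncard := h2.symm.trans h1
  -- Let n count the pairs at a in bad clusters and t ≤ 1 those also in good clusters. Deleting the
  -- other n - t pairs keeps all edges, so tightness gives n - t ≤ n - min(3, n). Hence n ≤ t,
  -- although au is among the n - t pairs.
  omega

end HasZeroExtensions

/-! ### The split graph and the collapse of the copies -/

section SplitGraph

variable {V : Type*} {G : GraphOn V} {a b : V} {Gs : GraphOn (SplitVertex V)}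

theorem splitCollapse_inr (t : Quad) :
    splitCollapse a b (Sum.inr t : SplitVertex V) ∈ ({a, b} : Set V) := by
  rcases t with i | i
  exacts [Or.inl rfl, Or.inr rfl]

namespace IsNonedgeSplit

theorem notMem_of_inl_mem (h : IsNonedgeSplit G a b Gs) {v : V} (hv : Sum.inl v ∈ Gs.verts) :
    v ∈ G.verts ∧ v ≠ a ∧ v ≠ b := by
  rw [h.verts_eq] at hv
  rcases hv with ⟨w, ⟨hw, hne⟩, hwv⟩ | ⟨t, ht⟩
  · rw [Sum.inl_injective hwv] at hw hne
    simpa [hw] using hne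
  · simp at ht

theorem inr_mem (h : IsNonedgeSplit G a b Gs) (t : Quad) : Sum.inr t ∈ Gs.verts := by
  rw [h.verts_eq]
  exact Or.inr ⟨t, rfl⟩

theorem exists_of_aCopy_adj (h : IsNonedgeSplit G a b Gs) {i : Fin 2} {y : SplitVertex V}
    (hy : Gs.Adj (aCopy V i) y) : ∃ v, G.Adj a v ∧ y = Sum.inl v := by
  have : y ∈ Gs.neighborSet (aCopy V 0) ∪ Gs.neighborSet (aCopy V 1) := by
    rcases fin_two_eq_zero_or_one i with rfl | rfl
    exacts [Or.inl hy, Or.inr hy]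
  rw [h.union_left] at this
  obtain ⟨v, hv, rfl⟩ := this
  exact ⟨v, hv, rfl⟩

theorem exists_of_bCopy_adj (h : IsNonedgeSplit G a b Gs) {i : Fin 2} {y : SplitVertex V}
    (hy : Gs.Adj (bCopy V i) y) : ∃ v, G.Adj b v ∧ y = Sum.inl v := by
  have : y ∈ Gs.neighborSet (bCopy V 0) ∪ Gs.neighborSet (bCopy V 1) := by
    rcases fin_two_eq_zero_or_one i with rfl | rfl
    exacts [Or.inl hy, Or.inr hy]
  rw [h.union_right] at this
  obtain ⟨v, hv, rfl⟩ := this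
  exact ⟨v, hv, rfl⟩

theorem aCopy_inj (h : IsNonedgeSplit G a b Gs) {i j : Fin 2} {y : SplitVertex V}
    (hi : Gs.Adj (aCopy V i) y) (hj : Gs.Adj (aCopy V j) y) : i = j := by
  have : y ∈ Gs.neighborSet (aCopy V 0) → y ∈ Gs.neighborSet (aCopy V 1) → False :=
    fun hy hy' => Set.disjoint_left.1 h.disjoint_left hy hy'
  rcases fin_two_eq_zero_or_one i with rfl | rfl <;>
    rcases fin_two_eq_zero_or_one j with rfl | rfl
  exacts [rfl, (this hi hj).elim, (this hj hi).elim, rfl]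

theorem bCopy_inj (h : IsNonedgeSplit G a b Gs) {i j : Fin 2} {y : SplitVertex V}
    (hi : Gs.Adj (bCopy V i) y) (hj : Gs.Adj (bCopy V j) y) : i = j := by
  have : y ∈ Gs.neighborSet (bCopy V 0) → y ∈ Gs.neighborSet (bCopy V 1) → False :=
    fun hy hy' => Set.disjoint_left.1 h.disjoint_right hy hy'
  rcases fin_two_eq_zero_or_one i with rfl | rfl <;>
    rcases fin_two_eq_zero_or_one j with rfl | rfl
  exacts [rfl, (this hi hj).elim, (this hj hi).elim, rfl]

theorem adj_collapse (h : IsNonedgeSplit G a b Gs) {x y : SplitVertex V} (hxy : Gs.Adj x y) :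
    G.Adj (splitCollapse a b x) (splitCollapse a b y) := by
  rcases x with x | i | i
  · rcases y with y | i | i
    · have hx := h.notMem_of_inl_mem hxy.fst_mem
      have hy := h.notMem_of_inl_mem hxy.snd_mem
      exact (h.adj_old x y (by simp [hx.2]) (by simp [hy.2])).1 hxy
    · obtain ⟨v, hv, hv'⟩ := h.exists_of_aCopy_adj hxy.symm
      rw [Sum.inl_injective hv']
      exact hv.symm
    · obtain ⟨v, hv, hv'⟩ := h.exists_of_bCopy_adj hxy.symm
      rw [Sum.inl_injective hv']
      exact hv.symm
  · obtain ⟨v, hv, rfl⟩ := h.exists_of_aCopy_adj hxy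
    exact hv
  · obtain ⟨v, hv, rfl⟩ := h.exists_of_bCopy_adj hxy
    exact hv

/-- Every edge at a copy goes to an old vertex, and the neighbourhoods of the two copies are
disjoint, so the collapsed edge determines the copy. -/
theorem collapse_inj (h : IsNonedgeSplit G a b Gs) {x y x' y' : SplitVertex V}
    (hxy : Gs.Adj x y) (hxy' : Gs.Adj x' y') (hx : splitCollapse a b x = splitCollapse a b x')
    (hy : splitCollapse a b y = splitCollapse a b y') : x = x' := by
  rcases x with x | i | i <;> rcases x' with x' | j | j
  · exact congrArg _ hx
  · exact ((h.notMem_of_inl_mem hxy.fst_mem).2.1 hx).elim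
  · exact ((h.notMem_of_inl_mem hxy.fst_mem).2.2 hx).elim
  · exact ((h.notMem_of_inl_mem hxy'.fst_mem).2.1 hx.symm).elim
  · obtain ⟨v, hv, rfl⟩ := h.exists_of_aCopy_adj hxy
    obtain ⟨v', hv', rfl⟩ := h.exists_of_aCopy_adj hxy'
    obtain rfl : v = v' := hy
    rw [h.aCopy_inj hxy hxy']
  · exact (h.ne hx).elim
  · exact ((h.notMem_of_inl_mem hxy'.fst_mem).2.2 hx.symm).elim
  · exact (h.ne hx.symm).elim
  · obtain ⟨v, hv, rfl⟩ := h.exists_of_bCopy_adj hxy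
    obtain ⟨v', hv', rfl⟩ := h.exists_of_bCopy_adj hxy'
    obtain rfl : v = v' := hy
    rw [h.bCopy_inj hxy hxy']

theorem injOn_collapse (h : IsNonedgeSplit G a b Gs) :
    InjOn (Sym2.map (splitCollapse a b)) Gs.edgeSet := by
  intro e he e' he' hee
  induction e with | _ x y
  induction e' with | _ x' y'
  rcases Sym2.eq_iff.1 hee with ⟨h1, h2⟩ | ⟨h1, h2⟩
  · exact congrArg₂ _ (h.collapse_inj he he' h1 h2)
      (h.collapse_inj (Gs.adj_symm he) (Gs.adj_symm he') h2 h1)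
  · rw [Sym2.eq_swap]
    exact congrArg₂ _ (h.collapse_inj (Gs.adj_symm he) he' h2 h1)
      (h.collapse_inj he (Gs.adj_symm he') h1 h2)

theorem mapsTo_collapse (h : IsNonedgeSplit G a b Gs) :
    MapsTo (Sym2.map (splitCollapse a b)) Gs.edgeSet G.edgeSet := by
  intro e he
  induction e with | _ x y
  exact h.adj_collapse he

end IsNonedgeSplit

theorem edgeSet_relabel {W : Type*} (f : V ↪ W) (G : GraphOn V) :
    (G.relabel f).edgeSet = Sym2.map f '' G.edgeSet :=
  SimpleGraph.Subgraph.edgeSet_map _ _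

theorem edgeSet_glueDoubleButterfly (Gs : GraphOn (SplitVertex V)) (σ : Quad ≃ Quad) :
    (glueDoubleButterfly Gs σ).edgeSet = Sym2.map Sum.inl '' Gs.edgeSet ∪
      Sym2.map (earInclusion V σ) '' doubleButterfly.edgeSet := by
  unfold glueDoubleButterfly
  rw [SimpleGraph.Subgraph.edgeSet_sup, edgeSet_relabel, edgeSet_relabel]
  rfl

end SplitGraph

/-! ### Independence of the glued graph -/

section GluedIndependent

variable {κ : GenericKind}

theorem linearIndepOn_edgeRow_image {V W : Type*} [Finite V] [Finite W] (f : V ↪ W)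
    {q : W → Fin κ.dim → ℝ} {A : Set (Sym2 V)}
    (hA : LinearIndepOn ℝ (edgeRow κ.coeff (q ∘ f)) A) :
    LinearIndepOn ℝ (edgeRow κ.coeff q) (Sym2.map f '' A) := by
  refine LinearIndepOn.image_of_comp _ _ ((linearIndepOn_congr_units
    (v := pushRow f ∘ edgeRow κ.coeff (q ∘ f)) fun e _ => pushRow_edgeRow f _ e).1 ?_)
  exact hA.map_injOn _ (pushRow_injective f.injective).injOn

/-- The ear is built by stars: each tip is joined to the hinges, then each gluing vertex to the
hinges and its tip. Only directions from the newly added vertex matter, so tips may coincide with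
tips and gluing vertices with gluing vertices. -/
theorem linearIndepOn_edgeRow_doubleButterfly {q : EarVertex → Fin κ.dim → ℝ}
    (h1 : ∀ i, LinearIndepOn ℝ (fun x => κ.coeff (q (earTip i)) (q x)) {earHinge 0, earHinge 1})
    (h2 : ∀ t i, LinearIndepOn ℝ (fun x => κ.coeff (q (Sum.inl t)) (q x))
      {earHinge 0, earHinge 1, earTip i}) :
    LinearIndepOn ℝ (edgeRow κ.coeff q) doubleButterfly.edgeSet := by
  have k0 := linearIndepOn_edgeRow_union_starEdges q (linearIndepOn_empty _ _)
    (w := earTip 0) (by simp [edgeSupport]) (by simp) (h1 0)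
  have n0 : ∀ w : EarVertex, w ≠ earTip 0 → w ∉ ({earHinge 0, earHinge 1} : Set EarVertex) → _ :=
    fun w h h' => notMem_edgeSupport_union_starEdges (I := ∅) (by simp [edgeSupport]) h h'
  have k1 := linearIndepOn_edgeRow_union_starEdges q k0 (w := earTip 1)
    (n0 _ (by simp) (by simp)) (by simp) (h1 1)
  have n1 : ∀ t : Quad, _ := fun t => notMem_edgeSupport_union_starEdges
    (n0 (Sum.inl t) (by simp) (by simp)) (x := earTip 1) (W := {earHinge 0, earHinge 1})
    (by simp) (by simp)
  have k2 := linearIndepOn_edgeRow_union_starEdges q k1 (w := Sum.inl (Sum.inl 0))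
    (n1 _) (by simp) (h2 _ 0)
  have n2 : ∀ t : Quad, t ≠ Sum.inl 0 → _ := fun t h => notMem_edgeSupport_union_starEdges
    (n1 t) (x := Sum.inl (Sum.inl 0)) (W := {earHinge 0, earHinge 1, earTip 0}) (by simpa) (by simp)
  have k3 := linearIndepOn_edgeRow_union_starEdges q k2 (w := Sum.inl (Sum.inr 0))
    (n2 _ (by simp)) (by simp) (h2 _ 0)
  have n3 : ∀ t : Quad, t ≠ Sum.inl 0 → t ≠ Sum.inr 0 → _ :=
    fun t h h' => notMem_edgeSupport_union_starEdges
    (n2 t h) (x := Sum.inl (Sum.inr 0)) (W := {earHinge 0, earHinge 1, earTip 0})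
    (by simpa) (by simp)
  have k4 := linearIndepOn_edgeRow_union_starEdges q k3 (w := Sum.inl (Sum.inl 1))
    (n3 _ (by simp) (by simp)) (by simp) (h2 _ 1)
  have n4 := notMem_edgeSupport_union_starEdges
    (n3 (Sum.inr 1) (by simp) (by simp)) (x := Sum.inl (Sum.inl 1))
    (W := {earHinge 0, earHinge 1, earTip 1}) (by simp) (by simp)
  have k5 := linearIndepOn_edgeRow_union_starEdges q k4 (w := Sum.inl (Sum.inr 1))
    n4 (by simp) (h2 _ 1)
  refine k5.mono (edgeSet_doubleButterfly_subset.trans (union_subset ?_ (iUnion_subset ?_)))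
  · rintro _ ⟨i, t, rfl⟩
    rcases fin_two_eq_zero_or_one i with rfl | rfl <;> rcases t with j | j <;>
      rcases fin_two_eq_zero_or_one j with rfl | rfl <;> simp [starEdges, Sym2.eq_swap]
  · rintro i _ ⟨x, hx, rfl⟩
    rcases fin_two_eq_zero_or_one i with rfl | rfl <;> rcases hx with rfl | rfl | rfl | rfl <;>
      simp [starEdges, Sym2.eq_swap]

variable {V : Type*} [Finite V] {G : GraphOn V} {a b : V} {Gs : GraphOn (SplitVertex V)}

/-- The map that identifies the copies of `a`, of `b` and of the tips. -/
def gluedCollapse (a b : V) : GluedVertex V → V ⊕ (Fin 2 ⊕ Unit) :=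
  Sum.map (splitCollapse a b) (Sum.map id fun _ => ())

/-- The edges of a single butterfly attached at `a` and `b`. -/
def collapsedEar (a b : V) : Set (Sym2 (V ⊕ (Fin 2 ⊕ Unit))) :=
  starEdges (Sum.inr (Sum.inl 0)) {Sum.inl a, Sum.inl b} ∪
    starEdges (Sum.inr (Sum.inl 1)) {Sum.inl a, Sum.inl b} ∪
    starEdges (Sum.inr (Sum.inr ()))
      {Sum.inr (Sum.inl 0), Sum.inr (Sum.inl 1), Sum.inl a, Sum.inl b}

/-- The hinges are added by zero-extensions, the second one also joined to the first. A 1-extension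
on the edge between them adds the tip. -/
theorem indep_union_collapsedEar {I : Set (Sym2 V)} (hI : (genericMatroid κ V).Indep I)
    (hab : a ≠ b) : (genericMatroid κ (V ⊕ (Fin 2 ⊕ Unit))).Indep
      (Sym2.map Sum.inl '' I ∪ collapsedEar a b) := by
  have hM := genericMatroid_hasZeroExtensions κ (V ⊕ (Fin 2 ⊕ Unit))
  have h0 : (genericMatroid κ (V ⊕ (Fin 2 ⊕ Unit))).Indep (Sym2.map Sum.inl '' I) :=
    (genericMatroid_indep_image_iff (Function.Embedding.inl)).2 hI
  have s0 : ∀ t, (Sum.inr t : V ⊕ (Fin 2 ⊕ Unit)) ∉ edgeSupport (Sym2.map Sum.inl '' I) := by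
    rintro t ⟨_, ⟨e, -, rfl⟩, ht⟩
    obtain ⟨v, -, hv⟩ := Sym2.mem_map.1 ht
    simp at hv
  have h1 := hM.zero_ext _ (Sum.inr (Sum.inl 0)) {Sum.inl a, Sum.inl b} h0 (s0 _) (by simp)
    ((ncard_insert_le _ _).trans (by simp))
  have s1 : ∀ t : Fin 2 ⊕ Unit, t ≠ Sum.inl 0 → _ := fun t ht => notMem_edgeSupport_union_starEdges (s0 t)
    (x := Sum.inr (Sum.inl 0)) (W := {Sum.inl a, Sum.inl b}) (by simpa) (by simp)
  have h2 := hM.zero_ext _ (Sum.inr (Sum.inl 1)) {Sum.inl a, Sum.inl b, Sum.inr (Sum.inl 0)} h1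
    (s1 _ (by simp)) (by simp)
    ((ncard_insert_le _ _).trans (Nat.succ_le_succ ((ncard_insert_le _ _).trans (by simp))))
  have s2 := notMem_edgeSupport_union_starEdges (s1 (Sum.inr ()) (by simp))
    (x := Sum.inr (Sum.inl 1)) (W := {Sum.inl a, Sum.inl b}) (by simp) (by simp)
  have h3 := genericMatroid_oneExtension (κ := κ) (w := Sum.inr (Sum.inr ()))
    (a := Sum.inr (Sum.inl 0)) (b := Sum.inr (Sum.inl 1)) (x := Sum.inl a) (y := Sum.inl b)
    (I := Sym2.map Sum.inl '' I ∪ starEdges (Sum.inr (Sum.inl 0)) {Sum.inl a, Sum.inl b} ∪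
      starEdges (Sum.inr (Sum.inl 1)) {Sum.inl a, Sum.inl b}) (h2.subset (by
      rintro e (rfl | he | ⟨x, hx, rfl⟩)
      · exact Or.inr ⟨_, Or.inr (Or.inr rfl), Sym2.eq_swap⟩
      · exact Or.inl he
      · exact Or.inr ⟨x, by rcases hx with rfl | rfl <;> simp, rfl⟩)) (by
      rintro ((⟨e, -, he⟩ | he) | he)
      · induction e
        simp at he
      · simp [starEdges] at he
      · simp [starEdges] at he) s2 (by simp [hab])
  rw [union_assoc, union_assoc, ← union_assoc (starEdges _ _)] at h3
  exact h3

theorem exists_placement_collapsedEar {I : Set (Sym2 (V ⊕ (Fin 2 ⊕ Unit)))}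
    (hI : (genericMatroid κ (V ⊕ (Fin 2 ⊕ Unit))).Indep I) (hab : a ≠ b) :
    ∃ p, LinearIndepOn ℝ (edgeRow κ.coeff p) I ∧
      LinearIndepOn ℝ (fun x => κ.coeff (p (Sum.inr (Sum.inr ()))) (p x))
        (Sum.inr ∘ Sum.inl '' (univ : Set (Fin 2))) ∧
      ∀ z ∈ ({a, b} : Set V), LinearIndepOn ℝ (fun x => κ.coeff (p (Sum.inl z)) (p x))
        (range Sum.inr) := by
  classical
  obtain ⟨p, hp, hpin⟩ := exists_placement_pinRow (κ := κ) hI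
    (K := Prod.mk (Sum.inl a) '' range Sum.inr ∪ (Prod.mk (Sum.inl b) '' range Sum.inr ∪
      Prod.mk (Sum.inr (Sum.inr ())) '' (Sum.inr ∘ Sum.inl '' (univ : Set (Fin 2))))) (by
      let g : Fin 2 ⊕ Unit → Fin 3 := Sum.elim (fun i => i.castSucc) fun _ => 2
      have hg : Function.Injective g := by decide
      -- All old vertices are at the origin; the hinges and the tip are at the three sample points.
      let p₀ : V ⊕ (Fin 2 ⊕ Unit) → Fin κ.dim → ℝ := Sum.elim 0 (κ.point ∘ g)
      have e1 : ∀ z : V, LinearIndepOn ℝ (fun x => κ.coeff (p₀ (Sum.inl z)) (p₀ x))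
          (range Sum.inr) := by
        intro z
        rw [← image_univ]
        refine LinearIndepOn.image_of_comp _ _ (linearIndepOn_univ_iff.2 ?_)
        exact κ.linearIndependent_coeff_point.comp g hg
      refine ⟨p₀, linearIndepOn_pinRow_union p₀ (e1 a)
        (linearIndepOn_pinRow_union p₀ (e1 b) ?_ ?_) ?_⟩
      · rw [linearIndepOn_pinRow_iff]
        refine LinearIndepOn.image_of_comp _ _ (linearIndepOn_univ_iff.2 ?_)
        convert κ.linearIndependent_coeff_point_two using 1
        ext i : 1
        fin_cases i <;> rfl
      · rintro _ ⟨x, -, rfl⟩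
        simp
      · rintro _ (⟨x, -, rfl⟩ | ⟨x, -, rfl⟩)
        · simpa using hab.symm
        · simp)
  refine ⟨p, hp, ?_, ?_⟩
  · exact (linearIndepOn_pinRow_iff _ _ _).1
      (hpin.mono (subset_union_right.trans subset_union_right))
  · rintro z (rfl | rfl)
    · exact (linearIndepOn_pinRow_iff _ _ _).1 (hpin.mono subset_union_left)
    · exact (linearIndepOn_pinRow_iff _ _ _).1
        (hpin.mono (subset_union_left.trans subset_union_right))

/-- Gluing a double-butterfly to a nonedge-split of an independent graph gives an independent
graph. -/
theorem IsNonedgeSplit.isIndependent_glueDoubleButterfly (h : IsNonedgeSplit G a b Gs)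
    (hG : IsIndependent (genericMatroid κ V) G) (σ : Quad ≃ Quad) :
    IsIndependent (genericMatroid κ (GluedVertex V)) (glueDoubleButterfly Gs σ) := by
  obtain ⟨p, hp, hc, hz⟩ := exists_placement_collapsedEar (indep_union_collapsedEar hG h.ne) h.ne
  have hcol : ∀ t, ∃ z ∈ ({a, b} : Set V), gluedCollapse a b (earInclusion V σ (Sum.inl t)) =
      Sum.inl z := fun t => ⟨_, splitCollapse_inr (σ t), rfl⟩
  refine genericMatroid_indep_iff.2 ⟨?_, p ∘ gluedCollapse a b, ?_⟩
  · intro e he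
    exact ⟨not_isDiag_of_mem_edgeSet he, fun _ _ => trivial⟩
  rw [edgeSet_glueDoubleButterfly]
  -- The split graph collapses injectively onto edges of G. The ear need not, so its own
  -- independence at the collapsed placement is supplied separately.
  refine linearIndepOn_edgeRow_union (gluedCollapse a b) p ?_ ?_ ?_ ?_ hp ?_
  · rintro _ ⟨e, he, rfl⟩ _ ⟨e', he', rfl⟩ hee
    have h1 : ∀ e : Sym2 (SplitVertex V), Sym2.map (gluedCollapse a b) (Sym2.map Sum.inl e) =
        Sym2.map Sum.inl (Sym2.map (splitCollapse a b) e) := by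
      intro e
      induction e
      rfl
    rw [h1, h1] at hee
    rw [h.injOn_collapse he he' (Sym2.map.injective Sum.inl_injective hee)]
  · rintro _ ⟨e, he, rfl⟩
    refine ⟨_, h.mapsTo_collapse he, ?_⟩
    induction e
    rfl
  · rintro _ ⟨e, he, rfl⟩
    rcases edgeSet_doubleButterfly_subset he with ⟨i, t, rfl⟩ | he
    · obtain ⟨z, hz, hzt⟩ := hcol t
      refine Or.inl ?_
      rw [Sym2.map_mk, Sym2.map_mk, hzt]
      rcases fin_two_eq_zero_or_one i with rfl | rfl
      · exact Or.inl ⟨_, by rcases hz with rfl | rfl <;> simp, rfl⟩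
      · exact Or.inr ⟨_, by rcases hz with rfl | rfl <;> simp, rfl⟩
    · obtain ⟨i, x, hx, rfl⟩ := mem_iUnion.1 he
      refine Or.inr ⟨gluedCollapse a b (earInclusion V σ x), ?_, rfl⟩
      rcases hx with rfl | rfl | rfl | rfl
      · obtain ⟨z, hz, hzt⟩ := hcol (Sum.inl i)
        rw [hzt]
        rcases hz with rfl | rfl <;> simp
      · obtain ⟨z, hz, hzt⟩ := hcol (Sum.inr i)
        rw [hzt]
        rcases hz with rfl | rfl <;> simp
      · exact Or.inl rfl
      · exact Or.inr (Or.inl rfl)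
  · rw [Set.disjoint_left]
    rintro _ ⟨e, -, rfl⟩ he
    have hinr : ∀ t, (Sum.inr t : V ⊕ (Fin 2 ⊕ Unit)) ∉ Sym2.map Sum.inl e := by
      intro t ht
      obtain ⟨v, -, hv⟩ := Sym2.mem_map.1 ht
      simp at hv
    rcases he with (⟨x, -, hx⟩ | ⟨x, -, hx⟩) | ⟨x, -, hx⟩
    all_goals
      refine hinr ?_ ?_
      rotate_left
      · rw [← hx]
        exact Sym2.mem_mk_left _ _
  · refine linearIndepOn_edgeRow_image _ (linearIndepOn_edgeRow_doubleButterfly ?_ ?_)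
    · intro i
      refine LinearIndepOn.comp_of_image (f := gluedCollapse a b ∘ earInclusion V σ)
        (v := fun x => κ.coeff (p (Sum.inr (Sum.inr ()))) (p x)) (hc.mono ?_) ?_
      · rintro _ ⟨x, rfl | rfl, rfl⟩
        exacts [⟨0, trivial, rfl⟩, ⟨1, trivial, rfl⟩]
      · rintro x (rfl | rfl) y (rfl | rfl) hxy <;>
          simp_all [gluedCollapse, earInclusion]
    · intro t i
      obtain ⟨z, hz', hzt⟩ := hcol t
      have := hz z hz'
      rw [← hzt] at this
      refine LinearIndepOn.comp_of_image (f := gluedCollapse a b ∘ earInclusion V σ)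
        (v := fun x => κ.coeff (p (gluedCollapse a b (earInclusion V σ (Sum.inl t)))) (p x))
        (this.mono ?_) ?_
      · rintro _ ⟨x, rfl | rfl | rfl, rfl⟩
        exacts [⟨_, rfl⟩, ⟨_, rfl⟩, ⟨_, rfl⟩]
      · rintro x (rfl | rfl | rfl) y (rfl | rfl | rfl) hxy <;>
          simp_all [gluedCollapse, earInclusion]

end GluedIndependent

/-! ### The glued graph is nucleation-free -/

section EarCount

/-- The edges of the double-butterfly. -/
def earEdge : (Fin 2 × Quad) ⊕ (Fin 2 × Fin 4) → EarVertex × EarVertex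
  | Sum.inl (i, t) => (earHinge i, Sum.inl t)
  | Sum.inr (i, k) => (earTip i, ![Sum.inl (Sum.inl i), Sum.inl (Sum.inr i), earHinge 0,
      earHinge 1] k)

/-- The Booleans encode a vertex subset of the ear, f its edges, g its gluing vertices and m its
other vertices. The subtraction g - 2 is truncated: at most two gluing vertices may be absorbed by
the collapsed graph, and only the excess enters the budget. -/
theorem ear_count : ∀ a₀ a₁ b₀ b₁ u v c₀ c₁ : Bool, ∀ f g m : ℕ,
    f = (u && a₀).toNat + (u && a₁).toNat + ((u && b₀).toNat + (u && b₁).toNat) +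
      ((v && a₀).toNat + (v && a₁).toNat + ((v && b₀).toNat + (v && b₁).toNat)) +
      ((c₀ && a₀).toNat + (c₀ && b₀).toNat + (c₀ && u).toNat + (c₀ && v).toNat +
      ((c₁ && a₁).toNat + (c₁ && b₁).toNat + (c₁ && u).toNat + (c₁ && v).toNat)) →
    g = a₀.toNat + a₁.toNat + (b₀.toNat + b₁.toNat) →
    m = u.toNat + v.toNat + (c₀.toNat + c₁.toNat) →
    (m = 0 → f = 0) ∧ (¬ (m = 0 ∧ g ≤ 2) → f < 3 * m + 3 * (g - 2)) ∧
      (3 ≤ g + m → f + 6 ≤ 3 * (g + m)) ∧ (5 ≤ g + m → f + 6 < 3 * (g + m)) := by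
  have key : ∀ a₀ a₁ b₀ b₁ u v c₀ c₁ : Bool,
    let f := (u && a₀).toNat + (u && a₁).toNat + ((u && b₀).toNat + (u && b₁).toNat) +
      ((v && a₀).toNat + (v && a₁).toNat + ((v && b₀).toNat + (v && b₁).toNat)) +
      ((c₀ && a₀).toNat + (c₀ && b₀).toNat + (c₀ && u).toNat + (c₀ && v).toNat +
      ((c₁ && a₁).toNat + (c₁ && b₁).toNat + (c₁ && u).toNat + (c₁ && v).toNat))
    let g := a₀.toNat + a₁.toNat + (b₀.toNat + b₁.toNat)
    let m := u.toNat + v.toNat + (c₀.toNat + c₁.toNat)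
    (m = 0 → f = 0) ∧ (¬ (m = 0 ∧ g ≤ 2) → f < 3 * m + 3 * (g - 2)) ∧
      (3 ≤ g + m → f + 6 ≤ 3 * (g + m)) ∧ (5 ≤ g + m → f + 6 < 3 * (g + m)) := by
    decide +kernel
  rintro a₀ a₁ b₀ b₁ u v c₀ c₁ _ _ _ rfl rfl rfl
  exact key a₀ a₁ b₀ b₁ u v c₀ c₁

theorem ncard_quad (P : Quad → Prop) [DecidablePred P] : {t | P t}.ncard =
    (decide (P (Sum.inl 0))).toNat + (decide (P (Sum.inl 1))).toNat +
      ((decide (P (Sum.inr 0))).toNat + (decide (P (Sum.inr 1))).toNat) := by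
  rw [ncard_eq_toFinset_card', toFinset_ofPred, Finset.card_filter]
  simp only [Fintype.sum_sum_type, Fin.sum_univ_two, Bool.toNat, Bool.cond_decide]

theorem doubleButterfly_count (S : Set EarVertex) {f g m : ℕ}
    (hf : f = (edgesIn doubleButterfly S).ncard) (hg : g = {t | Sum.inl t ∈ S}.ncard)
    (hm : m = {t | Sum.inr t ∈ S}.ncard) :
    (m = 0 → f = 0) ∧ (¬ (m = 0 ∧ g ≤ 2) → f < 3 * m + 3 * (g - 2)) ∧
      (3 ≤ g + m → f + 6 ≤ 3 * (g + m)) ∧ (5 ≤ g + m → f + 6 < 3 * (g + m)) := by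
  classical
  rw [ncard_quad] at hg hm
  obtain ⟨F, hF⟩ : ∃ F, F = ((Finset.univ : Finset ((Fin 2 × Quad) ⊕ (Fin 2 × Fin 4))).filter
    fun j => (earEdge j).1 ∈ S ∧ (earEdge j).2 ∈ S).card := ⟨_, rfl⟩
  have hle : f ≤ F := by
    have hsub : edgesIn doubleButterfly S ⊆ (fun j => Sym2.mk (earEdge j).1 (earEdge j).2) ''
        {j | (earEdge j).1 ∈ S ∧ (earEdge j).2 ∈ S} := by
      rintro e ⟨he, heS⟩
      rcases edgeSet_doubleButterfly_subset he with ⟨i, t, rfl⟩ | he'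
      · exact ⟨Sum.inl (i, t), ⟨heS _ (Sym2.mem_mk_left _ _), heS _ (Sym2.mem_mk_right _ _)⟩, rfl⟩
      · obtain ⟨i, x, hx, rfl⟩ := mem_iUnion.1 he'
        have h1 := heS _ (Sym2.mem_mk_left _ _)
        have h2 := heS _ (Sym2.mem_mk_right _ _)
        rcases hx with rfl | rfl | rfl | rfl
        exacts [⟨Sum.inr (i, 0), ⟨h1, h2⟩, rfl⟩, ⟨Sum.inr (i, 1), ⟨h1, h2⟩, rfl⟩,
          ⟨Sum.inr (i, 2), ⟨h1, h2⟩, rfl⟩, ⟨Sum.inr (i, 3), ⟨h1, h2⟩, rfl⟩]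
    rw [hf, hF]
    refine (ncard_le_ncard hsub).trans ((ncard_image_le).trans ?_)
    rw [ncard_eq_toFinset_card', toFinset_ofPred]
  have hF' := hF
  rw [Finset.card_filter] at hF'
  simp only [Fintype.sum_sum_type, Fintype.sum_prod_type, Fin.sum_univ_two, Fin.sum_univ_four,
    earEdge] at hF'
  have key := ear_count (decide (Sum.inl (Sum.inl 0) ∈ S)) (decide (Sum.inl (Sum.inl 1) ∈ S))
    (decide (Sum.inl (Sum.inr 0) ∈ S)) (decide (Sum.inl (Sum.inr 1) ∈ S))
    (decide (earHinge 0 ∈ S)) (decide (earHinge 1 ∈ S))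
    (decide (earTip 0 ∈ S)) (decide (earTip 1 ∈ S)) F g m (by
      rw [hF']
      simp only [Bool.toNat, Bool.cond_eq_ite, Bool.and_eq_true, decide_eq_true_eq]
      rfl) hg hm
  omega

end EarCount

section GluedNucleationFree

variable {V : Type*} [Finite V] {G : GraphOn V} {a b : V} {Gs : GraphOn (SplitVertex V)}
  {κ : GenericKind}

theorem ncard_sum_type {α β : Type*} [Finite α] [Finite β] (U : Set (α ⊕ β)) :
    U.ncard = (Sum.inl ⁻¹' U).ncard + (Sum.inr ⁻¹' U).ncard := by
  conv_lhs => rw [← image_preimage_inl_union_image_preimage_inr U]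
  rw [ncard_union_eq, ncard_image_of_injective _ Sum.inl_injective,
    ncard_image_of_injective _ Sum.inr_injective]
  rw [Set.disjoint_left]
  rintro _ ⟨x, -, rfl⟩ ⟨y, -, h⟩
  exact Sum.inl_ne_inr h.symm

/-- Gluing a double-butterfly to a nonedge-split of an independent nucleation-free graph gives a
nucleation-free graph. -/
theorem IsNonedgeSplit.isNucleationFree_glueDoubleButterfly (h : IsNonedgeSplit G a b Gs)
    (hG : IsIndependent (genericMatroid κ V) G) (hGn : IsNucleationFree (genericMatroid κ V) G)
    (σ : Quad ≃ Quad) :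
    IsNucleationFree (genericMatroid κ (GluedVertex V)) (glueDoubleButterfly Gs σ) := by
  have hM := genericMatroid_hasZeroExtensions κ V
  have hM' := genericMatroid_hasZeroExtensions κ (GluedVertex V)
  rw [hM'.isNucleationFree_iff (h.isIndependent_glueDoubleButterfly hG σ)]
  rw [hM.isNucleationFree_iff hG] at hGn
  intro U hU hU5
  set U₁ : Set (SplitVertex V) := Sum.inl ⁻¹' U with hU₁
  set S : Set EarVertex := earInclusion V σ ⁻¹' U with hS
  set W : Set V := splitCollapse a b '' (U₁ ∩ Gs.verts) with hW
  obtain ⟨g, hg⟩ : ∃ g, g = {t | Sum.inl t ∈ S}.ncard := ⟨_, rfl⟩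
  obtain ⟨m, hm⟩ : ∃ m, m = {t | Sum.inr t ∈ S}.ncard := ⟨_, rfl⟩
  obtain ⟨f, hf⟩ : ∃ f, f = (edgesIn doubleButterfly S).ncard := ⟨_, rfl⟩
  obtain ⟨k, hk⟩ : ∃ k, k = ((Sum.inl : V → SplitVertex V) ⁻¹' U₁).ncard := ⟨_, rfl⟩
  obtain ⟨hf1, hf2, hf3, hf4⟩ := doubleButterfly_count S hf hg hm
  have hverts : U₁ ∩ Gs.verts = U₁ := by
    refine inter_eq_left.2 fun x hx => ?_
    rcases hU hx with ⟨y, hy, hyx⟩ | ⟨y, -, hyx⟩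
    · exact Sum.inl_injective hyx ▸ hy
    · rcases y with t | t
      · obtain rfl := Sum.inl_injective hyx
        exact h.inr_mem _
      · simp [SimpleGraph.Embedding.completeGraph, earInclusion] at hyx
  have hg' : (Sum.inr ⁻¹' U₁ : Set Quad).ncard = g := by
    have : (Sum.inr ⁻¹' U₁ : Set Quad) = σ '' {t | Sum.inl t ∈ S} := by
      ext t
      obtain ⟨t, rfl⟩ := σ.surjective t
      rw [σ.injective.mem_set_image]
      rfl
    rw [this, ncard_image_of_injective _ σ.injective, hg]
  have hn : U.ncard = k + g + m := by
    rw [ncard_sum_type U, ncard_sum_type (Sum.inl ⁻¹' U), hk, ← hg', hm]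
    rfl
  have hsplit : U₁.ncard = k + g := by rw [ncard_sum_type U₁, hk, hg']
  have hw1 : W.ncard ≤ k + g := hsplit ▸ hverts ▸ ncard_image_le
  have hk' : ((Sum.inl : V → SplitVertex V) ⁻¹' U₁) = W \ {a, b} := by
    ext v
    constructor
    · intro hv
      have hv' : Sum.inl v ∈ U₁ ∩ Gs.verts := hverts.symm.subset hv
      exact ⟨⟨_, hv', rfl⟩, by simpa using (h.notMem_of_inl_mem hv'.2).2⟩
    · rintro ⟨⟨x | t, hx, rfl⟩, hv⟩
      · exact hx.1
      · exact (hv (splitCollapse_inr t)).elim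
  have hw2 : k ≤ W.ncard := by
    rw [hk, hk']
    exact ncard_le_ncard sdiff_subset
  have hw3 : W.ncard ≤ k + 2 := by
    have h1 := ncard_le_ncard_sdiff_add_ncard W {a, b}
    rw [← hk', ← hk] at h1
    exact h1.trans (Nat.add_le_add_left ((ncard_insert_le _ _).trans (by simp)) _)
  have hWG : W ⊆ G.verts := by
    rintro _ ⟨x | i | i, hx, rfl⟩
    exacts [(h.notMem_of_inl_mem hx.2).1, h.mem_left, h.mem_right]
  have hE1 := hM.ncard_edgesIn_le hG W
  have hE2 : 5 ≤ W.ncard → (edgesIn G W).ncard + 6 < 3 * W.ncard := fun h5 => hGn W hWG h5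
  -- With no old vertices other than a and b present, W lies in the nonadjacent pair a, b.
  have hE3 : k = 0 → (edgesIn G W).ncard = 0 := by
    intro hk0
    rw [hk, hk', ncard_eq_zero, sdiff_eq_empty] at hk0
    rw [ncard_eq_zero, eq_empty_iff_forall_notMem]
    rintro e ⟨he, heW⟩
    induction e with | _ x y
    have hxy : G.Adj x y := he
    rcases hk0 (heW x (Sym2.mem_mk_left x y)) with rfl | rfl <;>
      rcases hk0 (heW y (Sym2.mem_mk_right _ y)) with rfl | rfl
    exacts [hxy.ne rfl, h.not_adj hxy, h.not_adj hxy.symm, hxy.ne rfl]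
  have hcount : {e ∈ (glueDoubleButterfly Gs σ).edgeSet | ∀ v ∈ e, v ∈ U}.ncard ≤
      (edgesIn G W).ncard + f := by
    have hsub : {e ∈ (glueDoubleButterfly Gs σ).edgeSet | ∀ v ∈ e, v ∈ U} ⊆
        Sym2.map Sum.inl '' edgesIn Gs U₁ ∪
          Sym2.map (earInclusion V σ) '' edgesIn doubleButterfly S := by
      rintro e ⟨he, heU⟩
      rw [edgeSet_glueDoubleButterfly] at he
      rcases he with ⟨e, he, rfl⟩ | ⟨e, he, rfl⟩
      · exact Or.inl ⟨e, ⟨he, fun v hv => heU _ (Sym2.mem_map.2 ⟨v, hv, rfl⟩)⟩, rfl⟩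
      · exact Or.inr ⟨e, ⟨he, fun v hv => heU _ (Sym2.mem_map.2 ⟨v, hv, rfl⟩)⟩, rfl⟩
    refine (ncard_le_ncard hsub).trans ((ncard_union_le _ _).trans (Nat.add_le_add
      ((ncard_image_le).trans ?_) ((ncard_image_le).trans hf.ge)))
    refine ncard_le_ncard_of_injOn (Sym2.map (splitCollapse a b)) ?_
      (h.injOn_collapse.mono fun e he => he.1)
    rintro e ⟨he, heU⟩
    refine ⟨h.mapsTo_collapse he, fun v hv => ?_⟩
    obtain ⟨x, hx, rfl⟩ := Sym2.mem_map.1 hv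
    exact ⟨x, hverts.symm ▸ heU x hx, rfl⟩
  rw [hn] at hU5 ⊢
  -- For |W| ≥ 3 the bound 3|W| - 6 and the ear budget add up to at most 3|U| - 6, because |W| ≤ k +
  -- min(g, 2). Strictness comes from G if |W| ≥ 5, and otherwise from the ear or from |U| > |W|.
  -- For |W| ≤ 2 the Maxwell count of the ear suffices.
  have hc := completeRank_cases W.ncard
  omega

end GluedNucleationFree

/-! ### The clusters of the split graph -/

section SplitClusters

variable {V : Type*} {G : GraphOn V} {X : Set (Set V)} {a b : V} {Gs : GraphOn (SplitVertex V)}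
  {Y Y₁ Y₂ : Set V}

theorem splitCollapse_mem {x : SplitVertex V} (hx : x ∈ splitCluster a b Gs Y) :
    splitCollapse a b x ∈ Y := by
  rcases x with v | i | i
  exacts [(mem_splitCluster_inl.1 hx).1, (mem_splitCluster_aCopy.1 hx).1,
    (mem_splitCluster_bCopy.1 hx).1]

theorem aCopy_index_eq {Z : Set (SplitVertex V)} (hZ : ¬ ContainsTwins Z) {i j : Fin 2}
    (hi : aCopy V i ∈ Z) (hj : aCopy V j ∈ Z) : i = j := by
  by_contra hne
  refine hZ (Or.inl fun k => ?_)
  have : k = i ∨ k = j := by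
    clear * - hne
    revert i j k
    decide
  rcases this with rfl | rfl
  exacts [hi, hj]

theorem bCopy_index_eq {Z : Set (SplitVertex V)} (hZ : ¬ ContainsTwins Z) {i j : Fin 2}
    (hi : bCopy V i ∈ Z) (hj : bCopy V j ∈ Z) : i = j := by
  by_contra hne
  refine hZ (Or.inr fun k => ?_)
  have : k = i ∨ k = j := by
    clear * - hne
    revert i j k
    decide
  rcases this with rfl | rfl
  exacts [hi, hj]

theorem injOn_splitCollapse (hab : a ≠ b) (hY : ¬ ContainsTwins (splitCluster a b Gs Y)) :
    InjOn (splitCollapse a b) (splitCluster a b Gs Y) := by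
  rintro (v | i | i) hx (w | j | j) hy h
  · exact congrArg _ h
  · exact ((mem_splitCluster_inl.1 hx).2.1 h).elim
  · exact ((mem_splitCluster_inl.1 hx).2.2 h).elim
  · exact ((mem_splitCluster_inl.1 hy).2.1 h.symm).elim
  · rw [aCopy_index_eq hY hx hy]
  · exact (hab h).elim
  · exact ((mem_splitCluster_inl.1 hy).2.2 h.symm).elim
  · exact (hab h.symm).elim
  · rw [bCopy_index_eq hY hx hy]

namespace IsNonedgeSplit

variable (h : IsNonedgeSplit G a b Gs)
include h

/-- Each neighbour of a in the cluster belongs to a copy that enters the split cluster. Without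
twins there is only one such copy, so it has all these edges. -/
theorem adj_of_aCopy_mem (hY : ¬ ContainsTwins (splitCluster a b Gs Y)) {i : Fin 2} {u : V}
    (hi : aCopy V i ∈ splitCluster a b Gs Y) (hu : u ∈ Y) (hau : G.Adj a u) :
    Gs.Adj (aCopy V i) (Sum.inl u) := by
  obtain ⟨j, hj⟩ := h.exists_aCopy_adj_iff.2 hau
  have hj' : aCopy V j ∈ splitCluster a b Gs Y :=
    mem_splitCluster_aCopy.2 ⟨(mem_splitCluster_aCopy.1 hi).1, u, hu, hj⟩
  rwa [aCopy_index_eq hY hi hj']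

theorem adj_of_bCopy_mem (hY : ¬ ContainsTwins (splitCluster a b Gs Y)) {i : Fin 2} {u : V}
    (hi : bCopy V i ∈ splitCluster a b Gs Y) (hu : u ∈ Y) (hbu : G.Adj b u) :
    Gs.Adj (bCopy V i) (Sum.inl u) := by
  obtain ⟨j, hj⟩ := h.exists_bCopy_adj_iff.2 hbu
  have hj' : bCopy V j ∈ splitCluster a b Gs Y :=
    mem_splitCluster_bCopy.2 ⟨(mem_splitCluster_bCopy.1 hi).1, u, hu, hj⟩
  rwa [bCopy_index_eq hY hi hj']

theorem adj_of_mem_splitCluster (hY : ¬ ContainsTwins (splitCluster a b Gs Y))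
    {x y : SplitVertex V} (hx : x ∈ splitCluster a b Gs Y) (hy : y ∈ splitCluster a b Gs Y)
    (hxy : G.Adj (splitCollapse a b x) (splitCollapse a b y)) : Gs.Adj x y := by
  rcases x with x | i | i <;> rcases y with y | j | j
  · exact (h.adj_old x y (by simpa using (mem_splitCluster_inl.1 hx).2)
      (by simpa using (mem_splitCluster_inl.1 hy).2)).2 hxy
  · exact (h.adj_of_aCopy_mem hY hy (splitCollapse_mem hx) hxy.symm).symm
  · exact (h.adj_of_bCopy_mem hY hy (splitCollapse_mem hx) hxy.symm).symm
  · exact h.adj_of_aCopy_mem hY hx (splitCollapse_mem hy) hxy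
  · exact (hxy.ne rfl).elim
  · exact (h.not_adj hxy).elim
  · exact h.adj_of_bCopy_mem hY hx (splitCollapse_mem hy) hxy
  · exact (h.not_adj hxy.symm).elim
  · exact (hxy.ne rfl).elim

theorem splitCluster_subset_verts (hY : Y ⊆ G.verts) : splitCluster a b Gs Y ⊆ Gs.verts := by
  rintro (x | t) hx
  · rw [h.verts_eq]
    have := mem_splitCluster_inl.1 hx
    exact Or.inl ⟨x, ⟨hY this.1, by simpa using this.2⟩, rfl⟩
  · exact h.inr_mem t

end IsNonedgeSplit

theorem inter_eq_pair (hX : ∀ Y ∈ X, ∀ Z ∈ X, Y ≠ Z → (Y ∩ Z).ncard ≤ 2) [Finite V]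
    (h₁ : Y₁ ∈ X) (h₂ : Y₂ ∈ X) (hne : Y₁ ≠ Y₂) {x y : V} (hxy : x ≠ y) (hx₁ : x ∈ Y₁)
    (hx₂ : x ∈ Y₂) (hy₁ : y ∈ Y₁) (hy₂ : y ∈ Y₂) : Y₁ ∩ Y₂ = {x, y} := by
  refine (eq_of_subset_of_ncard_le ?_ ?_ (toFinite _)).symm
  · rintro z (rfl | rfl)
    exacts [⟨hx₁, hx₂⟩, ⟨hy₁, hy₂⟩]
  · rw [ncard_pair hxy]
    exact hX _ h₁ _ h₂ hne

/-- Clusters sharing au use the same copy of a: if au is an edge, only one copy is adjacent to u; if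
it is a nonedge, this is condition (2) of safety. -/
theorem IsSafeNonedgeSplit.aCopy_index_eq [Finite V] (h : IsSafeNonedgeSplit G X a b Gs)
    (hX : ∀ Y ∈ X, ∀ Z ∈ X, Y ≠ Z → (Y ∩ Z).ncard ≤ 2) (h₁ : Y₁ ∈ X) (h₂ : Y₂ ∈ X)
    (ht₁ : ¬ ContainsTwins (splitCluster a b Gs Y₁))
    (ht₂ : ¬ ContainsTwins (splitCluster a b Gs Y₂)) {u : V} (hua : a ≠ u) (hub : u ≠ b)
    (hu₁ : u ∈ Y₁) (hu₂ : u ∈ Y₂) (hS : s(a, u) ∈ sharedSet X) {i j : Fin 2}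
    (hi : aCopy V i ∈ splitCluster a b Gs Y₁) (hj : aCopy V j ∈ splitCluster a b Gs Y₂) :
    i = j := by
  by_cases hadj : G.Adj a u
  · exact h.toIsNonedgeSplit.aCopy_inj (h.toIsNonedgeSplit.adj_of_aCopy_mem ht₁ hi hu₁ hadj)
      (h.toIsNonedgeSplit.adj_of_aCopy_mem ht₂ hj hu₂ hadj)
  · by_cases hne : Y₁ = Y₂
    · subst hne
      exact _root_.aCopy_index_eq ht₁ hi hj
    · exact _root_.aCopy_index_eq ht₂ ((h.agree_left _ h₁ _ h₂ u hub (inter_eq_pair hX h₁ h₂ hne hua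
        (splitCollapse_mem hi) (splitCollapse_mem hj) hu₁ hu₂) hS hadj i).1 hi) hj

theorem IsSafeNonedgeSplit.bCopy_index_eq [Finite V] (h : IsSafeNonedgeSplit G X a b Gs)
    (hX : ∀ Y ∈ X, ∀ Z ∈ X, Y ≠ Z → (Y ∩ Z).ncard ≤ 2) (h₁ : Y₁ ∈ X) (h₂ : Y₂ ∈ X)
    (ht₁ : ¬ ContainsTwins (splitCluster a b Gs Y₁))
    (ht₂ : ¬ ContainsTwins (splitCluster a b Gs Y₂)) {u : V} (hub : b ≠ u) (hua : u ≠ a)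
    (hu₁ : u ∈ Y₁) (hu₂ : u ∈ Y₂) (hS : s(b, u) ∈ sharedSet X) {i j : Fin 2}
    (hi : bCopy V i ∈ splitCluster a b Gs Y₁) (hj : bCopy V j ∈ splitCluster a b Gs Y₂) :
    i = j := by
  by_cases hadj : G.Adj b u
  · exact h.toIsNonedgeSplit.bCopy_inj (h.toIsNonedgeSplit.adj_of_bCopy_mem ht₁ hi hu₁ hadj)
      (h.toIsNonedgeSplit.adj_of_bCopy_mem ht₂ hj hu₂ hadj)
  · by_cases hne : Y₁ = Y₂
    · subst hne
      exact _root_.bCopy_index_eq ht₁ hi hj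
    · exact _root_.bCopy_index_eq ht₂ ((h.agree_right _ h₁ _ h₂ u hua (inter_eq_pair hX h₁ h₂ hne
        hub (splitCollapse_mem hi) (splitCollapse_mem hj) hu₁ hu₂) hS hadj i).1 hi) hj

/-- The pairs inside large clusters of the split graph that lie over shared pairs other than
`ab`. -/
def splitLifts (X : Set (Set V)) (a b : V) (Gs : GraphOn (SplitVertex V)) :
    Set (Sym2 (SplitVertex V)) :=
  {e | (∃ Z ∈ largeSplitClusters X a b Gs, ∀ v ∈ e, v ∈ Z) ∧
    e.map (splitCollapse a b) ∈ sharedSet X \ {s(a, b)}}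

/-- The pairs inside large clusters of the split graph that lie over `ab`. -/
def splitKeyPairs (X : Set (Set V)) (a b : V) (Gs : GraphOn (SplitVertex V)) :
    Set (Sym2 (SplitVertex V)) :=
  {e | ∃ i j, e = s(aCopy V i, bCopy V j) ∧
    ∃ Z ∈ largeSplitClusters X a b Gs, aCopy V i ∈ Z ∧ bCopy V j ∈ Z}

/-- Gluing vertices are pairwise nonadjacent, so no edge cluster contributes, and large clusters
contain no twins. -/
theorem IsNonedgeSplit.keyPairs_eq [Finite V] (h : IsNonedgeSplit G a b Gs) :
    keyPairs (range Sum.inr) (safeSplitCover X a b Gs) = splitKeyPairs X a b Gs := by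
  ext e
  constructor
  · rintro ⟨he, Z, hZ, heZ⟩
    induction e with | _ x y
    obtain ⟨hne, ⟨s, rfl⟩, ⟨t, rfl⟩⟩ := mk_mem_pairsIn.1 he
    have hs := heZ _ (Sym2.mem_mk_left _ _)
    have ht := heZ _ (Sym2.mem_mk_right _ _)
    rcases hZ with hZ | ⟨x, y, hxy, rfl, -⟩
    · obtain ⟨Y, hY, rfl, -, htw⟩ := id hZ
      rcases s with i | i <;> rcases t with j | j
      · exact (hne (by rw [aCopy_index_eq htw hs ht])).elim
      · exact ⟨i, j, rfl, _, hZ, hs, ht⟩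
      · exact ⟨j, i, Sym2.eq_swap, _, hZ, ht, hs⟩
      · exact (hne (by rw [bCopy_index_eq htw hs ht])).elim
    · have hinr : ∀ s t : Quad, ¬ Gs.Adj (Sum.inr s) (Sum.inr t) := by
        rintro (i | i) t hadj
        · obtain ⟨v, -, hv⟩ := h.exists_of_aCopy_adj hadj
          simp at hv
        · obtain ⟨v, -, hv⟩ := h.exists_of_bCopy_adj hadj
          simp at hv
      rcases hs with rfl | rfl <;> rcases ht with ht | ht
      · exact (hne ht.symm).elim
      · obtain rfl := ht
        exact (hinr _ _ hxy).elim
      · obtain rfl := ht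
        exact (hinr _ _ hxy).elim
      · exact (hne ht.symm).elim
  · rintro ⟨i, j, rfl, Z, hZ, hi, hj⟩
    refine ⟨mk_mem_pairsIn.2 ⟨by simp, ⟨_, rfl⟩, ⟨_, rfl⟩⟩, Z, Or.inl hZ, ?_⟩
    simp [hi, hj]

/-- The consistent choice of copies gives each shared pair other than ab at most one lift. The pair
ab may have several, which are treated separately as key pairs. -/
theorem IsSafeNonedgeSplit.injOn_splitLifts [Finite V] (h : IsSafeNonedgeSplit G X a b Gs)
    (hX : ∀ Y ∈ X, ∀ Z ∈ X, Y ≠ Z → (Y ∩ Z).ncard ≤ 2) :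
    InjOn (Sym2.map (splitCollapse a b)) (splitLifts X a b Gs) := by
  have key : ∀ x y x' y' : SplitVertex V, s(x, y) ∈ splitLifts X a b Gs →
      s(x', y') ∈ splitLifts X a b Gs → splitCollapse a b x = splitCollapse a b x' →
      splitCollapse a b y = splitCollapse a b y' → x = x' := by
    rintro x y x' y' ⟨⟨_, ⟨Y₁, h₁, rfl, -, ht₁⟩, he⟩, hS, hne⟩
      ⟨⟨_, ⟨Y₂, h₂, rfl, -, ht₂⟩, he'⟩, -⟩ hx hy
    have hmx := he x (Sym2.mem_mk_left _ _)
    have hmy := he y (Sym2.mem_mk_right _ _)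
    have hmx' := he' x' (Sym2.mem_mk_left _ _)
    have hmy' := he' y' (Sym2.mem_mk_right _ _)
    have hmY₂ := hy ▸ splitCollapse_mem hmy'
    have hdiag : splitCollapse a b x ≠ splitCollapse a b y := fun h =>
      not_isDiag_of_mem_sharedSet hS h
    rcases x with v | i | i <;> rcases x' with v' | j | j
    · exact congrArg _ hx
    · exact ((mem_splitCluster_inl.1 hmx).2.1 hx).elim
    · exact ((mem_splitCluster_inl.1 hmx).2.2 hx).elim
    · exact ((mem_splitCluster_inl.1 hmx').2.1 hx.symm).elim
    · rw [h.aCopy_index_eq hX h₁ h₂ ht₁ ht₂ hdiag (fun h => hne (by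
        rw [mem_singleton_iff, Sym2.map_mk, h]; rfl)) (splitCollapse_mem hmy) hmY₂ hS hmx hmx']
    · exact (h.ne hx).elim
    · exact ((mem_splitCluster_inl.1 hmx').2.2 hx.symm).elim
    · exact (h.ne hx.symm).elim
    · rw [h.bCopy_index_eq hX h₁ h₂ ht₁ ht₂ hdiag (fun h => hne (by
        rw [mem_singleton_iff, Sym2.map_mk, h]; exact Sym2.eq_swap)) (splitCollapse_mem hmy) hmY₂
        hS hmx hmx']
  intro e he e' he' hee
  induction e with | _ x y
  induction e' with | _ x' y'
  have he₂ := he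
  have he₂' := he'
  rw [Sym2.eq_swap] at he₂ he₂'
  rcases Sym2.eq_iff.1 hee with ⟨h1, h2⟩ | ⟨h1, h2⟩
  · exact congrArg₂ _ (key _ _ _ _ he he' h1 h2) (key _ _ _ _ he₂ he₂' h2 h1)
  · rw [Sym2.eq_swap]
    exact congrArg₂ _ (key _ _ _ _ he₂ he' h2 h1) (key _ _ _ _ he he₂' h1 h2)

theorem largeSplitClusters_inter_le [Finite V] (hab : a ≠ b)
    (hX : ∀ Y ∈ X, ∀ Z ∈ X, Y ≠ Z → (Y ∩ Z).ncard ≤ 2) :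
    ∀ Y ∈ largeSplitClusters X a b Gs, ∀ Z ∈ largeSplitClusters X a b Gs, Y ≠ Z →
      (Y ∩ Z).ncard ≤ 2 := by
  rintro _ ⟨Y₁, h₁, rfl, -, ht₁⟩ _ ⟨Y₂, h₂, rfl, -, -⟩ hne
  refine (ncard_le_ncard_of_injOn (splitCollapse a b) (t := Y₁ ∩ Y₂) (fun x hx =>
    ⟨splitCollapse_mem hx.1, splitCollapse_mem hx.2⟩)
    ((injOn_splitCollapse hab ht₁).mono inter_subset_left)).trans (hX _ h₁ _ h₂ ?_)
  rintro rfl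
  exact hne rfl

theorem sharedSet_largeSplitClusters_subset [Finite V] (hab : a ≠ b)
    (hX : ∀ Y ∈ X, ∀ Z ∈ X, Y ≠ Z → (Y ∩ Z).ncard ≤ 2) :
    sharedSet (largeSplitClusters X a b Gs) ⊆ splitLifts X a b Gs ∪ splitKeyPairs X a b Gs := by
  intro e he
  have hd := not_isDiag_of_mem_sharedSet he
  obtain ⟨Z₁, hZ₁, Z₂, hZ₂, hne, he₁, he₂⟩ := exists_of_mem_sharedSet he
  have hZ₁' := hZ₁
  obtain ⟨Y₁, h₁, rfl, -, ht₁⟩ := hZ₁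
  obtain ⟨Y₂, h₂, rfl, -, ht₂⟩ := hZ₂
  have hS : e.map (splitCollapse a b) ∈ sharedSet X := by
    refine mem_sharedSet_of_mem ?_ hX h₁ h₂ (fun h => hne (by rw [h])) ?_ ?_
    · induction e with | _ x y
      intro hxy
      exact hd (injOn_splitCollapse hab ht₁ (he₁ x (Sym2.mem_mk_left _ _))
        (he₁ y (Sym2.mem_mk_right _ _)) hxy)
    · intro v hv
      obtain ⟨x, hx, rfl⟩ := Sym2.mem_map.1 hv
      exact splitCollapse_mem (he₁ x hx)
    · intro v hv
      obtain ⟨x, hx, rfl⟩ := Sym2.mem_map.1 hv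
      exact splitCollapse_mem (he₂ x hx)
  by_cases heab : e.map (splitCollapse a b) = s(a, b)
  · refine Or.inr ?_
    have key : ∀ x y : SplitVertex V, x ∈ splitCluster a b Gs Y₁ → y ∈ splitCluster a b Gs Y₁ →
        splitCollapse a b x = a → splitCollapse a b y = b → s(x, y) ∈ splitKeyPairs X a b Gs := by
      rintro (v | i | i) (w | j | j) hx hy hxa hyb
      · exact ((mem_splitCluster_inl.1 hx).2.1 hxa).elim
      · exact ((mem_splitCluster_inl.1 hx).2.1 hxa).elim
      · exact ((mem_splitCluster_inl.1 hx).2.1 hxa).elim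
      · exact ((mem_splitCluster_inl.1 hy).2.2 hyb).elim
      · exact (hab hyb).elim
      · exact ⟨i, j, rfl, _, hZ₁', hx, hy⟩
      · exact (hab hxa.symm).elim
      · exact (hab hxa.symm).elim
      · exact (hab hxa.symm).elim
    induction e with | _ x y
    have hx := he₁ x (Sym2.mem_mk_left _ _)
    have hy := he₁ y (Sym2.mem_mk_right _ _)
    rcases Sym2.eq_iff.1 heab with ⟨h1, h2⟩ | ⟨h1, h2⟩
    · exact key x y hx hy h1 h2
    · rw [Sym2.eq_swap]
      exact key y x hy hx h2 h1
  · exact Or.inl ⟨⟨_, hZ₁', he₁⟩, hS, heab⟩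

end SplitClusters

/-! ### Nullities of the clusters of the split graph -/

section SplitNullity

variable {κ : GenericKind} {V : Type*} [Finite V] {G : GraphOn V} {X : Set (Set V)} {a b : V}
  {Gs : GraphOn (SplitVertex V)}

open Classical in
/-- The inclusion of the old vertices that sends `a` and `b` to given copies. -/
noncomputable def copyEmbedding (a b : V) (i j : Fin 2) : V ↪ SplitVertex V where
  toFun v := if v = a then aCopy V i else if v = b then bCopy V j else Sum.inl v
  inj' v w h := by
    by_cases hva : v = a <;> by_cases hwa : w = a <;> by_cases hvb : v = b <;>
      by_cases hwb : w = b <;> simp_all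

theorem copyEmbedding_left {i j : Fin 2} : copyEmbedding a b i j a = aCopy V i :=
  if_pos rfl

theorem copyEmbedding_right {i j : Fin 2} (hab : a ≠ b) : copyEmbedding a b i j b = bCopy V j :=
  (if_neg hab.symm).trans (if_pos rfl)

theorem copyEmbedding_of_ne {i j : Fin 2} {v : V} (ha : v ≠ a) (hb : v ≠ b) :
    copyEmbedding a b i j v = Sum.inl v :=
  (if_neg ha).trans (if_neg hb)

/-- Without twins the collapse is inverted on the cluster by an embedding of all of V, which is what
comparing nullities requires. The index is irrelevant, and set to 0, when no copy occurs. -/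
theorem exists_copyEmbedding (hab : a ≠ b) {Y : Set V}
    (hY : ¬ ContainsTwins (splitCluster a b Gs Y)) : ∃ i j, ∀ x ∈ splitCluster a b Gs Y,
      copyEmbedding a b i j (splitCollapse a b x) = x := by
  obtain ⟨i, hi⟩ : ∃ i, ∀ k, aCopy V k ∈ splitCluster a b Gs Y → k = i := by
    by_cases h : ∃ i, aCopy V i ∈ splitCluster a b Gs Y
    · obtain ⟨i, hi⟩ := h
      exact ⟨i, fun k hk => aCopy_index_eq hY hk hi⟩
    · exact ⟨0, fun k hk => (h ⟨k, hk⟩).elim⟩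
  obtain ⟨j, hj⟩ : ∃ j, ∀ k, bCopy V k ∈ splitCluster a b Gs Y → k = j := by
    by_cases h : ∃ j, bCopy V j ∈ splitCluster a b Gs Y
    · obtain ⟨j, hj⟩ := h
      exact ⟨j, fun k hk => bCopy_index_eq hY hk hj⟩
    · exact ⟨0, fun k hk => (h ⟨k, hk⟩).elim⟩
  refine ⟨i, j, ?_⟩
  rintro (v | k | k) hx
  · exact copyEmbedding_of_ne (mem_splitCluster_inl.1 hx).2.1 (mem_splitCluster_inl.1 hx).2.2
  · rw [hi k hx]
    exact copyEmbedding_left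
  · rw [hj k hx]
    exact copyEmbedding_right hab

namespace IsSafeBaseWitness

variable (hw : IsSafeBaseWitness (genericMatroid κ V) G X a b Gs)
include hw

/-- Tightness leaves ab as the only possible pair at a in such a cluster, and a star with at most
one pair does not contribute to the nullity. -/
theorem nullity_le_sdiff_left {Y : Set V} (hY : Y ∈ X) (haY : a ∈ Y)
    (hbad : ∀ y ∈ Y, ¬ G.Adj a y) {B : Set (Sym2 V)}
    (hB : B ⊆ {e ∈ G.edgeSet ∪ sharedSet X | ∀ v ∈ e, v ∈ Y}) :
    nullity (genericMatroid κ V) B ≤ nullity (genericMatroid κ V) (B \ {e | a ∈ e}) := by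
  have hM := genericMatroid_hasZeroExtensions κ V
  have h1 : B ∩ {e | a ∈ e} ⊆ {s(a, b)} := by
    rintro e ⟨he, u, rfl⟩
    obtain ⟨hE | hS, heY⟩ := hB he
    · exact (hbad u (heY u (Sym2.mem_mk_right _ _)) hE).elim
    · by_contra hne
      exact hM.notMem_sharedSet_of_forall_not_adj hw.indep hw.cover hw.indep_shared hw.rank_eq
        hw.safe.isSplittableNonedge hY haY hbad (heY u (Sym2.mem_mk_right _ _))
        (fun h => hne (by rw [h]; rfl)) hS
  have h2 := (ncard_le_ncard h1).trans (ncard_singleton _).le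
  have h3 := hM.nullity_le_sdiff_star (A := B) (fun e he => ⟨by
    rcases (hB he).1 with h | h
    exacts [not_isDiag_of_mem_edgeSet h, not_isDiag_of_mem_sharedSet h], fun _ _ => trivial⟩) a
  omega

theorem nullity_le_sdiff_right {Y : Set V} (hY : Y ∈ X) (hbY : b ∈ Y)
    (hbad : ∀ y ∈ Y, ¬ G.Adj b y) {B : Set (Sym2 V)}
    (hB : B ⊆ {e ∈ G.edgeSet ∪ sharedSet X | ∀ v ∈ e, v ∈ Y}) :
    nullity (genericMatroid κ V) B ≤ nullity (genericMatroid κ V) (B \ {e | b ∈ e}) := by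
  have hM := genericMatroid_hasZeroExtensions κ V
  have h1 : B ∩ {e | b ∈ e} ⊆ {s(b, a)} := by
    rintro e ⟨he, u, rfl⟩
    obtain ⟨hE | hS, heY⟩ := hB he
    · exact (hbad u (heY u (Sym2.mem_mk_right _ _)) hE).elim
    · by_contra hne
      exact hM.notMem_sharedSet_of_forall_not_adj hw.indep hw.cover hw.indep_shared hw.rank_eq
        hw.safe.isSplittableNonedge.symm hY hbY hbad (heY u (Sym2.mem_mk_right _ _))
        (fun h => hne (by rw [h]; rfl)) hS
  have h2 := (ncard_le_ncard h1).trans (ncard_singleton _).le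
  have h3 := hM.nullity_le_sdiff_star (A := B) (fun e he => ⟨by
    rcases (hB he).1 with h | h
    exacts [not_isDiag_of_mem_edgeSet h, not_isDiag_of_mem_sharedSet h], fun _ _ => trivial⟩) b
  omega

/-- Ends of the split nonedge without neighbours in a cluster do not affect its nullity. -/
theorem nullity_le_image {Y : Set V} (hY : Y ∈ X) :
    nullity (genericMatroid κ V) {e ∈ G.edgeSet ∪ sharedSet X | ∀ v ∈ e, v ∈ Y} ≤
      nullity (genericMatroid κ V) {e ∈ G.edgeSet ∪ sharedSet X |
        ∀ v ∈ e, v ∈ splitCollapse a b '' splitCluster a b Gs Y} := by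
  set F : Set (Sym2 V) := {e ∈ G.edgeSet ∪ sharedSet X | ∀ v ∈ e, v ∈ Y} with hF
  have h := hw.safe.toIsNonedgeSplit
  obtain ⟨B₁, hB₁, hn₁, ha⟩ : ∃ B₁ ⊆ F, nullity (genericMatroid κ V) F ≤
      nullity (genericMatroid κ V) B₁ ∧
      ∀ e ∈ B₁, a ∈ e → a ∈ splitCollapse a b '' splitCluster a b Gs Y := by
    by_cases hgood : a ∈ Y ∧ ∃ y ∈ Y, G.Adj a y
    · obtain ⟨i, hi⟩ := h.exists_aCopy_mem_iff.2 hgood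
      exact ⟨F, Subset.rfl, le_rfl, fun _ _ _ => ⟨_, hi, rfl⟩⟩
    · by_cases haY : a ∈ Y
      · refine ⟨F \ {e | a ∈ e}, sdiff_subset, hw.nullity_le_sdiff_left hY haY
          (fun y hy hay => hgood ⟨haY, y, hy, hay⟩) Subset.rfl, fun e he hae => (he.2 hae).elim⟩
      · exact ⟨F, Subset.rfl, le_rfl, fun e he hae => (haY (he.2 a hae)).elim⟩
  obtain ⟨B₂, hB₂, hn₂, hb⟩ : ∃ B₂ ⊆ B₁, nullity (genericMatroid κ V) B₁ ≤
      nullity (genericMatroid κ V) B₂ ∧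
      ∀ e ∈ B₂, b ∈ e → b ∈ splitCollapse a b '' splitCluster a b Gs Y := by
    by_cases hgood : b ∈ Y ∧ ∃ y ∈ Y, G.Adj b y
    · obtain ⟨i, hi⟩ := h.exists_bCopy_mem_iff.2 hgood
      exact ⟨B₁, Subset.rfl, le_rfl, fun _ _ _ => ⟨_, hi, rfl⟩⟩
    · by_cases hbY : b ∈ Y
      · refine ⟨B₁ \ {e | b ∈ e}, sdiff_subset, hw.nullity_le_sdiff_right hY hbY
          (fun y hy hay => hgood ⟨hbY, y, hy, hay⟩) hB₁, fun e he hae => (he.2 hae).elim⟩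
      · exact ⟨B₁, Subset.rfl, le_rfl, fun e he hae => (hbY ((hB₁ he).2 b hae)).elim⟩
  refine (hn₁.trans hn₂).trans (nullity_mono fun e he => ⟨(hB₁ (hB₂ he)).1, fun v hv => ?_⟩)
  by_cases hva : v = a
  · subst hva
    exact ha e (hB₂ he) hv
  by_cases hvb : v = b
  · subst hvb
    exact hb e he hv
  exact ⟨Sum.inl v, mem_splitCluster_inl.2 ⟨(hB₁ (hB₂ he)).2 v hv, hva, hvb⟩, rfl⟩

/-- A cluster of positive nullity gives rise to a large cluster of the split graph of at least the
same nullity. -/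
theorem nullity_le_splitCluster {Y : Set V} (hY : Y ∈ X) (hpos : 0 < nullity (genericMatroid κ V)
      {e ∈ G.edgeSet ∪ sharedSet X | ∀ v ∈ e, v ∈ Y}) :
    splitCluster a b Gs Y ∈ largeSplitClusters X a b Gs ∧
    nullity (genericMatroid κ V) {e ∈ G.edgeSet ∪ sharedSet X | ∀ v ∈ e, v ∈ Y} ≤
      nullity (genericMatroid κ (SplitVertex V))
        {e ∈ Gs.edgeSet ∪ (splitLifts X a b Gs ∪ splitKeyPairs X a b Gs) |
          ∀ v ∈ e, v ∈ splitCluster a b Gs Y} := by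
  have hM := genericMatroid_hasZeroExtensions κ V
  have h := hw.safe.toIsNonedgeSplit
  -- A cluster without shared nonedges has only edges of G and no nullity; one with such a nonedge
  -- has no twins by condition (1).
  have htw : ¬ ContainsTwins (splitCluster a b Gs Y) := by
    refine hw.safe.not_twins Y hY ?_
    by_contra hcon
    push Not at hcon
    refine hpos.ne' (nullity_eq_zero_iff.2 (Matroid.Indep.subset (show
      (genericMatroid κ V).Indep G.edgeSet from hw.indep) ?_))
    rintro e ⟨he | he, heY⟩
    · exact he
    · induction e with | _ x y
      exact hcon x (heY x (Sym2.mem_mk_left _ _)) y (heY y (Sym2.mem_mk_right _ _)) he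
  have hle := hw.nullity_le_image hY
  obtain ⟨i, j, hij⟩ := exists_copyEmbedding h.ne htw
  set N : Set (Sym2 V) := {e ∈ G.edgeSet ∪ sharedSet X |
    ∀ v ∈ e, v ∈ splitCollapse a b '' splitCluster a b Gs Y} with hN
  have hlarge : splitCluster a b Gs Y ∈ largeSplitClusters X a b Gs := by
    refine ⟨Y, hY, rfl, ?_, htw⟩
    by_contra hcon
    refine (hpos.trans_le hle).ne' (nullity_eq_zero_iff.2 ((hM.indep_pairsIn
      (U := splitCollapse a b '' splitCluster a b Gs Y) ?_).subset ?_))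
    · refine (ncard_image_le (toFinite _)).trans ?_
      omega
    · rintro e ⟨he, heY⟩
      exact ⟨he.elim not_isDiag_of_mem_edgeSet not_isDiag_of_mem_sharedSet, heY⟩
  refine ⟨hlarge, hle.trans ?_⟩
  rw [← nullity_genericMatroid_image (copyEmbedding a b i j) N]
  refine nullity_mono ?_
  rintro _ ⟨e, ⟨he, heY⟩, rfl⟩
  have hmem : ∀ v ∈ e.map (copyEmbedding a b i j), v ∈ splitCluster a b Gs Y := by
    intro v hv
    obtain ⟨u, hu, rfl⟩ := Sym2.mem_map.1 hv
    obtain ⟨x, hx, rfl⟩ := heY u hu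
    rwa [hij x hx]
  have hcol : (e.map (copyEmbedding a b i j)).map (splitCollapse a b) = e := by
    rw [Sym2.map_map]
    refine (Sym2.map_congr fun v hv => ?_).trans (congrFun Sym2.map_id e)
    obtain ⟨x, hx, rfl⟩ := heY v hv
    exact congrArg _ (hij x hx)
  refine ⟨?_, hmem⟩
  rcases he with he | he
  · left
    induction e with | _ x y
    obtain ⟨x, hx, rfl⟩ := heY x (Sym2.mem_mk_left _ _)
    obtain ⟨y, hy, rfl⟩ := heY y (Sym2.mem_mk_right _ _)
    rw [Sym2.map_mk, hij x hx, hij y hy]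
    exact h.adj_of_mem_splitCluster htw hx hy he
  · right
    by_cases heab : e = s(a, b)
    · subst heab
      rw [Sym2.map_mk, copyEmbedding_left, copyEmbedding_right h.ne] at hmem ⊢
      exact Or.inr ⟨i, j, rfl, _, hlarge, hmem _ (Sym2.mem_mk_left _ _),
        hmem _ (Sym2.mem_mk_right _ _)⟩
    · exact Or.inl ⟨⟨_, hlarge, hmem⟩, by rw [hcol]; exact ⟨he, heab⟩⟩

/-- By tightness the left side is the total nullity over the clusters of G. Those of positive
nullity pass injectively, and without loss, to large clusters. -/
theorem ncard_shared_le_sum_nullity :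
    ((sharedSet X \ G.edgeSet).ncard : ℤ) ≤
      ∑ Z ∈ (largeSplitClusters X a b Gs).toFinite.toFinset,
        nullity (genericMatroid κ (SplitVertex V))
          {e ∈ Gs.edgeSet ∪ (splitLifts X a b Gs ∪ splitKeyPairs X a b Gs) | ∀ v ∈ e, v ∈ Z} := by
  classical
  have h := hw.safe.toIsNonedgeSplit
  rw [← (rank_eq_inclExcl_iff hw.indep hw.cover).1 hw.rank_eq]
  set ν : Set V → ℤ := fun Y =>
    nullity (genericMatroid κ V) {e ∈ G.edgeSet ∪ sharedSet X | ∀ v ∈ e, v ∈ Y} with hν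
  have h1 : ∑ Y ∈ X.toFinite.toFinset, ν Y =
      ∑ Y ∈ X.toFinite.toFinset.filter (fun Y => 0 < ν Y), ν Y := by
    rw [Finset.sum_filter]
    refine Finset.sum_congr rfl fun Y _ => ?_
    have : 0 ≤ ν Y := nullity_nonneg _ _
    split_ifs <;> omega
  have hm : ∀ {Y}, Y ∈ X.toFinite.toFinset.filter (fun Y => 0 < ν Y) ↔ Y ∈ X ∧ 0 < ν Y := by simp
  -- A common image has at least three vertices and collapses injectively into the intersection,
  -- which has at most two.
  have hinj : Set.InjOn (splitCluster a b Gs)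
      (X.toFinite.toFinset.filter (fun Y => 0 < ν Y)) := by
    intro Y₁ h₁ Y₂ h₂ heq
    rw [Finset.mem_coe, hm] at h₁ h₂
    by_contra hne
    obtain ⟨-, -, -, h3, htw⟩ := (hw.nullity_le_splitCluster h₁.1 h₁.2).1
    have := ncard_le_ncard_of_injOn (splitCollapse a b) (s := splitCluster a b Gs Y₁)
      (t := Y₁ ∩ Y₂) (fun x hx => ⟨splitCollapse_mem hx, splitCollapse_mem (heq ▸ hx)⟩)
      (injOn_splitCollapse h.ne htw)
    have := hw.cover.inter_le _ h₁.1 _ h₂.1 hne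
    omega
  refine h1.trans_le ((Finset.sum_le_sum fun Y hY =>
    (hw.nullity_le_splitCluster (hm.1 hY).1 (hm.1 hY).2).2).trans ?_)
  rw [← Finset.sum_image (f := fun Z => nullity (genericMatroid κ (SplitVertex V))
    {e ∈ Gs.edgeSet ∪ (splitLifts X a b Gs ∪ splitKeyPairs X a b Gs) | ∀ v ∈ e, v ∈ Z}) hinj]
  refine Finset.sum_le_sum_of_subset_of_nonneg ?_ fun _ _ _ => nullity_nonneg _ _
  intro Z hZ
  obtain ⟨Y, hY, rfl⟩ := Finset.mem_image.1 hZ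
  rw [Finite.mem_toFinset]
  exact (hw.nullity_le_splitCluster (hm.1 hY).1 (hm.1 hY).2).1

/-- Lifts of edges are edges, and ab itself has no lift here. This strict inequality is the unit of
slack used below. -/
theorem ncard_splitLifts_lt :
    (splitLifts X a b Gs \ Gs.edgeSet).ncard < (sharedSet X \ G.edgeSet).ncard := by
  have h := hw.safe.toIsNonedgeSplit
  have hab : s(a, b) ∈ sharedSet X \ G.edgeSet := ⟨hw.safe.mem_shared, h.not_adj⟩
  have hle : (splitLifts X a b Gs \ Gs.edgeSet).ncard ≤
      ((sharedSet X \ G.edgeSet) \ {s(a, b)}).ncard := by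
    refine ncard_le_ncard_of_injOn (Sym2.map (splitCollapse a b)) ?_
      ((hw.safe.injOn_splitLifts hw.cover.inter_le).mono sdiff_subset)
    rintro e ⟨⟨⟨_, ⟨Y, hY, rfl, -, htw⟩, heY⟩, heS, hne⟩, heE⟩
    refine ⟨⟨heS, fun hE => heE ?_⟩, hne⟩
    induction e with | _ x y
    exact h.adj_of_mem_splitCluster htw (heY x (Sym2.mem_mk_left _ _))
      (heY y (Sym2.mem_mk_right _ _)) hE
  exact hle.trans_lt (ncard_sdiff_singleton_lt_of_mem hab)

/-- At the collapsed placement the lifts map injectively to shared pairs other than ab, and K maps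
to ab. The pairs allowed in K are disjoint, so their rows are independent as soon as a and b have a
nonzero coefficient vector. -/
theorem indep_splitLifts_union {K : Set (Sym2 (SplitVertex V))} {i j : Fin 2}
    (hK : K ⊆ {s(aCopy V i, bCopy V j), s(aCopy V (1 - i), bCopy V (1 - j))}) :
    (genericMatroid κ (SplitVertex V)).Indep (splitLifts X a b Gs ∪ K) := by
  have h := hw.safe.toIsNonedgeSplit
  obtain ⟨p, hp⟩ := (genericMatroid_indep_iff.1 hw.indep_shared).2
  have hab0 : κ.coeff (p a) (p b) ≠ 0 := by
    intro h0
    obtain ⟨s, hs⟩ := edgeRow_mk (κ := κ) p a b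
    refine hp.ne_zero hw.safe.mem_shared ?_
    rw [hs]
    have : orientedRow κ p a b = 0 := by
      ext x
      simp [orientedRow, h0]
    rw [this, smul_zero]
  refine genericMatroid_indep_iff.2 ⟨?_, p ∘ splitCollapse a b, ?_⟩
  · rintro e (⟨-, he, -⟩ | he)
    · refine ⟨?_, fun _ _ => trivial⟩
      induction e with | _ x y
      intro hxy
      exact not_isDiag_of_mem_sharedSet he (congrArg (splitCollapse a b) hxy)
    · rcases hK he with rfl | rfl <;> exact mk_mem_pairsIn.2 ⟨by simp, trivial, trivial⟩
  · refine linearIndepOn_edgeRow_union (splitCollapse a b) p (C := sharedSet X \ {s(a, b)})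
      (D := {s(a, b)}) (hw.safe.injOn_splitLifts hw.cover.inter_le) (fun e he => he.2) ?_
      disjoint_sdiff_left ?_ ?_
    · intro e he
      rcases hK he with rfl | rfl <;> rfl
    · exact hp.mono (union_subset sdiff_subset (singleton_subset_iff.2 hw.safe.mem_shared))
    · have hone : ∀ k l, LinearIndepOn ℝ (fun x => κ.coeff ((p ∘ splitCollapse a b) (aCopy V k))
          ((p ∘ splitCollapse a b) x)) {bCopy V l} := fun k l => LinearIndepOn.singleton hab0
      have k1 := linearIndepOn_edgeRow_union_starEdges (κ := κ) (p ∘ splitCollapse a b)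
        (linearIndepOn_empty _ _) (w := aCopy V i) (by simp [edgeSupport]) (by simp) (hone i j)
      have hi : 1 - i ≠ i := by
        clear * -
        revert i
        decide
      have k2 := linearIndepOn_edgeRow_union_starEdges (κ := κ) (p ∘ splitCollapse a b)
        k1 (w := aCopy V (1 - i)) (notMem_edgeSupport_union_starEdges (by simp [edgeSupport])
          (by simpa using hi) (by simp)) (by simp) (hone (1 - i) (1 - j))
      refine k2.mono (hK.trans ?_)
      rintro e (rfl | rfl) <;> simp [starEdges]

/-- Without key pairs the lifts would contain the whole shared set of the large clusters. Their
total nullity, at least |S \ E|, could then be at most the number of lifted nonedges, which is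
smaller. -/
theorem splitKeyPairs_nonempty : (splitKeyPairs X a b Gs).Nonempty := by
  by_contra hcon
  rw [not_nonempty_iff_eq_empty] at hcon
  have h := hw.safe.toIsNonedgeSplit
  have hsum := hw.ncard_shared_le_sum_nullity
  have hlt := hw.ncard_splitLifts_lt
  have hA := hw.indep_splitLifts_union (K := ∅) (i := 0) (j := 0) (empty_subset _)
  have hS := sharedSet_largeSplitClusters_subset (Gs := Gs) h.ne hw.cover.inter_le
  rw [hcon, union_empty] at hS hsum
  rw [union_empty] at hA
  have hd : ∀ e ∈ Gs.edgeSet ∪ splitLifts X a b Gs, ¬ e.IsDiag := by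
    rintro e (he | he)
    exacts [not_isDiag_of_mem_edgeSet he,
      ((genericMatroid_hasZeroExtensions κ _).subset_pairsIn hA he).1]
  have h1 := sum_nullity_le (largeSplitClusters X a b Gs).toFinite.toFinset
    (fun Z => {e ∈ Gs.edgeSet ∪ splitLifts X a b Gs | ∀ v ∈ e, v ∈ Z}) hA
    (fun Y hY Z hZ hne e he => hS (mem_sharedSet_of_mem (hd e he.1.1)
      (largeSplitClusters_inter_le h.ne hw.cover.inter_le) ((Finite.mem_toFinset _).1 hY)
      ((Finite.mem_toFinset _).1 hZ) hne he.1.2 he.2.2))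
  have h2 : nullity (genericMatroid κ (SplitVertex V))
      (⋃ Z ∈ (largeSplitClusters X a b Gs).toFinite.toFinset,
        {e ∈ Gs.edgeSet ∪ splitLifts X a b Gs | ∀ v ∈ e, v ∈ Z}) ≤
      nullity (genericMatroid κ (SplitVertex V)) (Gs.edgeSet ∪ splitLifts X a b Gs) :=
    nullity_mono (iUnion₂_subset fun Z _ e he => he.1)
  have hGs : (genericMatroid κ (SplitVertex V)).Indep Gs.edgeSet := by
    obtain ⟨p, hp⟩ := (genericMatroid_indep_iff.1 hw.indep).2
    exact genericMatroid_indep_iff.2 ⟨fun e he => ⟨not_isDiag_of_mem_edgeSet he, fun _ _ => trivial⟩,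
      _, linearIndepOn_edgeRow_of_injOn (splitCollapse a b) p h.injOn_collapse h.mapsTo_collapse hp⟩
  have h3 := edgeRank_mono (M := genericMatroid κ (SplitVertex V))
    (subset_union_left (s := Gs.edgeSet) (t := splitLifts X a b Gs))
  rw [edgeRank_eq_ncard hGs] at h3
  have h4 := ncard_union_eq_add_sdiff Gs.edgeSet (splitLifts X a b Gs)
  have h5 : nullity (genericMatroid κ (SplitVertex V)) (Gs.edgeSet ∪ splitLifts X a b Gs) =
    (Gs.edgeSet ∪ splitLifts X a b Gs).ncard - edgeRank (genericMatroid κ (SplitVertex V))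
      (Gs.edgeSet ∪ splitLifts X a b Gs) := rfl
  omega

end IsSafeBaseWitness

end SplitNullity

/-! ### A tight cover of the glued graph -/

section Glued

variable {V : Type*}

theorem doubleButterfly_adj_hinge (t : Quad) (i : Fin 2) :
    doubleButterfly.Adj (Sum.inl t) (earHinge i) := by
  rcases t with j | j
  all_goals
    refine ⟨by simp, j, ?_, ?_, ?_, ?_⟩
    · simp [butterflyVerts]
    · rcases fin_two_eq_zero_or_one i with rfl | rfl <;> simp [butterflyVerts]
    · simp
    · simp

theorem doubleButterfly_not_adj_inl (s t : Quad) :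
    ¬ doubleButterfly.Adj (Sum.inl s) (Sum.inl t) := by
  intro h
  have h' : s(Sum.inl s, Sum.inl t) ∈ doubleButterfly.edgeSet := h
  rcases edgeSet_doubleButterfly_subset h' with ⟨i, r, h⟩ | h
  · simp at h
  · obtain ⟨i, x, -, h⟩ := mem_iUnion.1 h
    simp at h

variable {G : GraphOn V} {a b : V} {Gs : GraphOn (SplitVertex V)} {σ : Quad ≃ Quad}

theorem glueDoubleButterfly_adj_of_adj {x y : SplitVertex V} (h : Gs.Adj x y) :
    (glueDoubleButterfly Gs σ).Adj (Sum.inl x) (Sum.inl y) := by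
  have : s(Sum.inl x, Sum.inl y) ∈ (glueDoubleButterfly Gs σ).edgeSet := by
    rw [edgeSet_glueDoubleButterfly]
    exact Or.inl ⟨s(x, y), h, rfl⟩
  exact this

theorem glueDoubleButterfly_adj_of_ear_adj {x y : EarVertex} (h : doubleButterfly.Adj x y) :
    (glueDoubleButterfly Gs σ).Adj (earInclusion V σ x) (earInclusion V σ y) := by
  have : s(earInclusion V σ x, earInclusion V σ y) ∈ (glueDoubleButterfly Gs σ).edgeSet := by
    rw [edgeSet_glueDoubleButterfly]
    exact Or.inr ⟨s(x, y), h, rfl⟩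
  exact this

theorem glueDoubleButterfly_adj_hinge (t : Quad) (i : Fin 2) :
    (glueDoubleButterfly Gs σ).Adj (Sum.inl (Sum.inr t)) (Sum.inr (Sum.inl i)) := by
  have := glueDoubleButterfly_adj_of_ear_adj (Gs := Gs) (σ := σ)
    (doubleButterfly_adj_hinge (σ.symm t) i)
  simpa [earInclusion] using this

theorem earInclusion_mem_verts (x : EarVertex) :
    earInclusion V σ x ∈ (glueDoubleButterfly Gs σ).verts :=
  Or.inr ⟨x, trivial, rfl⟩

theorem inr_mem_verts (t : Quad) :
    (Sum.inr t : GluedVertex V) ∈ (glueDoubleButterfly Gs σ).verts :=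
  earInclusion_mem_verts (Sum.inr t)

theorem inl_inr_mem_verts (t : Quad) :
    (Sum.inl (Sum.inr t) : GluedVertex V) ∈ (glueDoubleButterfly Gs σ).verts := by
  have := earInclusion_mem_verts (Gs := Gs) (σ := σ) (Sum.inl (σ.symm t))
  simpa [earInclusion] using this

theorem inl_mem_verts {x : SplitVertex V} (hx : x ∈ Gs.verts) :
    (Sum.inl x : GluedVertex V) ∈ (glueDoubleButterfly Gs σ).verts :=
  Or.inl ⟨x, hx, rfl⟩

theorem IsNonedgeSplit.not_glueDoubleButterfly_adj (h : IsNonedgeSplit G a b Gs) (s t : Quad) :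
    ¬ (glueDoubleButterfly Gs σ).Adj (Sum.inl (Sum.inr s)) (Sum.inl (Sum.inr t)) := by
  intro hadj
  have hadj' : s(Sum.inl (Sum.inr s), Sum.inl (Sum.inr t)) ∈
    (glueDoubleButterfly Gs σ).edgeSet := hadj
  rw [edgeSet_glueDoubleButterfly] at hadj'
  rcases hadj' with ⟨e, he, hst⟩ | ⟨e, he, hst⟩
  · have : e = s(Sum.inr s, Sum.inr t) := Sym2.map.injective Sum.inl_injective hst
    subst this
    rcases s with i | i
    · obtain ⟨v, -, hv⟩ := h.exists_of_aCopy_adj he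
      simp at hv
    · obtain ⟨v, -, hv⟩ := h.exists_of_bCopy_adj he
      simp at hv
  · have : e = s(Sum.inl (σ.symm s), Sum.inl (σ.symm t)) := by
      refine Sym2.map.injective (earInclusion V σ).injective (hst.trans ?_)
      simp [earInclusion]
    subst this
    exact doubleButterfly_not_adj_inl _ _ he

variable [Finite V] {κ : GenericKind} {X : Set (Set V)}

/-- The images of the large clusters of the split graph in the glued graph. -/
def gluedClusters (X : Set (Set V)) (a b : V) (Gs : GraphOn (SplitVertex V)) :
    Set (Set (GluedVertex V)) :=
  image Sum.inl '' largeSplitClusters X a b Gs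

/-- The additional pairs in the count for the glued graph. -/
def gluedPairs (X : Set (Set V)) (a b : V) (Gs : GraphOn (SplitVertex V))
    (R : Set (Sym2 (GluedVertex V))) : Set (Sym2 (GluedVertex V)) :=
  Sym2.map Sum.inl '' (splitLifts X a b Gs ∪ splitKeyPairs X a b Gs) ∪ R

/-- The pair of hinges in the glued graph. -/
def hingePair (V : Type*) : Sym2 (GluedVertex V) := s(Sum.inr (Sum.inl 0), Sum.inr (Sum.inl 1))

/-- Sufficient conditions on the clusters covering the ear for the glued graph to be a safe base
graph. -/
structure IsEarFamily (κ : GenericKind) (X : Set (Set V)) (a b : V) (Gs : GraphOn (SplitVertex V))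
    (σ : Quad ≃ Quad) (i j : Fin 2) (L : Set (Set (GluedVertex V)))
    (R : Set (Sym2 (GluedVertex V))) : Prop where
  key_mem : s(aCopy V i, bCopy V j) ∈ splitKeyPairs X a b Gs
  key_subset : splitKeyPairs X a b Gs ⊆
    {s(aCopy V i, bCopy V j), s(aCopy V (1 - i), bCopy V (1 - j))}
  pairs_subset : R ⊆ {hingePair V}
  three_le : ∀ D ∈ L, 3 ≤ D.ncard
  key_cover : ∃ D ∈ L, Sum.inl (aCopy V i) ∈ D ∧ Sum.inl (bCopy V j) ∈ D
  hinge_mem : ∀ D ∈ L, Sum.inr (Sum.inl 0) ∈ D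
  inter_split : ∀ D ∈ L, ∃ k ∈ splitKeyPairs X a b Gs, ∀ x, Sum.inl x ∈ D → x ∈ k
  inter_ear : ∀ D ∈ L, ∀ D' ∈ L, D ≠ D' → hingePair V ∈ R ∧
    D ∩ D' ⊆ {Sum.inr (Sum.inl 0), Sum.inr (Sum.inl 1)}
  count : ((splitKeyPairs X a b Gs).ncard : ℤ) + R.ncard ≤ 1 + ∑ D ∈ L.toFinite.toFinset,
    nullity (genericMatroid κ (GluedVertex V))
      {e ∈ (glueDoubleButterfly Gs σ).edgeSet ∪ gluedPairs X a b Gs R | ∀ v ∈ e, v ∈ D}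

theorem ncard_sym2_le (k : Sym2 (SplitVertex V)) : {x | x ∈ k}.ncard ≤ 2 := by
  induction k with | _ x y
  have : {z | z ∈ s(x, y)} = {x, y} := by
    ext z
    simp
  rw [this]
  exact (ncard_insert_le _ _).trans (by simp)

namespace IsEarFamily

variable {i j : Fin 2} {L : Set (Set (GluedVertex V))} {R : Set (Sym2 (GluedVertex V))}
  (hL : IsEarFamily κ X a b Gs σ i j L R) (hw : IsSafeBaseWitness (genericMatroid κ V) G X a b Gs)
include hL hw

theorem indep_gluedPairs :
    (genericMatroid κ (GluedVertex V)).Indep (gluedPairs X a b Gs R) := by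
  have hM := genericMatroid_hasZeroExtensions κ (GluedVertex V)
  have h1 : (genericMatroid κ (GluedVertex V)).Indep
      (Sym2.map Sum.inl '' (splitLifts X a b Gs ∪ splitKeyPairs X a b Gs)) :=
    (genericMatroid_indep_image_iff Function.Embedding.inl).2
      (hw.indep_splitLifts_union hL.key_subset)
  refine (hM.zero_ext _ (Sum.inr (Sum.inl 0)) {Sum.inr (Sum.inl 1)} h1 ?_ (by simp)
    (by simp)).subset (union_subset_union_right _ ?_)
  · rintro ⟨_, ⟨e, -, rfl⟩, he⟩
    obtain ⟨x, -, hx⟩ := Sym2.mem_map.1 he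
    simp at hx
  · refine hL.pairs_subset.trans ?_
    rintro _ rfl
    exact ⟨_, rfl, rfl⟩

theorem inter_le : ∀ Y ∈ gluedClusters X a b Gs ∪ L, ∀ Z ∈ gluedClusters X a b Gs ∪ L, Y ≠ Z →
    (Y ∩ Z).ncard ≤ 2 := by
  have key : ∀ Y ∈ gluedClusters X a b Gs, ∀ Z ∈ L, (Y ∩ Z).ncard ≤ 2 := by
    rintro _ ⟨Y, hY, rfl⟩ Z hZ
    obtain ⟨k, -, hk⟩ := hL.inter_split Z hZ
    refine (ncard_le_ncard (t := Sum.inl '' {x | x ∈ k}) ?_).trans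
      ((ncard_image_le (toFinite _)).trans (ncard_sym2_le k))
    rintro _ ⟨⟨x, -, rfl⟩, hx⟩
    exact ⟨x, hk x hx, rfl⟩
  rintro Y (hY | hY) Z (hZ | hZ) hne
  · obtain ⟨Y, hY, rfl⟩ := hY
    obtain ⟨Z, hZ, rfl⟩ := hZ
    rw [← image_inter Sum.inl_injective, ncard_image_of_injective _ Sum.inl_injective]
    exact largeSplitClusters_inter_le hw.safe.ne hw.cover.inter_le _ hY _ hZ
      fun h => hne (by rw [h])
  · exact key Y hY Z hZ
  · rw [inter_comm]
    exact key Z hZ Y hY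
  · exact (ncard_le_ncard (hL.inter_ear Y hY Z hZ hne).2).trans
      ((ncard_insert_le _ _).trans (by simp))

theorem sharedSet_subset : sharedSet (gluedClusters X a b Gs ∪ L) ⊆ gluedPairs X a b Gs R := by
  have key : ∀ Y ∈ gluedClusters X a b Gs, ∀ Z ∈ L, ∀ e : Sym2 (GluedVertex V), ¬ e.IsDiag →
      (∀ v ∈ e, v ∈ Y) → (∀ v ∈ e, v ∈ Z) → e ∈ gluedPairs X a b Gs R := by
    rintro _ ⟨Y, hY, rfl⟩ Z hZ e he heY heZ
    obtain ⟨k, hk, hkZ⟩ := hL.inter_split Z hZ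
    induction e with | _ x y
    obtain ⟨x, -, rfl⟩ := heY x (Sym2.mem_mk_left _ _)
    obtain ⟨y, -, rfl⟩ := heY y (Sym2.mem_mk_right _ _)
    have hxy : x ≠ y := fun h => he (congrArg _ h)
    have : k = s(x, y) := (Sym2.mem_and_mem_iff hxy).1 ⟨hkZ x (heZ _ (Sym2.mem_mk_left _ _)),
      hkZ y (heZ _ (Sym2.mem_mk_right _ _))⟩
    exact Or.inl ⟨k, Or.inr hk, by rw [this]; rfl⟩
  intro e he
  have hd := not_isDiag_of_mem_sharedSet he
  obtain ⟨Y, hY, Z, hZ, hne, heY, heZ⟩ := exists_of_mem_sharedSet he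
  rcases hY with hY | hY <;> rcases hZ with hZ | hZ
  · obtain ⟨Y, hY, rfl⟩ := hY
    obtain ⟨Z, hZ, rfl⟩ := hZ
    induction e with | _ x y
    obtain ⟨x, hxY, rfl⟩ := heY x (Sym2.mem_mk_left _ _)
    obtain ⟨y, hyY, rfl⟩ := heY y (Sym2.mem_mk_right _ _)
    have hxZ := Sum.inl_injective.mem_set_image.1 (heZ _ (Sym2.mem_mk_left _ _))
    have hyZ := Sum.inl_injective.mem_set_image.1 (heZ _ (Sym2.mem_mk_right _ _))
    refine Or.inl ⟨s(x, y), sharedSet_largeSplitClusters_subset hw.safe.ne hw.cover.inter_le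
      (mem_sharedSet_of_mem (fun h => hd (congrArg _ h))
        (largeSplitClusters_inter_le hw.safe.ne hw.cover.inter_le) hY hZ
        (fun h => hne (by rw [h])) ?_ ?_), rfl⟩
    · simp [hxY, hyY]
    · simp [hxZ, hyZ]
  · exact key Y hY Z hZ e hd heY heZ
  · exact key Z hZ Y hY e hd heZ heY
  · have hi := hL.inter_ear Y hY Z hZ hne
    refine Or.inr ?_
    convert hi.1
    induction e with | _ x y
    have hx := hi.2 ⟨heY x (Sym2.mem_mk_left _ _), heZ x (Sym2.mem_mk_left _ _)⟩
    have hy := hi.2 ⟨heY y (Sym2.mem_mk_right _ _), heZ y (Sym2.mem_mk_right _ _)⟩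
    rcases hx with rfl | rfl <;> rcases hy with rfl | rfl
    exacts [(hd rfl).elim, rfl, Sym2.eq_swap, (hd rfl).elim]

/-- The split clusters pay for all lifted nonedges and have one unit left. By `count` this unit and
the ear clusters pay for the key pairs and R. -/
theorem ncard_gluedPairs_le :
    ((gluedPairs X a b Gs R \ (glueDoubleButterfly Gs σ).edgeSet).ncard : ℤ) ≤
      ∑ Y ∈ (gluedClusters X a b Gs ∪ L).toFinite.toFinset,
        nullity (genericMatroid κ (GluedVertex V))
          {e ∈ (glueDoubleButterfly Gs σ).edgeSet ∪ gluedPairs X a b Gs R | ∀ v ∈ e, v ∈ Y} := by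
  classical
  set ν : Set (GluedVertex V) → ℤ := fun Y => nullity (genericMatroid κ (GluedVertex V))
    {e ∈ (glueDoubleButterfly Gs σ).edgeSet ∪ gluedPairs X a b Gs R | ∀ v ∈ e, v ∈ Y} with hν
  have h1 : (gluedPairs X a b Gs R \ (glueDoubleButterfly Gs σ).edgeSet).ncard ≤
      (splitLifts X a b Gs \ Gs.edgeSet).ncard + (splitKeyPairs X a b Gs).ncard + R.ncard := by
    have : gluedPairs X a b Gs R \ (glueDoubleButterfly Gs σ).edgeSet ⊆
        Sym2.map Sum.inl '' (splitLifts X a b Gs \ Gs.edgeSet) ∪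
          Sym2.map Sum.inl '' splitKeyPairs X a b Gs ∪ R := by
      rw [edgeSet_glueDoubleButterfly]
      rintro _ ⟨⟨e, he | he, rfl⟩ | he, hE⟩
      · exact Or.inl (Or.inl ⟨e, ⟨he, fun h => hE (Or.inl ⟨e, h, rfl⟩)⟩, rfl⟩)
      · exact Or.inl (Or.inr ⟨e, he, rfl⟩)
      · exact Or.inr he
    refine (ncard_le_ncard this).trans ((ncard_union_le _ _).trans (Nat.add_le_add_right
      ((ncard_union_le _ _).trans (Nat.add_le_add ?_ ?_)) _))
    exacts [ncard_image_le (toFinite _), ncard_image_le (toFinite _)]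
  have h2 := hw.ncard_splitLifts_lt
  have h3 := hw.ncard_shared_le_sum_nullity
  have hdisj : Disjoint (gluedClusters X a b Gs).toFinite.toFinset L.toFinite.toFinset := by
    rw [Finset.disjoint_left]
    intro Y hY hY'
    rw [Finite.mem_toFinset] at hY hY'
    obtain ⟨Z, -, rfl⟩ := hY
    obtain ⟨x, -, hx⟩ := hL.hinge_mem _ hY'
    simp at hx
  have h4 : ∑ Y ∈ (gluedClusters X a b Gs ∪ L).toFinite.toFinset, ν Y =
      ∑ Y ∈ (gluedClusters X a b Gs).toFinite.toFinset, ν Y + ∑ Y ∈ L.toFinite.toFinset, ν Y := by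
    rw [← Finset.sum_union hdisj]
    congr 1
    ext Y
    simp
  have h5 : (gluedClusters X a b Gs).toFinite.toFinset =
      (largeSplitClusters X a b Gs).toFinite.toFinset.image (image Sum.inl) := by
    ext Y
    simp [gluedClusters]
  have h6 : ∑ Z ∈ (largeSplitClusters X a b Gs).toFinite.toFinset,
        nullity (genericMatroid κ (SplitVertex V))
          {e ∈ Gs.edgeSet ∪ (splitLifts X a b Gs ∪ splitKeyPairs X a b Gs) | ∀ v ∈ e, v ∈ Z} ≤
      ∑ Y ∈ (gluedClusters X a b Gs).toFinite.toFinset, ν Y := by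
    rw [h5, Finset.sum_image (Sum.inl_injective.image_injective.injOn)]
    refine Finset.sum_le_sum fun Z _ => ?_
    rw [← nullity_genericMatroid_image (Function.Embedding.inl (β := Quad))]
    refine nullity_mono ?_
    rintro _ ⟨e, ⟨he, heZ⟩, rfl⟩
    refine ⟨?_, ?_⟩
    · rcases he with he | he
      · rw [edgeSet_glueDoubleButterfly]
        exact Or.inl (Or.inl ⟨e, he, rfl⟩)
      · exact Or.inr (Or.inl ⟨e, he, rfl⟩)
    · intro v hv
      obtain ⟨x, hx, rfl⟩ := Sym2.mem_map.1 hv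
      exact ⟨x, heZ x hx, rfl⟩
  have h7 := hL.count
  rw [h4]
  have h8 : ∑ D ∈ L.toFinite.toFinset, nullity (genericMatroid κ (GluedVertex V))
      {e ∈ (glueDoubleButterfly Gs σ).edgeSet ∪ gluedPairs X a b Gs R | ∀ v ∈ e, v ∈ D} =
    ∑ Y ∈ L.toFinite.toFinset, ν Y := rfl
  omega

/-- A copy belongs to a split cluster only because of a neighbour there, an ear cluster contains a
hinge, and an edge cluster contains the other end. -/
theorem exists_adj_of_mem {Y : Set (GluedVertex V)}
    (hY : Y ∈ edgeCompletion (glueDoubleButterfly Gs σ) (gluedClusters X a b Gs ∪ L)) {t : Quad}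
    (ht : Sum.inl (Sum.inr t) ∈ Y) :
    ∃ y ∈ Y, (glueDoubleButterfly Gs σ).Adj (Sum.inl (Sum.inr t)) y := by
  have h := hw.safe.toIsNonedgeSplit
  rcases hY with (⟨Z, ⟨Y₀, hY₀, rfl, -, -⟩, rfl⟩ | hY) | ⟨x, y, hxy, rfl, -⟩
  · have ht' := Sum.inl_injective.mem_set_image.1 ht
    obtain ⟨y, hy, hadj⟩ : ∃ y ∈ Y₀, Gs.Adj (Sum.inr t) (Sum.inl y) := by
      rcases t with k | k
      exacts [(mem_splitCluster_aCopy.1 ht').2, (mem_splitCluster_bCopy.1 ht').2]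
    exact ⟨_, ⟨Sum.inl y, mem_splitCluster_inl.2 ⟨hy, (h.notMem_of_inl_mem hadj.snd_mem).2⟩, rfl⟩,
      glueDoubleButterfly_adj_of_adj hadj⟩
  · exact ⟨_, hL.hinge_mem Y hY, glueDoubleButterfly_adj_hinge t 0⟩
  · rcases ht with rfl | rfl
    exacts [⟨y, by simp, hxy⟩, ⟨x, by simp, hxy.symm⟩]

theorem isSafeBaseGraph :
    IsSafeBaseGraph (genericMatroid κ (GluedVertex V)) (glueDoubleButterfly Gs σ) := by
  have h := hw.safe.toIsNonedgeSplit
  have hind := h.isIndependent_glueDoubleButterfly (κ := κ) hw.indep σ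
  have hsub : ∀ Y ∈ gluedClusters X a b Gs ∪ L, Y ⊆ (glueDoubleButterfly Gs σ).verts := by
    rintro _ (⟨_, ⟨Y, hY, rfl, -, -⟩, rfl⟩ | hY)
    · rintro _ ⟨x, hx, rfl⟩
      exact inl_mem_verts (h.splitCluster_subset_verts (hw.cover.subset_verts Y hY) hx)
    · rintro (x | t) hx
      · obtain ⟨k, ⟨k₁, k₂, rfl, -⟩, hk⟩ := hL.inter_split _ hY
        rcases Sym2.mem_iff.1 (hk x hx) with rfl | rfl
        exacts [inl_inr_mem_verts _, inl_inr_mem_verts _]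
      · exact inr_mem_verts t
  have h3 : ∀ Y ∈ gluedClusters X a b Gs ∪ L, 3 ≤ Y.ncard := by
    rintro _ (⟨_, ⟨Y, hY, rfl, hlt, -⟩, rfl⟩ | hY)
    · rw [ncard_image_of_injective _ Sum.inl_injective]
      exact hlt
    · exact hL.three_le _ hY
  have hthin := hL.inter_le hw
  have hshared := sharedSet_edgeCompletion hsub h3 hthin
  have hS := (hL.indep_gluedPairs hw).subset (hL.sharedSet_subset hw)
  have hcover := isTwoThinCover_edgeCompletion hsub h3 hthin
  refine ⟨edgeCompletion (glueDoubleButterfly Gs σ) (gluedClusters X a b Gs ∪ L),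
    Sum.inl (aCopy V i), Sum.inl (bCopy V j), _, hind, hcover, hshared ▸ hS, ?_,
    IsSplittableNonedge.isSafeNonedgeSplit ?_⟩
  · exact edgeRank_eq_inclExcl_edgeCompletion hind hsub h3 hthin hS (hL.sharedSet_subset hw)
      (fun e he => ((genericMatroid_hasZeroExtensions κ _).subset_pairsIn
        (hL.indep_gluedPairs hw) he).1) (hL.ncard_gluedPairs_le hw)
  · refine ⟨inl_inr_mem_verts _, inl_inr_mem_verts _, by simp, h.not_glueDoubleButterfly_adj _ _,
      ?_, ?_, ?_⟩
    · obtain ⟨i', j', he, Z, hZ, hi, hj⟩ := hL.key_mem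
      obtain ⟨D, hD, hDi, hDj⟩ := hL.key_cover
      have hij : i = i' ∧ j = j' := by simpa using he
      obtain ⟨rfl, rfl⟩ := hij
      rw [hshared]
      refine mem_sharedSet_of_mem (by simp) hthin (Or.inl ⟨Z, hZ, rfl⟩) (Or.inr hD) ?_ ?_ ?_
      · rintro rfl
        obtain ⟨x, -, hx⟩ := hL.hinge_mem _ hD
        simp at hx
      · intro v hv
        rcases Sym2.mem_iff.1 hv with rfl | rfl
        exacts [⟨_, hi, rfl⟩, ⟨_, hj, rfl⟩]
      · simp [hDi, hDj]
    -- Both sides of the agreement condition are true, since every cluster at a gluing vertex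
    -- contains a neighbour of it.
    · intro Y hY Z hZ u _ hYZ _ _
      have hm : Sum.inl (aCopy V i) ∈ Y ∩ Z := hYZ ▸ mem_insert _ _
      exact iff_of_true (hL.exists_adj_of_mem hw hY hm.1) (hL.exists_adj_of_mem hw hZ hm.2)
    · intro Y hY Z hZ u _ hYZ _ _
      have hm : Sum.inl (bCopy V j) ∈ Y ∩ Z := hYZ ▸ mem_insert _ _
      exact iff_of_true (hL.exists_adj_of_mem hw hY hm.1) (hL.exists_adj_of_mem hw hZ hm.2)

end IsEarFamily

end Glued

/-! ### The double-butterfly split-and-glue -/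

section SplitAndGlue

variable {V : Type*} [Finite V] {κ : GenericKind} {G : GraphOn V} {X : Set (Set V)} {a b : V}
  {Gs : GraphOn (SplitVertex V)} {σ : Quad ≃ Quad}

theorem nullity_pairsIn_of_ncard_five {W : Type*} [Finite W] {M : Matroid (Sym2 W)}
    (hM : HasZeroExtensions M) {U : Set W} (hU : U.ncard = 5) : nullity M (pairsIn U) = 1 := by
  rw [nullity, hM.edgeRank_pairsIn, ncard_pairsIn, hU]
  rfl

theorem ncard_butterflyVerts (l : Fin 2) : (butterflyVerts l).ncard = 5 := by
  have : butterflyVerts l = (({Sum.inl (Sum.inl l), Sum.inl (Sum.inr l), earHinge 0, earHinge 1,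
      earTip l} : Finset EarVertex) : Set EarVertex) := by
    simp [butterflyVerts]
  rw [this, ncard_coe_finset]
  clear this
  revert l
  decide

/-- The image of a butterfly in the glued graph. -/
def butterflyCluster (V : Type*) (σ : Quad ≃ Quad) (l : Fin 2) : Set (GluedVertex V) :=
  earInclusion V σ '' butterflyVerts l

theorem inl_mem_butterflyCluster {x : SplitVertex V} {l : Fin 2} :
    Sum.inl x ∈ butterflyCluster V σ l ↔
      x = Sum.inr (σ (Sum.inl l)) ∨ x = Sum.inr (σ (Sum.inr l)) := by
  constructor
  · rintro ⟨y, rfl | rfl | rfl | rfl | rfl, h⟩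
    · exact Or.inl (Sum.inl_injective h).symm
    · exact Or.inr (Sum.inl_injective h).symm
    all_goals simp [earInclusion] at h
  · rintro (rfl | rfl)
    exacts [⟨_, Or.inl rfl, rfl⟩, ⟨_, Or.inr (Or.inl rfl), rfl⟩]

theorem inr_mem_butterflyCluster {t : Quad} {l : Fin 2} :
    (Sum.inr t : GluedVertex V) ∈ butterflyCluster V σ l ↔
      t = Sum.inl 0 ∨ t = Sum.inl 1 ∨ t = Sum.inr l := by
  constructor
  · rintro ⟨y, rfl | rfl | rfl | rfl | rfl, h⟩
    · simp [earInclusion] at h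
    · simp [earInclusion] at h
    · exact Or.inl (Sum.inr_injective h).symm
    · exact Or.inr (Or.inl (Sum.inr_injective h).symm)
    · exact Or.inr (Or.inr (Sum.inr_injective h).symm)
  · rintro (rfl | rfl | rfl)
    exacts [⟨earHinge 0, by simp [butterflyVerts], rfl⟩, ⟨earHinge 1, by simp [butterflyVerts], rfl⟩,
      ⟨earTip l, by simp [butterflyVerts], rfl⟩]

/-- The gluing pair and the hinge pair complete the butterfly to K₅, which has ten pairs and rank
nine. -/
theorem one_le_nullity_butterflyCluster {R : Set (Sym2 (GluedVertex V))}
    (hR : hingePair V ∈ R) {l : Fin 2}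
    (hk : s(Sum.inr (σ (Sum.inl l)), Sum.inr (σ (Sum.inr l))) ∈ splitKeyPairs X a b Gs) :
    1 ≤ nullity (genericMatroid κ (GluedVertex V))
      {e ∈ (glueDoubleButterfly Gs σ).edgeSet ∪ gluedPairs X a b Gs R |
        ∀ v ∈ e, v ∈ butterflyCluster V σ l} := by
  have hM := genericMatroid_hasZeroExtensions κ (GluedVertex V)
  rw [← nullity_pairsIn_of_ncard_five hM (U := butterflyCluster V σ l) (by
    rw [butterflyCluster, ncard_image_of_injective _ (earInclusion V σ).injective,
      ncard_butterflyVerts])]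
  refine nullity_mono fun e he => ⟨?_, he.2⟩
  induction e with | _ x y
  obtain ⟨hne, ⟨x, hx, rfl⟩, ⟨y, hy, rfl⟩⟩ := mk_mem_pairsIn.1 he
  by_cases h1 : s(x, y) = s(Sum.inl (Sum.inl l), Sum.inl (Sum.inr l))
  · refine Or.inr (Or.inl ⟨_, Or.inr hk, ?_⟩)
    exact (congrArg (Sym2.map (earInclusion V σ)) h1).symm
  by_cases h2 : s(x, y) = s(earHinge 0, earHinge 1)
  · refine Or.inr (Or.inr ?_)
    convert hR
    exact congrArg (Sym2.map (earInclusion V σ)) h2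
  · exact Or.inl (glueDoubleButterfly_adj_of_ear_adj
      ⟨fun h => hne (congrArg _ h), l, hx, hy, h1, h2⟩)

variable (hw : IsSafeBaseWitness (genericMatroid κ V) G X a b Gs)
  {XH : Set (Set EarVertex)}
  (hH : IsSafeEarCover (genericMatroid κ EarVertex) doubleButterfly (range Sum.inl) XH)
  (hσ : ∀ s t : Quad, s((Sum.inl s : EarVertex), Sum.inl t) ∈ keyPairs (range Sum.inl) XH ↔
    s((Sum.inr (σ s) : SplitVertex V), Sum.inr (σ t)) ∈
      keyPairs (range Sum.inr) (safeSplitCover X a b Gs))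

include hw hH hσ

/-- The matching of key pairs transports the description of the key pairs of the ear through σ. The
two gluing pairs are disjoint, so the second key pair uses the opposite copy of each end. -/
theorem exists_gluingPair_of_splitKeyPairs {i j i' j' : Fin 2}
    (h : s(aCopy V i, bCopy V j) ∈ splitKeyPairs X a b Gs)
    (h' : s(aCopy V i', bCopy V j') ∈ splitKeyPairs X a b Gs) (hne : ¬ (i' = i ∧ j' = j)) :
    i' = 1 - i ∧ j' = 1 - j ∧ ∃ l,
      s(aCopy V i, bCopy V j) = s(Sum.inr (σ (Sum.inl l)), Sum.inr (σ (Sum.inr l))) ∧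
      s(aCopy V i', bCopy V j') =
        s(Sum.inr (σ (Sum.inl (1 - l))), Sum.inr (σ (Sum.inr (1 - l)))) := by
  rw [← hw.safe.toIsNonedgeSplit.keyPairs_eq] at h h'
  have key : ∀ i j : Fin 2, s(aCopy V i, bCopy V j) ∈
      keyPairs (range Sum.inr) (safeSplitCover X a b Gs) →
      s(Sum.inl (σ.symm (Sum.inl i)), Sum.inl (σ.symm (Sum.inr j))) ∈
        keyPairs (range Sum.inl) XH := by
    intro i j hij
    rw [hσ, σ.apply_symm_apply, σ.apply_symm_apply]
    exact hij
  obtain ⟨l, h1, h2⟩ := hH.eq_gluingPair (key i j h) (key i' j' h') (by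
    intro heq
    have := Sym2.map.injective σ.symm.injective
      (a₁ := s(Sum.inl i, Sum.inr j)) (a₂ := s(Sum.inl i', Sum.inr j')) heq
    simp only [Sym2.eq_iff, Sum.inl.injEq, Sum.inr.injEq, reduceCtorEq, and_false,
      or_false] at this
    exact hne ⟨this.1.symm, this.2.symm⟩)
  have e1 : s(Sum.inl i, Sum.inr j) = s(σ (Sum.inl l), σ (Sum.inr l)) := by
    have := congrArg (Sym2.map σ) h1
    simpa using this
  have e2 : s(Sum.inl i', Sum.inr j') = s(σ (Sum.inl (1 - l)), σ (Sum.inr (1 - l))) := by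
    have := congrArg (Sym2.map σ) h2
    simpa using this
  have hl : l ≠ 1 - l := by
    clear * -
    revert l
    decide
  have hdisj : ∀ t : Quad, t ∈ s(Sum.inl i, Sum.inr j) → t ∈ s(Sum.inl i', Sum.inr j') → False := by
    intro t ht ht'
    rw [e1] at ht
    rw [e2] at ht'
    rcases Sym2.mem_iff.1 ht with rfl | rfl <;> rcases Sym2.mem_iff.1 ht' with ht' | ht' <;>
      simp [hl] at ht'
  have hi : i ≠ i' := by
    rintro rfl
    exact hdisj _ (Sym2.mem_mk_left _ _) (Sym2.mem_mk_left _ _)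
  have hj : j ≠ j' := by
    rintro rfl
    exact hdisj _ (Sym2.mem_mk_right _ _) (Sym2.mem_mk_right _ _)
  have hsub : ∀ i i' : Fin 2, i ≠ i' → i' = 1 - i := by decide
  exact ⟨hsub i i' hi, hsub j j' hj, l, congrArg (Sym2.map Sum.inr) e1,
    congrArg (Sym2.map Sum.inr) e2⟩

/-- A safe double-butterfly split-and-glue gives a safe base graph. -/
theorem isSafeBaseGraph_glueDoubleButterfly :
    IsSafeBaseGraph (genericMatroid κ (GluedVertex V)) (glueDoubleButterfly Gs σ) := by
  classical
  obtain ⟨k, hk⟩ := hw.splitKeyPairs_nonempty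
  obtain ⟨i, j, rfl, -⟩ := id hk
  have hsub : splitKeyPairs X a b Gs ⊆
      {s(aCopy V i, bCopy V j), s(aCopy V (1 - i), bCopy V (1 - j))} := by
    intro k' hk'
    obtain ⟨i', j', rfl, -⟩ := id hk'
    by_cases hne : i' = i ∧ j' = j
    · exact Or.inl (by rw [hne.1, hne.2])
    · obtain ⟨h1, h2, -⟩ := exists_gluingPair_of_splitKeyPairs hw hH hσ hk hk' hne
      exact Or.inr (by rw [h1, h2]; rfl)
  by_cases hone : splitKeyPairs X a b Gs ⊆ {s(aCopy V i, bCopy V j)}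
  -- The slack of the split pays for the single key pair. The ear cluster only has to make this pair
  -- shared, and the hinge makes it a triple containing neighbours of both gluing vertices.
  · refine IsEarFamily.isSafeBaseGraph (L := {{Sum.inl (aCopy V i), Sum.inl (bCopy V j),
      Sum.inr (Sum.inl 0)}}) (R := ∅) (i := i) (j := j) ⟨hk, hsub, empty_subset _, ?_, ?_, ?_, ?_,
      ?_, ?_⟩ hw
    · rintro _ rfl
      rw [ncard_insert_of_notMem (by simp), ncard_pair (by simp)]
    · exact ⟨_, rfl, by simp, by simp⟩
    · rintro _ rfl
      simp
    · rintro _ rfl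
      exact ⟨_, hk, fun x hx => by simpa using hx⟩
    · rintro _ rfl _ rfl hne
      exact (hne rfl).elim
    · have h1 := (ncard_le_ncard hone).trans (ncard_singleton _).le
      have h2 : 0 ≤ ∑ D ∈ ({{Sum.inl (aCopy V i), Sum.inl (bCopy V j), Sum.inr (Sum.inl 0)}} :
          Set (Set (GluedVertex V))).toFinite.toFinset,
          nullity (genericMatroid κ (GluedVertex V))
            {e ∈ (glueDoubleButterfly Gs σ).edgeSet ∪ gluedPairs X a b Gs ∅ | ∀ v ∈ e, v ∈ D} :=
        Finset.sum_nonneg fun _ _ => nullity_nonneg _ _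
      rw [ncard_empty]
      omega
  · obtain ⟨k', hk', hne⟩ := not_subset.1 hone
    obtain ⟨i', j', rfl, -⟩ := id hk'
    obtain ⟨-, -, l, h1, h2⟩ := exists_gluingPair_of_splitKeyPairs hw hH hσ hk hk'
      (fun h => hne (by rw [h.1, h.2]; rfl))
    have hkey : ∀ m : Fin 2,
        s(Sum.inr (σ (Sum.inl m)), Sum.inr (σ (Sum.inr m))) ∈ splitKeyPairs X a b Gs := by
      intro m
      have : m = l ∨ m = 1 - l := by
        clear * -
        revert l m
        decide
      rcases this with rfl | rfl
      exacts [h1 ▸ hk, h2 ▸ hk']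
    have hBne : butterflyCluster V σ 0 ≠ butterflyCluster V σ 1 := by
      intro h
      have : (Sum.inr (Sum.inr 0) : GluedVertex V) ∈ butterflyCluster V σ 0 :=
        inr_mem_butterflyCluster.2 (by simp)
      rw [h, inr_mem_butterflyCluster] at this
      simp at this
    -- There are three new pairs to pay for: two key pairs and uv. The slack gives one unit, each
    -- completed butterfly another.
    refine IsEarFamily.isSafeBaseGraph (L := range (butterflyCluster V σ)) (R := {hingePair V})
      (i := i) (j := j) ⟨hk, hsub, Subset.rfl, ?_, ?_, ?_, ?_, ?_, ?_⟩ hw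
    · rintro _ ⟨m, rfl⟩
      rw [butterflyCluster, ncard_image_of_injective _ (earInclusion V σ).injective,
        ncard_butterflyVerts]
      norm_num
    · refine ⟨_, ⟨l, rfl⟩, ?_, ?_⟩
      · rw [inl_mem_butterflyCluster]
        exact Sym2.mem_iff.1 (h1 ▸ Sym2.mem_mk_left _ _)
      · rw [inl_mem_butterflyCluster]
        exact Sym2.mem_iff.1 (h1 ▸ Sym2.mem_mk_right _ _)
    · rintro _ ⟨m, rfl⟩
      exact inr_mem_butterflyCluster.2 (Or.inl rfl)
    · rintro _ ⟨m, rfl⟩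
      exact ⟨_, hkey m, fun x hx => Sym2.mem_iff.2 (inl_mem_butterflyCluster.1 hx)⟩
    · rintro _ ⟨m, rfl⟩ _ ⟨m', rfl⟩ hmm
      have hm : m ≠ m' := fun h => hmm (congrArg _ h)
      refine ⟨rfl, ?_⟩
      rintro (x | t) ⟨hx, hx'⟩
      · rw [inl_mem_butterflyCluster] at hx hx'
        rcases hx with rfl | rfl <;> rcases hx' with h | h <;> simp [hm] at h
      · rw [inr_mem_butterflyCluster] at hx hx'
        rcases hx with rfl | rfl | rfl
        · simp
        · simp
        · simp [hm] at hx'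
    · have h3 := ncard_le_ncard hsub
      have h4 := h3.trans ((ncard_insert_le _ _).trans (Nat.succ_le_succ (ncard_singleton _).le))
      have h5 : (range (butterflyCluster V σ)).toFinite.toFinset =
          {butterflyCluster V σ 0, butterflyCluster V σ 1} := by
        ext D
        simp [Fin.exists_fin_two, eq_comm]
      rw [h5, Finset.sum_pair hBne, ncard_singleton]
      have h6 := one_le_nullity_butterflyCluster (κ := κ) (R := {hingePair V}) rfl (hkey 0)
      have h7 := one_le_nullity_butterflyCluster (κ := κ) (R := {hingePair V}) rfl (hkey 1)
      omega

end SplitAndGlue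

theorem mainTheorem11 :
    (∀ (κ : GenericKind) {V : Type*} [Finite V] (G : GraphOn V) (G' : GraphOn (GluedVertex V)),
      IsSafeBaseGraph (genericMatroid κ V) G → IsNucleationFree (genericMatroid κ V) G →
      IsSafeDoubleButterflySplitAndGlue κ G G' →
        IsNucleationFree (genericMatroid κ (GluedVertex V)) G' ∧
          IsSafeBaseGraph (genericMatroid κ (GluedVertex V)) G') ∧
    (∀ {V : Type*} [Finite V] (M : Matroid (Sym2 V)),
      ((∃ κ, M = genericMatroid κ V) ∨ IsAbstractRigidityMatroid M) →
      ∀ G : GraphOn V, IsSafeBaseGraph M G → IsNucleationFree M G →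
        (∀ (k : ℕ) (H G' : GraphOn V), IsIndependent M H → IsNucleationFree M H →
          IsKSum k G H G' →
          (k ≤ 2 ∨ k = 3 ∧
            (¬ IsInKFour G (G.verts ∩ H.verts) ∨ ¬ IsInKFour H (G.verts ∩ H.verts))) →
            IsNucleationFree M G' ∧ IsSafeBaseGraph M G') ∧
        (∀ (W : Set V) (w : V) (G' : GraphOn V), IsHennebergI G W w G' → ¬ IsInKFour G W →
            IsNucleationFree M G' ∧ IsSafeBaseGraph M G')) := by
  refine ⟨?_, ?_⟩
  · rintro κ V _ G G' - hGn ⟨X, a, b, Gs, hw, XH, hH, σ, hσ, rfl⟩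
    exact ⟨hw.safe.toIsNonedgeSplit.isNucleationFree_glueDoubleButterfly hw.indep hGn σ,
      isSafeBaseGraph_glueDoubleButterfly hw hH hσ⟩
  · intro V _ M hM G hG hGn
    have hM : HasZeroExtensions M := by
      rcases hM with ⟨κ, rfl⟩ | hM
      exacts [genericMatroid_hasZeroExtensions κ V, hM.hasZeroExtensions]
    exact ⟨fun k H G' hH hHn h hk => hM.ksum hG hGn hH hHn h hk,
      fun W w G' h hW => hM.hennebergI hG hGn h hW⟩
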